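/- **Notation.** All graphs are finite and simple. Two graphs with adjacency matrices $A,A'$ are $\mathbb R$-cospectral if $A+rJ$ and $A'+rJ$ have the same multiset of eigenvalues for every $r\in\mathbb R$, where $J$ is the all-ones matrix. A square real matrix is regular orthogonal if it is orthogonal with constant row sum; its level is the least positive integer $\ell$ (if any) for which $\ell$ times the matrix is integral; it is decomposable if some permutation of its rows and some permutation of its columns make it block diagonal with at least two nonempty square blocks. Put $$R_{12}=\tfrac12\,\mathrm{circulant}(J,O,O,O,O,Y)=\tfrac12\begin{bmatrix}J&O&O&O&O&Y\\Y&J&O&O&O&O\\O&Y&J&O&O&O\\O&O&Y&J&O&O\\O&O&O&Y&J&O\\O&O&O&O&Y&J\end{bmatrix},\qquad J=\begin{bmatrix}1&1\\1&1\end{bmatrix},\quad Y=2I-J .$$ For a regular orthogonal matrix $R$, let $\mathcal B_R$ be the set of adjacency matrices $B$ such that $R^TBR$ is an adjacency matrix. A matrix $B\in\mathcal B_R$ is *reducible* with respect to $R$ if there are decomposable regular orthogonal matrices $R_1,\dots,R_s$ with $R=R_1\cdots R_s$ such that, writing $Q=\mathrm{diag}(R,I)$ and $Q_i=\mathrm{diag}(R_i,I)$,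 for every adjacency matrix $A=\begin{bmatrix}B&V\\V^T&W\end{bmatrix}$ for which $Q^TAQ$ is an adjacency matrix and every $i<s$, the matrix $(Q_1\cdots Q_i)^TA(Q_1\cdots Q_i)$ is an adjacency matrix. Otherwise $B$ is *irreducible* with respect to $R$. Two $12\times12$ adjacency matrices, divided into $2\times 2$ blocks, are *equivalent* if one is obtained from the other by a sequence of the following operations: replacing an off-diagonal block $B_{ij}$ and its transpose $B_{ji}$ by $J-B_{ij}$ and $J-B_{ji}$; replacing $B$ by the adjacency matrix $J-I-B$ of the complement; replacing $B$ by $P^TBP$, where $P$ is a permutation matrix for which there is a permutation matrix $P'$ with $P^TR_{12}P'=R_{12}$. Let $T_1,\dots,T_{18}$ be the following matrices, where $O$ and $I$ are the zero and identity matrices of order 2 and $N=\begin{bmatrix}0&0\\1&1\end{bmatrix}$. $$T_{1}=\begin{bmatrix}O&O&I&O&N&O\\O&O&N&N^T&O&I\\I&N^T&O&N&O&O\\O&N&N^T&O&I&N^T\\N^T&O&O&I&O&N\\O&I&O&N&N^T&O\end{bmatrix},\quad T_{2}=\begin{bmatrix}O&O&I&O&N&N^T\\O&O&N&N^T&O&N\\I&N^T&O&N&O&O\\O&N&N^T&O&I&O\\N^T&O&O&I&O&I\\N&N^T&O&O&I&O\end{bmatrix},\quad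 T_{3}=\begin{bmatrix}O&O&I&I&I&N^T\\O&O&N&N^T&I&N\\I&N^T&O&O&I&I\\I&N&O&O&N&N^T\\I&I&I&N^T&O&O\\N&N^T&I&N&O&O\end{bmatrix},$$ $$T_{4}=\begin{bmatrix}O&O&I&I&N^T&I\\O&O&O&I&N&N\\I&O&O&N&N&N^T\\I&I&N^T&O&I&O\\N&N^T&N^T&I&O&I\\I&N^T&N&O&I&O\end{bmatrix},\quad T_{5}=\begin{bmatrix}O&O&I&I&N&O\\O&O&N&N^T&I&I\\I&N^T&O&N&O&I\\I&N&N^T&O&I&N^T\\N^T&I&O&I&O&N\\O&I&I&N&N^T&O\end{bmatrix},\quad T_{6}=\begin{bmatrix}O&O&I&I&N&N^T\\O&O&N&N^T&I&N\\I&N^T&O&N&O&I\\I&N&N^T&O&I&O\\N^T&I&O&I&O&I\\N&N^T&I&O&I&O\end{bmatrix},$$ $$T_{7}=\begin{bmatrix}O&O&I&N^T&N&O\\O&O&O&N&N&N^T\\I&O&O&N&O&O\\N&N^T&N^T&O&I&O\\N^T&N^T&O&I&O&I\\O&N&O&O&I&O\end{bmatrix},\quad T_{8}=\begin{bmatrix}O&O&I&N^T&N&O\\O&O&O&N&N&N^T\\I&O&O&N&N^T&O\\N&N^T&N^T&O&N&N^T\\N^T&N^T&N&N^T&O&N\\O&N&O&N&N^T&O\end{bmatrix},\quad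 T_{9}=\begin{bmatrix}O&O&I&N&N^T&N^T\\O&O&N&N^T&N^T&N\\I&N^T&O&O&N&O\\N^T&N&O&O&N&N^T\\N&N&N^T&N^T&O&O\\N&N^T&O&N&O&O\end{bmatrix},$$ $$T_{10}=\begin{bmatrix}O&O&I&N&N^T&N^T\\O&O&N&N^T&N^T&N\\I&N^T&O&O&N&N^T\\N^T&N&O&O&O&N\\N&N&N^T&O&O&O\\N&N^T&N&N^T&O&O\end{bmatrix},\quad T_{11}=\begin{bmatrix}O&O&N&N^T&N&O\\O&O&O&N&N&N^T\\N^T&O&O&N&N^T&N\\N&N^T&N^T&O&N&N^T\\N^T&N^T&N&N^T&O&N\\O&N&N^T&N&N^T&O\end{bmatrix},\quad T_{12}=\begin{bmatrix}O&O&N&N&N^T&N^T\\O&O&N&N^T&N^T&N\\N^T&N^T&O&O&N&N\\N^T&N&O&O&N&N^T\\N&N&N^T&N^T&O&O\\N&N^T&N^T&N&O&O\end{bmatrix},$$ $$T_{13}=\begin{bmatrix}O&I&O&I&N&N^T\\I&O&I&N&N^T&N^T\\O&I&O&I&N^T&N\\I&N^T&I&O&N&N^T\\N^T&N&N&N^T&O&N\\N&N&N^T&N&N^T&O\end{bmatrix},\quad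 T_{14}=\begin{bmatrix}O&I&N^T&O&N&N^T\\I&O&N&O&O&O\\N&N^T&O&I&N^T&O\\O&O&I&O&N&O\\N^T&O&N&N^T&O&I\\N&O&O&O&I&O\end{bmatrix},\quad T_{15}=\begin{bmatrix}O&I&N^T&I&N&N^T\\I&O&N&N&N^T&N^T\\N&N^T&O&I&N^T&N\\I&N^T&I&O&N&O\\N^T&N&N&N^T&O&I\\N&N&N^T&O&I&O\end{bmatrix},$$ $$T_{16}=\begin{bmatrix}O&I&N^T&N&N^T&I\\I&O&N&O&N&N^T\\N&N^T&O&I&N^T&N\\N^T&O&I&O&N&N\\N&N^T&N&N^T&O&I\\I&N&N^T&N^T&I&O\end{bmatrix},\quad T_{17}=\begin{bmatrix}O&I&N^T&N&N^T&I\\I&O&N&N^T&N&N^T\\N&N^T&O&N&N^T&N\\N^T&N&N^T&O&N&N\\N&N^T&N&N^T&O&I\\I&N&N^T&N^T&I&O\end{bmatrix},\quad T_{18}=\begin{bmatrix}O&I&N^T&N&N&N^T\\I&O&N&N&N^T&N^T\\N&N^T&O&I&N^T&N\\N^T&N^T&I&O&N&N\\N^T&N&N&N^T&O&I\\N&N&N^T&N^T&I&O\end{bmatrix}.$$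 **Theorem (twelve-vertex switching).** 1. *Switching.* Let $\Gamma$ be a graph with vertex set partitioned into $C_1,\dots,C_6,D$ ($D$ may be empty) such that (i) $|C_1|=\dots=|C_6|=2$; write $C_i=\{v_{i1},v_{i2}\}$; (ii) every vertex in $D$ has the same number of neighbours in $C_1,\dots,C_6$ modulo $2$; (iii) the adjacency matrix $B$ of the induced subgraph on $C_1\cup\dots\cup C_6$, with the vertices in the order $v_{11},v_{12},v_{21},\dots,v_{62}$, is equivalent to one of $T_1,\dots,T_{18}$ (for example, one of these matrices where any off-diagonal $2\times2$ blocks, together with their transposes, may be replaced by their complements). Let $\pi(v_{ia})=v_{i-1,a}$, with indices $i$ modulo $6$. For every $v\in D$ that has exactly one neighbour in each $C_i$, replace each edge $\{v,w\}$ with $w\in C_1\cup\dots\cup C_6$ by $\{v,\pi(w)\}$. Replace the induced subgraph on $C_1\cup\dots\cup C_6$ by the one with adjacency matrix $R_{12}^TBR_{12}$, and leave all other adjacencies unchanged. This gives a well-defined graph $\Gamma'$; its adjacency matrix is $A'=Q^TAQ$, where $A$ is the adjacency matrix of $\Gamma$ and $Q=\mathrm{diag}(R_{12},I)$; and $\Gamma'$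 is $\mathbb R$-cospectral with $\Gamma$. 2. *Classification.* A real $12\times 12$ matrix $B$ belongs to $\mathcal B_{R_{12}}$ and is irreducible with respect to $R_{12}$ if and only if it is equivalent to one of $T_1,\dots,T_{18}$, and no two of $T_1,\dots,T_{18}$ are equivalent. 3. *All indecomposable matrices of order 12.* Let $R$ be an indecomposable regular orthogonal matrix of order $12$, level $2$ and row sum $1$. Then there are permutation matrices $P,P'$ with $P^TRP'=R_{12}$ such that, for every real $12\times12$ matrix $B$: $B$ belongs to $\mathcal B_R$ and is irreducible with respect to $R$ if and only if $P^TBP$ is equivalent to one of $T_1,\dots,T_{18}$. -/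

import Mathlib

namespace TwelveSwitch

/-! Matrices of level two -/

section General

variable {ι : Type*} [Fintype ι] [DecidableEq ι]

/-- An orthogonal real matrix with constant row sum. -/
def IsRegularOrthogonal (M : Matrix ι ι ℝ) : Prop :=
  M ∈ Matrix.orthogonalGroup ι ℝ ∧ ∃ c : ℝ, ∀ i, ∑ j, M i j = c

/-- `l` is the smallest positive integer such that `l` times `M` is an integral matrix. -/
def HasLevel (M : Matrix ι ι ℝ) (l : ℕ) : Prop :=
  IsLeast {l : ℕ | 0 < l ∧ ∀ i j, ∃ z : ℤ, (l : ℝ) * M i j = z} l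

/-- Some permutation of the rows and some permutation of the columns bring `M` into a block
diagonal form with two nonempty square blocks: the first block has row set `S` and column
set `T`. -/
def IsDecomposable (M : Matrix ι ι ℝ) : Prop :=
  ∃ S T : Finset ι, S.Nonempty ∧ S ≠ Finset.univ ∧ S.card = T.card ∧
    ∀ i j, M i j ≠ 0 → (i ∈ S ↔ j ∈ T)

/-- The set of the adjacency matrices `B` for which `Rᵀ B R` is again an adjacency matrix. -/
def switchable (R : Matrix ι ι ℝ) : Set (Matrix ι ι ℝ) :=
  {B | B.IsAdjMatrix ∧ (R.transpose * B * R).IsAdjMatrix}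

/-- The matrix `diag(R, I)`, where the identity block has order `d`. -/
def extend (d : ℕ) (R : Matrix ι ι ℝ) : Matrix (ι ⊕ Fin d) (ι ⊕ Fin d) ℝ :=
  Matrix.fromBlocks R 0 0 1

/-- `B` is reducible with respect to `R`: there is a factorization `R = R₁ ⋯ Rₛ` into decomposable
regular orthogonal matrices such that, for every adjacency matrix `A` with upper left block `B`
to which the switching method of `R` applies, all the intermediate conjugates of `A`
are adjacency matrices. -/
def IsReducible (R B : Matrix ι ι ℝ) : Prop :=
  ∃ L : List (Matrix ι ι ℝ),
    (∀ S ∈ L, IsRegularOrthogonal S ∧ IsDecomposable S) ∧ L.prod = R ∧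
    ∀ (d : ℕ) (A : Matrix (ι ⊕ Fin d) (ι ⊕ Fin d) ℝ),
      A.IsAdjMatrix → A.toBlocks₁₁ = B →
      ((extend d R).transpose * A * extend d R).IsAdjMatrix →
      ∀ i < L.length,
        (((L.take i).map (extend d)).prod.transpose * A *
          ((L.take i).map (extend d)).prod).IsAdjMatrix

/-- `B` is the adjacency matrix of an irreducible switching set for `R`. -/
def IsIrreducible (R B : Matrix ι ι ℝ) : Prop :=
  B ∈ switchable R ∧ ¬ IsReducible R B

end General

/-! The matrix of order twelve and the equivalence of switching sets.
The vertex `(i, a)` is the vertex number `a` of the pair number `i`. -/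

/-- The matrix `R₁₂`, that is, half the block circulant matrix with first block row
`J, O, O, O, O, Y`, where `J` is the all-ones matrix of order two and `Y = 2 I - J`. -/
noncomputable def R12 : Matrix (Fin 6 × Fin 2) (Fin 6 × Fin 2) ℝ :=
  Matrix.of fun x y =>
    if y.1 = x.1 then 1 / 2
    else if y.1 = x.1 - 1 then (if x.2 = y.2 then 1 / 2 else -1 / 2)
    else 0

/-- Replace the block in position `(i, j)` and its transpose in position `(j, i)` by their
complements. -/
def blockCompl (i j : Fin 6) (B : Matrix (Fin 6 × Fin 2) (Fin 6 × Fin 2) ℝ) :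
    Matrix (Fin 6 × Fin 2) (Fin 6 × Fin 2) ℝ :=
  Matrix.of fun x y =>
    if (x.1 = i ∧ y.1 = j) ∨ (x.1 = j ∧ y.1 = i) then 1 - B x y else B x y

/-- The elementary equivalences: complementation of an off-diagonal block together with its
transpose, complementation of the whole matrix, and conjugation with a permutation matrix `P`
for which there is a permutation matrix `P'` with `Pᵀ R₁₂ P' = R₁₂`. -/
inductive Step : Matrix (Fin 6 × Fin 2) (Fin 6 × Fin 2) ℝ →
    Matrix (Fin 6 × Fin 2) (Fin 6 × Fin 2) ℝ → Prop
  | block (B : Matrix (Fin 6 × Fin 2) (Fin 6 × Fin 2) ℝ) (i j : Fin 6) (h : i ≠ j) :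
      Step B (blockCompl i j B)
  | compl (B : Matrix (Fin 6 × Fin 2) (Fin 6 × Fin 2) ℝ) :
      Step B (Matrix.of (fun _ _ => (1 : ℝ)) - 1 - B)
  | conj (B : Matrix (Fin 6 × Fin 2) (Fin 6 × Fin 2) ℝ) (p p' : Equiv.Perm (Fin 6 × Fin 2))
      (h : R12.submatrix p p' = R12) : Step B (B.submatrix p p)

/-- The equivalence relation generated by the elementary equivalences. -/
def Equivalent (B B' : Matrix (Fin 6 × Fin 2) (Fin 6 × Fin 2) ℝ) : Prop :=
  Relation.EqvGen Step B B'

/-! The eighteen switching sets -/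

/-- Names of four square blocks of order two. -/
inductive Blk
  | O | I | N | Nt
  deriving DecidableEq

/-- The blocks: zero, identity, `N` with rows `0 0` and `1 1`, and the transpose of `N`. -/
def Blk.toMatrix : Blk → Matrix (Fin 2) (Fin 2) ℝ
  | .O => !![0, 0; 0, 0]
  | .I => !![1, 0; 0, 1]
  | .N => !![0, 0; 1, 1]
  | .Nt => !![0, 1; 0, 1]

open Blk in
/-- The eighteen switching sets, written in blocks of order two. -/
def blockTable : Fin 18 → Matrix (Fin 6) (Fin 6) Blk :=
  ![
    !![O, O, I, O, N, O;
       O, O, N, Nt, O, I;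
       I, Nt, O, N, O, O;
       O, N, Nt, O, I, Nt;
       Nt, O, O, I, O, N;
       O, I, O, N, Nt, O],
    !![O, O, I, O, N, Nt;
       O, O, N, Nt, O, N;
       I, Nt, O, N, O, O;
       O, N, Nt, O, I, O;
       Nt, O, O, I, O, I;
       N, Nt, O, O, I, O],
    !![O, O, I, I, I, Nt;
       O, O, N, Nt, I, N;
       I, Nt, O, O, I, I;
       I, N, O, O, N, Nt;
       I, I, I, Nt, O, O;
       N, Nt, I, N, O, O],
    !![O, O, I, I, Nt, I;
       O, O, O, I, N, N;
       I, O, O, N, N, Nt;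
       I, I, Nt, O, I, O;
       N, Nt, Nt, I, O, I;
       I, Nt, N, O, I, O],
    !![O, O, I, I, N, O;
       O, O, N, Nt, I, I;
       I, Nt, O, N, O, I;
       I, N, Nt, O, I, Nt;
       Nt, I, O, I, O, N;
       O, I, I, N, Nt, O],
    !![O, O, I, I, N, Nt;
       O, O, N, Nt, I, N;
       I, Nt, O, N, O, I;
       I, N, Nt, O, I, O;
       Nt, I, O, I, O, I;
       N, Nt, I, O, I, O],
    !![O, O, I, Nt, N, O;
       O, O, O, N, N, Nt;
       I, O, O, N, O, O;
       N, Nt, Nt, O, I, O;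
       Nt, Nt, O, I, O, I;
       O, N, O, O, I, O],
    !![O, O, I, Nt, N, O;
       O, O, O, N, N, Nt;
       I, O, O, N, Nt, O;
       N, Nt, Nt, O, N, Nt;
       Nt, Nt, N, Nt, O, N;
       O, N, O, N, Nt, O],
    !![O, O, I, N, Nt, Nt;
       O, O, N, Nt, Nt, N;
       I, Nt, O, O, N, O;
       Nt, N, O, O, N, Nt;
       N, N, Nt, Nt, O, O;
       N, Nt, O, N, O, O],
    !![O, O, I, N, Nt, Nt;
       O, O, N, Nt, Nt, N;
       I, Nt, O, O, N, Nt;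
       Nt, N, O, O, O, N;
       N, N, Nt, O, O, O;
       N, Nt, N, Nt, O, O],
    !![O, O, N, Nt, N, O;
       O, O, O, N, N, Nt;
       Nt, O, O, N, Nt, N;
       N, Nt, Nt, O, N, Nt;
       Nt, Nt, N, Nt, O, N;
       O, N, Nt, N, Nt, O],
    !![O, O, N, N, Nt, Nt;
       O, O, N, Nt, Nt, N;
       Nt, Nt, O, O, N, N;
       Nt, N, O, O, N, Nt;
       N, N, Nt, Nt, O, O;
       N, Nt, Nt, N, O, O],
    !![O, I, O, I, N, Nt;
       I, O, I, N, Nt, Nt;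
       O, I, O, I, Nt, N;
       I, Nt, I, O, N, Nt;
       Nt, N, N, Nt, O, N;
       N, N, Nt, N, Nt, O],
    !![O, I, Nt, O, N, Nt;
       I, O, N, O, O, O;
       N, Nt, O, I, Nt, O;
       O, O, I, O, N, O;
       Nt, O, N, Nt, O, I;
       N, O, O, O, I, O],
    !![O, I, Nt, I, N, Nt;
       I, O, N, N, Nt, Nt;
       N, Nt, O, I, Nt, N;
       I, Nt, I, O, N, O;
       Nt, N, N, Nt, O, I;
       N, N, Nt, O, I, O],
    !![O, I, Nt, N, Nt, I;
       I, O, N, O, N, Nt;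
       N, Nt, O, I, Nt, N;
       Nt, O, I, O, N, N;
       N, Nt, N, Nt, O, I;
       I, N, Nt, Nt, I, O],
    !![O, I, Nt, N, Nt, I;
       I, O, N, Nt, N, Nt;
       N, Nt, O, N, Nt, N;
       Nt, N, Nt, O, N, N;
       N, Nt, N, Nt, O, I;
       I, N, Nt, Nt, I, O],
    !![O, I, Nt, N, N, Nt;
       I, O, N, N, Nt, Nt;
       N, Nt, O, I, Nt, N;
       Nt, Nt, I, O, N, N;
       Nt, N, N, Nt, O, I;
       N, N, Nt, Nt, I, O]]

/-- The eighteen switching sets as matrices of order twelve. -/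
def table (k : Fin 18) : Matrix (Fin 6 × Fin 2) (Fin 6 × Fin 2) ℝ :=
  Matrix.of fun x y => (blockTable k x.1 y.1).toMatrix x.2 y.2

/-! Graphs and switching.  The pairs `C₁, …, C₆` are given by an embedding `c` of the index set
of `R₁₂` into the vertex set, and `D` is the complement of its range. -/

section Graph

variable {V : Type*}

open Classical in
/-- The real adjacency matrix of a graph. -/
noncomputable def adj (G : SimpleGraph V) : Matrix V V ℝ := G.adjMatrix ℝ

/-- The graphs are `ℝ`-cospectral: for each real `r`, the matrices `A + r J` and `A' + r J` have
the same multiset of eigenvalues. -/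
def RCospectral [Fintype V] [DecidableEq V] (G G' : SimpleGraph V) : Prop :=
  ∀ r : ℝ, (adj G + r • Matrix.of (fun _ _ => (1 : ℝ))).charpoly.roots =
    (adj G' + r • Matrix.of (fun _ _ => (1 : ℝ))).charpoly.roots

/-- The `i`-th pair. -/
def pair (c : Fin 6 × Fin 2 ↪ V) (i : Fin 6) : Set V := {v | ∃ a, c (i, a) = v}

/-- The adjacency matrix of the induced subgraph on the union of the pairs. -/
noncomputable def inducedAdj (G : SimpleGraph V) (c : Fin 6 × Fin 2 ↪ V) :
    Matrix (Fin 6 × Fin 2) (Fin 6 × Fin 2) ℝ :=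
  (adj G).submatrix c c

/-- Each vertex outside the pairs has, modulo two, the same number of neighbours in
all the pairs. -/
def ParityCondition (G : SimpleGraph V) (c : Fin 6 × Fin 2 ↪ V) : Prop :=
  ∀ v ∉ Set.range c, ∀ i j : Fin 6,
    (G.neighborSet v ∩ pair c i).ncard ≡ (G.neighborSet v ∩ pair c j).ncard [MOD 2]

/-- The vertex `v` has exactly one neighbour in each pair. -/
def OneInEach (G : SimpleGraph V) (c : Fin 6 × Fin 2 ↪ V) (v : V) : Prop :=
  ∀ i : Fin 6, (G.neighborSet v ∩ pair c i).ncard = 1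

/-- `G'` is obtained from `G` by switching with respect to the pairs given by `c`. -/
structure IsSwitched (G G' : SimpleGraph V) (c : Fin 6 × Fin 2 ↪ V) : Prop where
  outside : ∀ u ∉ Set.range c, ∀ v ∉ Set.range c, (G'.Adj u v ↔ G.Adj u v)
  shift : ∀ v ∉ Set.range c, OneInEach G c v →
    ∀ i a, (G'.Adj v (c (i - 1, a)) ↔ G.Adj v (c (i, a)))
  keep : ∀ v ∉ Set.range c, ¬ OneInEach G c v → ∀ x, (G'.Adj v (c x) ↔ G.Adj v (c x))
  inside : inducedAdj G' c = R12.transpose * inducedAdj G c * R12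

open Classical in
/-- The matrix `diag(R₁₂, I)`, with rows and columns indexed by the vertex set.  The matrix `E` is
the 0-1 matrix of the embedding `c`. -/
noncomputable def extendAlong (c : Fin 6 × Fin 2 ↪ V) : Matrix V V ℝ :=
  let E : Matrix V (Fin 6 × Fin 2) ℝ := Matrix.of fun v x => if c x = v then 1 else 0
  1 + E * (R12 - 1) * E.transpose

end Graph

end TwelveSwitch

open TwelveSwitch

/-! ### The group of matrices that permute the differences of the pairs. -/

namespace TwelveSwitch
open Matrix

/-! Write `u_i` and `w_i` for the sum and the difference of the two basis vectors of pair `i`. The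
matrix `R12` fixes every `u_i` and maps `w_i` to `w_{i+1}`, so it is the member `pairMatrix shift`
of the family `pairMatrix τ`, which fixes every `u_i`, maps `w_i` to `w_{τ i}` and is multiplicative
in `τ`.

If `B` is switchable for `R12`, a parity argument around the cycle shows that every block has an
even number of ones (`exists_hasType`). An off-diagonal block is then `O`, `I`, `N` or `Nᵀ` up to
complement, and its name says which of the four characters of order-two blocks it carries.
Conjugation by `pairMatrix τ` recombines these characters, so whether it yields an adjacency matrix
depends only on the 6 × 6 array of names: this is `Fits` (`isAdjMatrix_conj_iff`). Elementary
equivalences change the array only by a rotation of the indices, since an automorphism of `R12`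
rotates the pairs, and conversely matrices with the same array are equivalent. Equivalence classes
of matrices that have such an array are therefore arrays modulo rotation.

An exhaustive search shows that an array fitting the shift is a rotation of a table entry or fits
some `τ` for which `pairMatrix τ` and `pairMatrix (τ⁻¹ * shift)` are both decomposable; in the
second case their product is a reduction of `R12`. For a table entry no reduction exists. The
vertices outside the switching set may have any adjacency vector admissible for `R12`, and an
orthogonal matrix whose transpose keeps all these vectors zero-one is a `pairMatrix τ` up to column
order (`exists_eq_pairMatrix`). For the table entries only the identity and the shift fit, so each
partial product of a reduction is a permutation matrix or `R12` with permuted columns. Passing from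
the first kind to the second needs an indecomposable factor, a contradiction.

For a general indecomposable `R` of order twelve, the supports of the rows of `2R` are connected
four-element sets with even intersections. The only obstruction to splitting the twelve columns into
pairs compatible with all the supports is a configuration of Hamming code type on seven or eight
points, which connectedness on twelve points excludes (`exists_pairing`). Orthogonality then makes
`R` a `pairMatrix τ` up to row and column order, and indecomposability makes `τ` a six-cycle,
conjugate to the shift. -/

/-- The sign attached to a vertex of a pair. -/
def sg (a : Fin 2) : ℝ := if a = 0 then 1 else -1

lemma sg_mul_self (a : Fin 2) : sg a * sg a = 1 := by unfold sg; split_ifs <;> norm_num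

lemma ite_eq_sg (a b : Fin 2) : (if a = b then (1 : ℝ) else -1) = sg a * sg b := by
  fin_cases a <;> fin_cases b <;> norm_num [sg]

@[simp] lemma sg_zero : sg 0 = 1 := rfl
@[simp] lemma sg_one : sg 1 = -1 := by simp [sg]

/-- The orthogonal matrix that fixes the sum of the two basis vectors of each pair and permutes
their differences according to `τ`. -/
noncomputable def pairMatrix (τ : Equiv.Perm (Fin 6)) : Matrix (Fin 6 × Fin 2) (Fin 6 × Fin 2) ℝ :=
  Matrix.of fun x y =>
    ((if y.1 = x.1 then 1 else 0) + (if τ y.1 = x.1 then sg x.2 * sg y.2 else 0)) / 2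

/-- The cyclic shift of the pairs. -/
abbrev shift : Equiv.Perm (Fin 6) := Equiv.addRight 1

lemma R12_eq : R12 = pairMatrix shift := by
  ext x y
  simp only [R12, pairMatrix, Matrix.of_apply, Equiv.coe_addRight, eq_sub_iff_add_eq, ← ite_eq_sg]
  by_cases h : y.1 = x.1
  · have : ¬ y.1 + 1 = x.1 := by rw [h]; simp
    simp [h]
  · simp only [h, if_false]
    split_ifs <;> norm_num

lemma pairMatrix_one : pairMatrix 1 = 1 := by
  ext ⟨i, a⟩ ⟨j, b⟩
  by_cases h : j = i
  · subst h
    fin_cases a <;> fin_cases b <;> norm_num [pairMatrix, Matrix.one_apply]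
  · have h' : ¬ i = j := fun e => h e.symm
    simp [pairMatrix, h, h']

/-- Both factors fix the pair sums, and on the pair differences they act as the permutations `σ` and
then `τ`. -/
lemma pairMatrix_mul (τ σ : Equiv.Perm (Fin 6)) :
    pairMatrix τ * pairMatrix σ = pairMatrix (τ * σ) := by
  ext ⟨i, a⟩ ⟨j, b⟩
  simp only [Matrix.mul_apply, Fintype.sum_prod_type, Fin.sum_univ_two, pairMatrix,
    Matrix.of_apply, sg_zero, sg_one, Equiv.Perm.mul_apply]
  have : ∀ k : Fin 6, ((if k = i then (1 : ℝ) else 0) + if τ k = i then sg a * 1 else 0) / 2 *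
        (((if j = k then 1 else 0) + if σ j = k then 1 * sg b else 0) / 2) +
      ((if k = i then 1 else 0) + if τ k = i then sg a * -1 else 0) / 2 *
        (((if j = k then 1 else 0) + if σ j = k then -1 * sg b else 0) / 2) =
      (if j = k then (if k = i then 1 / 2 else 0) else 0) +
      (if σ j = k then (if τ k = i then sg a * sg b / 2 else 0) else 0) := by
    intro k
    split_ifs <;> ring
  simp only [this, Finset.sum_add_distrib, Finset.sum_ite_eq, Finset.mem_univ, if_true]
  by_cases h : τ (σ j) = i <;> simp only [h, if_true, if_false] <;> split_ifs <;> ring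

lemma pairMatrix_transpose (τ : Equiv.Perm (Fin 6)) : (pairMatrix τ)ᵀ = pairMatrix τ⁻¹ := by
  ext ⟨i, a⟩ ⟨j, b⟩
  simp only [pairMatrix, Matrix.transpose_apply, Matrix.of_apply, Equiv.Perm.inv_eq_iff_eq]
  rw [mul_comm (sg a)]
  congr 2
  · simp only [eq_comm]
  · simp only [eq_comm]

lemma pairMatrix_mem (τ : Equiv.Perm (Fin 6)) :
    pairMatrix τ ∈ orthogonalGroup (Fin 6 × Fin 2) ℝ := by
  rw [mem_orthogonalGroup_iff, pairMatrix_transpose, pairMatrix_mul, mul_inv_cancel, pairMatrix_one]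

lemma pairMatrix_row_sum (τ : Equiv.Perm (Fin 6)) (x : Fin 6 × Fin 2) :
    ∑ y, pairMatrix τ x y = 1 := by
  simp only [Fintype.sum_prod_type, Fin.sum_univ_two, pairMatrix, Matrix.of_apply, sg_zero, sg_one]
  have : ∀ k : Fin 6, ((if k = x.1 then (1 : ℝ) else 0) + if τ k = x.1 then sg x.2 * 1 else 0) / 2 +
      ((if k = x.1 then 1 else 0) + if τ k = x.1 then sg x.2 * -1 else 0) / 2 =
      if k = x.1 then 1 else 0 := by
    intro k
    split_ifs <;> ring
  simp only [this, Finset.sum_ite_eq', Finset.mem_univ, if_true]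

lemma pairMatrix_regular (τ : Equiv.Perm (Fin 6)) : IsRegularOrthogonal (pairMatrix τ) :=
  ⟨pairMatrix_mem τ, 1, pairMatrix_row_sum τ⟩

/-- The matrix of `τ` is decomposable if `τ` preserves a proper set of pairs. -/
lemma pairMatrix_decomposable {τ : Equiv.Perm (Fin 6)} {s : Finset (Fin 6)} (hs : s.Nonempty)
    (hs' : s ≠ Finset.univ) (h : ∀ i, τ i ∈ s ↔ i ∈ s) : IsDecomposable (pairMatrix τ) := by
  refine ⟨s ×ˢ Finset.univ, s ×ˢ Finset.univ, hs.product Finset.univ_nonempty, ?_, rfl, ?_⟩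
  · intro e
    apply hs'
    ext i
    have : (i, (0 : Fin 2)) ∈ s ×ˢ (Finset.univ : Finset (Fin 2)) := by rw [e]; simp
    simpa using this
  · rintro ⟨i, a⟩ ⟨j, b⟩ hij
    simp only [Finset.mem_product, Finset.mem_univ, and_true]
    by_cases h1 : j = i
    · rw [h1]
    · by_cases h2 : τ j = i
      · rw [← h2, h]
      · simp [pairMatrix, h1, h2] at hij

lemma cyclic_induction {p : Fin 6 → Prop} {i : Fin 6} (hi : p i) (h : ∀ i, p i → p (i + 1))
    (j : Fin 6) : p j := by
  have key : ∀ i j : Fin 6, j = i ∨ j = i + 1 ∨ j = i + 1 + 1 ∨ j = i + 1 + 1 + 1 ∨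
      j = i + 1 + 1 + 1 + 1 ∨ j = i + 1 + 1 + 1 + 1 + 1 := by decide
  rcases key i j with rfl | rfl | rfl | rfl | rfl | rfl
  exacts [hi, h _ hi, h _ (h _ hi), h _ (h _ (h _ hi)), h _ (h _ (h _ (h _ hi))),
    h _ (h _ (h _ (h _ (h _ hi))))]

/-- Column pair `i` has no zero entry in the row pairs `i` and `i + 1`, so membership in a block
spreads from one pair to the next around the whole cycle. -/
lemma R12_not_decomposable : ¬ IsDecomposable R12 := by
  rw [R12_eq]
  rintro ⟨S, T, ⟨x, hx⟩, hS, -, h⟩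
  have h1 : ∀ i a b, (i, a) ∈ S ↔ (i, b) ∈ T := by
    intro i a b
    apply h
    simp [pairMatrix]
  have h2 : ∀ i a b, (i + 1, a) ∈ S ↔ (i, b) ∈ T := by
    intro i a b
    apply h
    simp only [pairMatrix, Matrix.of_apply, Equiv.coe_addRight]
    fin_cases a <;> fin_cases b <;> simp
  have h3 : ∀ i a b, (i + 1, a) ∈ S ↔ (i, b) ∈ S := fun i a b => (h2 i a b).trans (h1 i b b).symm
  apply hS
  ext ⟨j, b⟩
  simp only [Finset.mem_univ, iff_true]
  exact cyclic_induction (p := fun j => ∀ b, (j, b) ∈ S) (i := x.1)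
    (fun b => (h1 _ _ _).2 ((h1 _ x.2 b).1 hx)) (fun i hi b => (h3 i b b).2 (hi b)) j b

lemma sum_pairMatrix_mul (τ : Equiv.Perm (Fin 6)) (k : Fin 6) (a : Fin 2)
    (f : Fin 6 × Fin 2 → ℝ) :
    ∑ x, pairMatrix τ x (k, a) * f x =
      (f (k, 0) + f (k, 1) + sg a * (f (τ k, 0) - f (τ k, 1))) / 2 := by
  simp only [Fintype.sum_prod_type, Fin.sum_univ_two, pairMatrix, Matrix.of_apply, sg_zero, sg_one]
  have : ∀ i : Fin 6, ((if k = i then (1 : ℝ) else 0) + if τ k = i then 1 * sg a else 0) / 2 *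
        f (i, 0) + ((if k = i then 1 else 0) + if τ k = i then -1 * sg a else 0) / 2 * f (i, 1) =
      (if k = i then (f (i, 0) + f (i, 1)) / 2 else 0) +
      (if τ k = i then sg a * (f (i, 0) - f (i, 1)) / 2 else 0) := by
    intro i
    split_ifs <;> ring
  simp only [this, Finset.sum_add_distrib, Finset.sum_ite_eq, Finset.mem_univ, if_true]
  ring

/-! ### Types of blocks and the combinatorial criterion for switching. -/

section Blocks

variable (B : Matrix (Fin 6 × Fin 2) (Fin 6 × Fin 2) ℝ) (i j : Fin 6)

/-- The sum of the entries of a block. -/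
def blockSum : ℝ := B (i, 0) (j, 0) + B (i, 0) (j, 1) + B (i, 1) (j, 0) + B (i, 1) (j, 1)

/-- The difference of the column sums of a block. -/
def colDiff : ℝ := B (i, 0) (j, 0) - B (i, 0) (j, 1) + B (i, 1) (j, 0) - B (i, 1) (j, 1)

/-- The difference of the row sums of a block. -/
def rowDiff : ℝ := B (i, 0) (j, 0) + B (i, 0) (j, 1) - B (i, 1) (j, 0) - B (i, 1) (j, 1)

/-- The difference of the sums of the two diagonals of a block. -/
def diagDiff : ℝ := B (i, 0) (j, 0) - B (i, 0) (j, 1) - B (i, 1) (j, 0) + B (i, 1) (j, 1)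

end Blocks

/-- Column `(k, a)` of `pairMatrix τ` is half of `u_k + sg a • w_{τ k}`. Expanding the bilinear form
of `B` on two such columns gives one character from each of four blocks. -/
lemma conj_pairMatrix_apply (τ : Equiv.Perm (Fin 6))
    (B : Matrix (Fin 6 × Fin 2) (Fin 6 × Fin 2) ℝ) (k l : Fin 6) (a b : Fin 2) :
    ((pairMatrix τ)ᵀ * B * pairMatrix τ) (k, a) (l, b) =
      (blockSum B k l + sg b * colDiff B k (τ l) + sg a * rowDiff B (τ k) l +
        sg a * sg b * diagDiff B (τ k) (τ l)) / 4 := by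
  have h1 : ∀ y, ((pairMatrix τ)ᵀ * B) (k, a) y =
      (B (k, 0) y + B (k, 1) y + sg a * (B (τ k, 0) y - B (τ k, 1) y)) / 2 := by
    intro y
    rw [Matrix.mul_apply]
    exact sum_pairMatrix_mul τ k a fun x => B x y
  rw [Matrix.mul_apply]
  simp only [h1]
  have h2 := sum_pairMatrix_mul τ l b fun y =>
    (B (k, 0) y + B (k, 1) y + sg a * (B (τ k, 0) y - B (τ k, 1) y)) / 2
  simp only [mul_comm (pairMatrix τ _ _)] at h2
  rw [h2]
  simp only [blockSum, colDiff, rowDiff, diagDiff]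
  ring

/-- The block `b` is the block named `t` or its complement. -/
def HasBlock (t : Blk) (b : Fin 2 → Fin 2 → ℝ) : Prop :=
  (∀ a c, b a c = t.toMatrix a c) ∨ ∀ a c, b a c = 1 - t.toMatrix a c

/-- The name of the transposed block. -/
def Blk.transpose : Blk → Blk
  | .O => .O
  | .I => .I
  | .N => .Nt
  | .Nt => .N

lemma Blk.toMatrix_transpose (t : Blk) (a c : Fin 2) :
    t.transpose.toMatrix a c = t.toMatrix c a := by
  cases t <;> fin_cases a <;> fin_cases c <;> simp [Blk.toMatrix, Blk.transpose]

lemma HasBlock.transpose {t : Blk} {b : Fin 2 → Fin 2 → ℝ} (h : HasBlock t b) :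
    HasBlock t.transpose (fun a c => b c a) :=
  h.imp (fun h a c => (h c a).trans (t.toMatrix_transpose a c).symm)
    (fun h a c => (h c a).trans (congrArg (1 - ·) (t.toMatrix_transpose a c).symm))

lemma HasBlock.compl {t : Blk} {b : Fin 2 → Fin 2 → ℝ} (h : HasBlock t b) :
    HasBlock t (fun a c => 1 - b a c) :=
  h.symm.imp (fun h a c => by simp [h a c]) (fun h a c => by simp [h a c])

lemma hasBlock_iff {t : Blk} {b : Fin 2 → Fin 2 → ℝ} : HasBlock t b ↔
    (b 0 0 = t.toMatrix 0 0 ∧ b 0 1 = t.toMatrix 0 1 ∧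
      b 1 0 = t.toMatrix 1 0 ∧ b 1 1 = t.toMatrix 1 1) ∨
    (b 0 0 = 1 - t.toMatrix 0 0 ∧ b 0 1 = 1 - t.toMatrix 0 1 ∧
      b 1 0 = 1 - t.toMatrix 1 0 ∧ b 1 1 = 1 - t.toMatrix 1 1) := by
  simp [HasBlock, Fin.forall_fin_two, and_assoc]

/-- The type of a block, read off from its four characters. -/
lemma HasBlock.values {t : Blk} {b : Fin 2 → Fin 2 → ℝ} (h : HasBlock t b) :
    (if t = .O then (b 0 0 + b 0 1 + b 1 0 + b 1 1 = 0 ∨ b 0 0 + b 0 1 + b 1 0 + b 1 1 = 4)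
      else b 0 0 + b 0 1 + b 1 0 + b 1 1 = 2) ∧
    (if t = .Nt then (b 0 0 - b 0 1 + b 1 0 - b 1 1 = 2 ∨ b 0 0 - b 0 1 + b 1 0 - b 1 1 = -2)
      else b 0 0 - b 0 1 + b 1 0 - b 1 1 = 0) ∧
    (if t = .N then (b 0 0 + b 0 1 - b 1 0 - b 1 1 = 2 ∨ b 0 0 + b 0 1 - b 1 0 - b 1 1 = -2)
      else b 0 0 + b 0 1 - b 1 0 - b 1 1 = 0) ∧
    (if t = .I then (b 0 0 - b 0 1 - b 1 0 + b 1 1 = 2 ∨ b 0 0 - b 0 1 - b 1 0 + b 1 1 = -2)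
      else b 0 0 - b 0 1 - b 1 0 + b 1 1 = 0) := by
  rw [hasBlock_iff] at h
  rcases h with ⟨h1, h2, h3, h4⟩ | ⟨h1, h2, h3, h4⟩ <;> cases t <;>
    simp [Blk.toMatrix, h1, h2, h3, h4] <;> norm_num

lemma HasBlock.zero_or_one {t : Blk} {b : Fin 2 → Fin 2 → ℝ} (h : HasBlock t b) (a c : Fin 2) :
    b a c = 0 ∨ b a c = 1 := by
  rcases h with h | h <;> rw [h] <;> cases t <;> fin_cases a <;> fin_cases c <;>
    simp [Blk.toMatrix]

lemma HasBlock.unique {t t' : Blk} {b : Fin 2 → Fin 2 → ℝ} (h : HasBlock t b)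
    (h' : HasBlock t' b) : t = t' := by
  have h1 := h.values
  have h2 := h'.values
  cases t <;> cases t' <;> first | rfl | (exfalso; simp at h1 h2; grind)

/-- A block with entries `0` and `1` is, up to complement, one of the four named blocks, or else
it has an odd number of ones. -/
lemma hasBlock_or_odd {b : Fin 2 → Fin 2 → ℝ} (h : ∀ a c, b a c = 0 ∨ b a c = 1) :
    (∃ t, HasBlock t b) ∨
      (b 0 0 + b 0 1 + b 1 0 + b 1 1 = 1 ∨ b 0 0 + b 0 1 + b 1 0 + b 1 1 = 3) ∧
      (b 0 0 - b 0 1 + b 1 0 - b 1 1 = 1 ∨ b 0 0 - b 0 1 + b 1 0 - b 1 1 = -1) := by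
  have e : (∃ t, HasBlock t b) ↔ HasBlock .O b ∨ HasBlock .I b ∨ HasBlock .N b ∨ HasBlock .Nt b :=
    ⟨fun ⟨t, ht⟩ => by cases t <;> simp [ht], by rintro (h | h | h | h) <;> exact ⟨_, h⟩⟩
  rw [e]
  simp only [hasBlock_iff, Blk.toMatrix]
  rcases h 0 0 with h1 | h1 <;> rcases h 0 1 with h2 | h2 <;> rcases h 1 0 with h3 | h3 <;>
    rcases h 1 1 with h4 | h4 <;> simp [h1, h2, h3, h4] <;> norm_num

/-- The matrix `B` consists, up to complements of blocks, of the blocks named by `T`. -/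
structure HasType (B : Matrix (Fin 6 × Fin 2) (Fin 6 × Fin 2) ℝ) (T : Fin 6 → Fin 6 → Blk) :
    Prop where
  symm : ∀ x y, B x y = B y x
  diag : ∃ δ : ℝ, (δ = 0 ∨ δ = 1) ∧ ∀ i a b, B (i, a) (i, b) = if a = b then 0 else δ
  block : ∀ i j, i ≠ j → HasBlock (T i j) fun a b => B (i, a) (j, b)
  diag_type : ∀ i, T i i = .O

/-- The condition on the types of the blocks under which `pairMatrix τ` switches. -/
def Fits (T : Fin 6 → Fin 6 → Blk) (τ : Fin 6 → Fin 6) : Prop :=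
  (∀ k, T k (τ k) ≠ .Nt) ∧ ∀ k l, k ≠ l →
    (if T k l = .O then 0 else 1) = (if T k (τ l) = .Nt then 1 else 0) +
      (if T (τ k) l = .N then 1 else 0) + (if T (τ k) (τ l) = .I then 1 else 0)

namespace HasType

variable {B : Matrix (Fin 6 × Fin 2) (Fin 6 × Fin 2) ℝ} {T : Fin 6 → Fin 6 → Blk}

lemma isAdjMatrix (h : HasType B T) : B.IsAdjMatrix where
  zero_or_one := by
    rintro ⟨i, a⟩ ⟨j, b⟩
    by_cases e : i = j
    · subst e
      obtain ⟨δ, hδ, hd⟩ := h.diag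
      rw [hd]
      split_ifs
      · exact Or.inl rfl
      · exact hδ
    · exact (h.block i j e).zero_or_one a b
  symm := by ext x y; exact h.symm y x
  apply_diag := by
    rintro ⟨i, a⟩
    obtain ⟨δ, hδ, hd⟩ := h.diag
    rw [hd, if_pos rfl]

lemma unique {T' : Fin 6 → Fin 6 → Blk} (h : HasType B T) (h' : HasType B T') : T = T' := by
  funext i j
  by_cases e : i = j
  · rw [e, h.diag_type, h'.diag_type]
  · exact (h.block i j e).unique (h'.block i j e)

lemma transpose (h : HasType B T) (i j : Fin 6) : T j i = (T i j).transpose := by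
  by_cases e : i = j
  · rw [e, h.diag_type]; rfl
  · refine (h.block j i (Ne.symm e)).unique ?_
    simp only [h.symm (j, _)]
    exact (h.block i j e).transpose

lemma colDiff_eq (h : HasType B T) (i j : Fin 6) :
    if T i j = .Nt then (colDiff B i j = 2 ∨ colDiff B i j = -2) else colDiff B i j = 0 := by
  by_cases e : i = j
  · subst e
    obtain ⟨δ, hδ, hd⟩ := h.diag
    rw [h.diag_type]
    simp [colDiff, hd]
  · exact (h.block i j e).values.2.1

lemma rowDiff_eq (h : HasType B T) (i j : Fin 6) :
    if T i j = .N then (rowDiff B i j = 2 ∨ rowDiff B i j = -2) else rowDiff B i j = 0 := by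
  by_cases e : i = j
  · subst e
    obtain ⟨δ, hδ, hd⟩ := h.diag
    rw [h.diag_type]
    simp [rowDiff, hd]
  · exact (h.block i j e).values.2.2.1

/-- An entry of an off-diagonal block of the conjugate is a quarter of `s ± c ± r ± d`, where each
of `c`, `r`, `d` is `0` or `±2`. If `s` is `0` or `4`, all entries are zero-one only when `c = r = d
= 0`; if `s = 2`, exactly one of the three must be nonzero. On the diagonal the contributions of `δ`
cancel, and only the column difference between pair `k` and pair `τ k` has to vanish. -/
lemma isAdjMatrix_conj_iff (h : HasType B T) (τ : Equiv.Perm (Fin 6)) :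
    ((pairMatrix τ)ᵀ * B * pairMatrix τ).IsAdjMatrix ↔ Fits T τ := by
  obtain ⟨δ, hδ, hd⟩ := h.diag
  have hS : ∀ k, blockSum B k k = 2 * δ := fun k => by simp [blockSum, hd]; ring
  have hD : ∀ k, diagDiff B k k = -(2 * δ) := fun k => by simp [diagDiff, hd]; ring
  have hRC : ∀ i j, rowDiff B j i = colDiff B i j := fun i j => by
    simp only [rowDiff, colDiff, h.symm (j, _)]; ring
  have off : ∀ k l, k ≠ l →
      ((∀ a b, ((pairMatrix τ)ᵀ * B * pairMatrix τ) (k, a) (l, b) = 0 ∨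
        ((pairMatrix τ)ᵀ * B * pairMatrix τ) (k, a) (l, b) = 1) ↔
      (if T k l = .O then 0 else 1) = (if T k (τ l) = .Nt then 1 else 0) +
      (if T (τ k) l = .N then 1 else 0) + (if T (τ k) (τ l) = .I then 1 else 0)) := by
    intro k l hkl
    have h1 := (h.block k l hkl).values.1
    have h2 := h.colDiff_eq k (τ l)
    have h3 := h.rowDiff_eq (τ k) l
    have h4 := (h.block (τ k) (τ l) (τ.injective.ne hkl)).values.2.2.2
    simp only [conj_pairMatrix_apply]
    change if _ then (blockSum B k l = 0 ∨ blockSum B k l = 4) else blockSum B k l = 2 at h1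
    change if _ then (diagDiff B (τ k) (τ l) = 2 ∨ diagDiff B (τ k) (τ l) = -2) else
      diagDiff B (τ k) (τ l) = 0 at h4
    generalize blockSum B k l = s at *
    generalize colDiff B k (τ l) = c at *
    generalize rowDiff B (τ k) l = r at *
    generalize diagDiff B (τ k) (τ l) = d at *
    simp only [Fin.forall_fin_two, sg_zero, sg_one]
    by_cases e1 : T k l = .O <;> by_cases e2 : T k (τ l) = .Nt <;>
      by_cases e3 : T (τ k) l = .N <;> by_cases e4 : T (τ k) (τ l) = .I <;>
      simp only [e1, e2, e3, e4, if_true, if_false] at h1 h2 h3 h4 ⊢ <;>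
      (try rcases h1 with h1 | h1) <;> (try rcases h2 with h2 | h2) <;>
      (try rcases h3 with h3 | h3) <;> (try rcases h4 with h4 | h4) <;>
      subst_vars <;> norm_num
  have diag : ∀ k, ((∀ a, ((pairMatrix τ)ᵀ * B * pairMatrix τ) (k, a) (k, a) = 0) ↔
      T k (τ k) ≠ .Nt) := by
    intro k
    have h2 := h.colDiff_eq k (τ k)
    simp only [conj_pairMatrix_apply, hS, hD, hRC, Fin.forall_fin_two, sg_zero, sg_one]
    by_cases e : T k (τ k) = .Nt
    · simp only [e, if_true, ne_eq, not_true_eq_false, iff_false] at h2 ⊢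
      rintro ⟨h5, -⟩
      rcases h2 with h2 | h2 <;> rw [h2] at h5 <;> linarith
    · simp only [e, if_false, ne_eq, not_false_eq_true, iff_true] at h2 ⊢
      rw [h2]
      constructor <;> ring
  constructor
  · intro hA
    exact ⟨fun k => (diag k).1 fun a => hA.apply_diag _,
      fun k l hkl => (off k l hkl).1 fun a b => hA.zero_or_one _ _⟩
  · intro hF
    refine ⟨?_, ?_, ?_⟩
    · rintro ⟨k, a⟩ ⟨l, b⟩
      by_cases e : k = l
      · subst e
        have h2 := h.colDiff_eq k (τ k)
        rw [if_neg (hF.1 k)] at h2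
        rw [conj_pairMatrix_apply, hS, hD, hRC, h2]
        fin_cases a <;> fin_cases b <;> rcases hδ with e | e <;> simp [e] <;> norm_num
      · exact (off k l e).2 (hF.2 k l e) a b
    · have : B.IsSymm := by ext x y; exact h.symm y x
      simp only [Matrix.IsSymm, transpose_mul, transpose_transpose, this.eq, Matrix.mul_assoc]
    · rintro ⟨k, a⟩
      exact (diag k).2 (hF.1 k) a

end HasType

/-- The blocks of a switching set of `R₁₂` have an even number of ones. -/
lemma exists_hasType {B : Matrix (Fin 6 × Fin 2) (Fin 6 × Fin 2) ℝ} (hB : B ∈ switchable R12) :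
    ∃ T, HasType B T := by
  obtain ⟨hA, hA'⟩ := hB
  rw [R12_eq] at hA'
  have hs : ∀ x y, B x y = B y x := fun x y => hA.symm.apply y x
  have hz : ∀ i a, B (i, a) (i, a) = 0 := fun i a => hA.apply_diag _
  have hz' := fun i j a b => hA'.zero_or_one (i, a) (j, b)
  simp only [conj_pairMatrix_apply, Equiv.coe_addRight] at hz'
  have odd := fun i j => hasBlock_or_odd (b := fun a b => B (i, a) (j, b))
    fun a b => hA.zero_or_one (i, a) (j, b)
  have dzero : ∀ i, ∃ t, HasBlock t fun a b => B (i, a) (i, b) := by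
    intro i
    rcases hA.zero_or_one (i, 0) (i, 1) with e | e
    · refine ⟨.O, hasBlock_iff.2 (Or.inl ?_)⟩
      simp [hz, e, hs (i, 1) (i, 0), Blk.toMatrix]
    · refine ⟨.I, hasBlock_iff.2 (Or.inr ?_)⟩
      simp [hz, e, hs (i, 1) (i, 0), Blk.toMatrix]
  -- Adding the entries for `a = 0` and `a = 1` leaves half of the block sum at `(i, j)` plus the
  -- column difference at `(i, j + 1)`. This must be an integer, so an even block at `(i, j)` forces
  -- an even block at `(i, j + 1)`.
  have next : ∀ i j, (∃ t, HasBlock t fun a b => B (i, a) (j, b)) →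
      ∃ t, HasBlock t fun a b => B (i, a) (j + 1, b) := by
    rintro i j ⟨t, ht⟩
    refine (odd i (j + 1)).resolve_right ?_
    rintro ⟨-, hc⟩
    change colDiff B i (j + 1) = 1 ∨ colDiff B i (j + 1) = -1 at hc
    have h1 : blockSum B i j = 0 ∨ blockSum B i j = 2 ∨ blockSum B i j = 4 := by
      have := ht.values.1
      simp only [blockSum]
      split_ifs at this <;> tauto
    have h2 := hz' i j 0 0
    have h3 := hz' i j 1 0
    simp only [sg_zero, sg_one] at h2 h3
    grind
  have even : ∀ i j, ∃ t, HasBlock t fun a b => B (i, a) (j, b) := fun i =>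
    cyclic_induction (i := i) (dzero i) (next i)
  choose T hT using even
  refine ⟨fun i j => if i = j then .O else T i j, hs, ⟨B (0, 0) (0, 1), hA.zero_or_one _ _, ?_⟩,
    fun i j hij => by simpa [hij] using hT i j, fun i => by simp⟩
  -- In the sum of the two new diagonal entries of pair `i` the row and column differences cancel,
  -- which leaves the difference of the edge indicators inside the pairs `i` and `i + 1`.
  have hoff : ∀ i, B (i, 0) (i, 1) = B (0, 0) (0, 1) := by
    refine cyclic_induction (i := 0) rfl fun i hi => ?_
    rw [← hi]
    have h2 := hA'.apply_diag (i, 0)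
    have h3 := hA'.apply_diag (i, 1)
    simp only [conj_pairMatrix_apply, Equiv.coe_addRight, sg_zero, sg_one, blockSum, colDiff,
      rowDiff, diagDiff, hz, hs (_, 1) (_, 0)] at h2 h3
    rw [hs (i + 1, 0) (i, 1), hs (i + 1, 0) (i, 0)] at h2 h3
    linarith
  intro i a b
  fin_cases a <;> fin_cases b <;> simp [hz, hs (_, 1) (_, 0), hoff]

end TwelveSwitch

namespace TwelveSwitch

/-! The finite search over the types of the blocks. For the sake of fast evaluation in the kernel,
it uses an enumeration type in place of `Fin 6`. -/

/-- Boolean conjunction, with lazy evaluation of the second argument. -/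
def both (p q : Bool) : Bool := Bool.casesOn p false q

lemma both_iff {p q : Bool} : both p q = true ↔ p = true ∧ q = true := by
  cases p <;> simp [both]

/-- An index type with six elements. -/
inductive Six
  | a | b | c | d | e | f
  deriving DecidableEq

namespace Six

/-- The function with the given values. -/
def ofValues {α : Type*} (xa xb xc xd xe xf : α) (i : Six) : α :=
  Six.casesOn i xa xb xc xd xe xf

/-- The number of an index. -/
def toFin : Six → Fin 6 := ofValues 0 1 2 3 4 5

/-- The index with a given number. -/
def ofFin (i : Fin 6) : Six := ![.a, .b, .c, .d, .e, .f] i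

/-- The cyclic successor. -/
def next : Six → Six := ofValues .b .c .d .e .f .a

lemma toFin_ofFin (i : Fin 6) : (ofFin i).toFin = i := by revert i; decide

lemma toFin_next (i : Six) : i.next.toFin = i.toFin + 1 := by cases i <;> rfl

/-- `p` holds for all increasing pairs. -/
def allPairs (p : Six → Six → Bool) : Bool :=
  both (p .e .f) <| both (p .d .f) <| both (p .c .f) <| both (p .b .f) <| both (p .a .f) <|
  both (p .d .e) <| both (p .c .e) <| both (p .b .e) <| both (p .a .e) <| both (p .c .d) <|
  both (p .b .d) <| both (p .a .d) <| both (p .b .c) <| both (p .a .c) <| p .a .b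

lemma allPairs_iff {p : Six → Six → Bool} :
    allPairs p = true ↔ ∀ i j : Fin 6, i < j → p (ofFin i) (ofFin j) = true := by
  constructor
  · intro h i j hij
    simp only [allPairs, both_iff] at h
    fin_cases i <;> fin_cases j <;> first | (exfalso; revert hij; decide) | simp_all [ofFin]
  · intro h
    simp only [allPairs, both_iff]
    refine ⟨?_, ?_, ?_, ?_, ?_, ?_, ?_, ?_, ?_, ?_, ?_, ?_, ?_, ?_, ?_⟩
    exacts [h 4 5 (by decide), h 3 5 (by decide), h 2 5 (by decide), h 1 5 (by decide), h 0 5 (by decide),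
      h 3 4 (by decide), h 2 4 (by decide), h 1 4 (by decide), h 0 4 (by decide), h 2 3 (by decide),
      h 1 3 (by decide), h 0 3 (by decide), h 1 2 (by decide), h 0 2 (by decide), h 0 1 (by decide)]

end Six

open Six

/-- The array `T` over the enumeration type. -/
def onSix (T : Fin 6 → Fin 6 → Blk) : Six → Six → Blk := fun i j => T i.toFin j.toFin

namespace Blk

/-- `p` holds for all names of blocks. -/
def all (p : Blk → Bool) : Bool := p .O && p .I && p .N && p .Nt

/-- The name is not `Nt`. -/
def notNt (x : Blk) : Bool := Blk.casesOn x true true true false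

/-- The name is not `N`. -/
def notN (x : Blk) : Bool := Blk.casesOn x true true false true

/-- The name is not `I`. -/
def notI (x : Blk) : Bool := Blk.casesOn x true false true true

/-- The name is `I`. -/
def isI (x : Blk) : Bool := Blk.casesOn x false true false false

lemma all_iff {p : Blk → Bool} : Blk.all p = true ↔ ∀ x, p x = true := by
  simp only [Blk.all, Bool.and_eq_true]
  exact ⟨fun h x => by cases x <;> simp [h], fun h => by simp [h]⟩

end Blk

/-- Boolean implication, with lazy evaluation of the second argument. -/
def imp (p q : Bool) : Bool := Bool.casesOn p true q

lemma imp_iff {p q : Bool} : imp p q = true ↔ (p = true → q = true) := by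
  cases p <;> simp [imp]

/-- Exactly one of `y = Nt`, `z = N` and `w = I` holds. -/
def exactlyOne (y z w : Blk) : Bool :=
  Blk.casesOn y (Blk.casesOn z w.isI w.isI w.notI w.isI) (Blk.casesOn z w.isI w.isI w.notI w.isI)
    (Blk.casesOn z w.isI w.isI w.notI w.isI) (both z.notN w.notI)

/-- The condition of `Fits` for a pair of different indices. -/
def balanced (x y z w : Blk) : Bool :=
  Blk.casesOn x (both y.notNt (both z.notN w.notI)) (exactlyOne y z w) (exactlyOne y z w)
    (exactlyOne y z w)

lemma balanced_iff {x y z w : Blk} : balanced x y z w = true ↔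
    (if x = .O then 0 else 1) = (if y = .Nt then 1 else 0) +
      (if z = .N then 1 else 0) + (if w = .I then 1 else 0) := by
  cases x <;> cases y <;> cases z <;> cases w <;> decide

/-- A Boolean version of `Fits`. -/
def fitsBool (T : Six → Six → Blk) (τ : Six → Six) : Bool :=
  both (T .f (τ .f)).notNt <| both (T .e (τ .e)).notNt <| both (T .d (τ .d)).notNt <|
    both (T .c (τ .c)).notNt <| both (T .b (τ .b)).notNt <| both (T .a (τ .a)).notNt <|
    allPairs fun k l => balanced (T k l) (T k (τ l)) (T (τ k) l) (T (τ k) (τ l))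

lemma notNt_iff {x : Blk} : x.notNt = true ↔ x ≠ .Nt := by cases x <;> decide

lemma notN_iff {x : Blk} : x.notN = true ↔ x ≠ .N := by cases x <;> decide

/-- The array of types is symmetric, up to transposition of blocks, with zero diagonal. -/
def IsTypeArray (T : Fin 6 → Fin 6 → Blk) : Prop :=
  (∀ i j, T j i = (T i j).transpose) ∧ ∀ i, T i i = .O

/-- Transposition exchanges `N` and `Nt`, and with them the roles of `y` and `z`. Hence the
conditions for `k < l` imply those for `k > l`. -/
lemma balanced_transpose {x y z w : Blk} (h : balanced x y z w = true) :
    balanced x.transpose z.transpose y.transpose w.transpose = true := by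
  revert h; cases x <;> cases y <;> cases z <;> cases w <;> decide

lemma fits_of_lt {T : Fin 6 → Fin 6 → Blk} (hT : IsTypeArray T) {τ : Fin 6 → Fin 6}
    (h1 : ∀ k, T k (τ k) ≠ .Nt)
    (h2 : ∀ k l, k < l →
      balanced (T k l) (T k (τ l)) (T (τ k) l) (T (τ k) (τ l)) = true) : Fits T τ := by
  refine ⟨h1, fun k l hkl => balanced_iff.1 ?_⟩
  rcases lt_or_gt_of_ne hkl with h | h
  · exact h2 k l h
  · have := balanced_transpose (h2 l k h)
    simpa only [← hT.1] using this

/-- The permutation of the numbers given by a map of the enumeration type. -/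
def conjFin (τ : Six → Six) (i : Fin 6) : Fin 6 := (τ (ofFin i)).toFin

lemma fits_of_fitsBool {T : Fin 6 → Fin 6 → Blk} (hT : IsTypeArray T) {τ : Six → Six}
    (h : fitsBool (onSix T) τ = true) : Fits T (conjFin τ) := by
  simp only [fitsBool, both_iff, notNt_iff, allPairs_iff, onSix, toFin_ofFin] at h
  obtain ⟨h5, h4, h3, h2, h1, h0, h6⟩ := h
  refine fits_of_lt hT (fun k => ?_) h6
  fin_cases k
  exacts [h0, h1, h2, h3, h4, h5]

/-- The matrix of `τ` and its quotient with the cyclic shift are decomposable. -/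
def IsReducer (τ : Fin 6 → Fin 6) : Prop :=
  Function.Injective τ ∧
  (∃ s : Finset (Fin 6), s.Nonempty ∧ s ≠ Finset.univ ∧ ∀ i, τ i ∈ s ↔ i ∈ s) ∧
  ∃ s : Finset (Fin 6), s.Nonempty ∧ s ≠ Finset.univ ∧ ∀ i, τ i - 1 ∈ s ↔ i ∈ s

instance (τ : Fin 6 → Fin 6) : Decidable (IsReducer τ) := by
  unfold IsReducer Function.Injective; infer_instance

/-- Permutations that suffice for all reducible switching sets. -/
def reducers : List (Six → Six) :=
  [ofValues .a .b .f .d .e .c, ofValues .d .b .c .a .e .f, ofValues .a .e .c .d .b .f,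
   ofValues .e .b .c .d .a .f, ofValues .a .b .c .f .e .d, ofValues .a .b .e .d .c .f,
   ofValues .c .b .a .d .e .f, ofValues .a .f .c .d .e .b, ofValues .a .d .c .b .e .f,
   ofValues .b .a .c .d .e .f, ofValues .a .c .b .d .e .f, ofValues .a .b .d .c .e .f,
   ofValues .f .b .c .d .e .a, ofValues .a .b .c .d .f .e, ofValues .a .b .c .e .d .f,
   ofValues .d .c .b .a .e .f, ofValues .b .a .f .d .e .c, ofValues .f .e .c .d .b .a,
   ofValues .a .b .f .e .d .c, ofValues .a .e .d .c .b .f, ofValues .d .b .c .a .f .e,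
   ofValues .b .f .d .c .e .a, ofValues .b .f .c .e .d .a, ofValues .b .c .a .d .f .e,
   ofValues .e .c .b .d .f .a, ofValues .b .a .c .e .f .d, ofValues .a .c .d .b .f .e,
   ofValues .b .a .d .e .c .f, ofValues .f .c .d .b .e .a, ofValues .b .c .a .e .d .f,
   ofValues .e .b .d .c .f .a, ofValues .a .c .b .e .f .d, ofValues .f .b .d .e .c .a,
   ofValues .b .a .d .f .e .c, ofValues .f .c .e .d .b .a, ofValues .a .d .c .b .f .e,
   ofValues .c .b .f .e .d .a, ofValues .d .c .b .f .e .a, ofValues .a .f .c .e .d .b,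
   ofValues .f .d .c .e .b .a, ofValues .b .a .e .d .c .f, ofValues .b .e .d .c .a .f,
   ofValues .a .c .b .f .e .d, ofValues .b .d .c .a .f .e, ofValues .f .b .e .d .c .a,
   ofValues .a .f .e .d .c .b, ofValues .d .b .c .f .e .a, ofValues .c .b .a .e .d .f,
   ofValues .a .e .c .d .f .b, ofValues .a .f .d .c .e .b, ofValues .c .b .f .d .e .a,
   ofValues .d .b .c .e .a .f, ofValues .d .c .b .e .a .f, ofValues .b .a .c .f .e .d,
   ofValues .a .d .c .e .b .f, ofValues .c .b .a .d .f .e, ofValues .b .a .e .d .f .c,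
   ofValues .c .b .d .a .e .f, ofValues .e .b .d .c .a .f, ofValues .a .c .f .d .e .b,
   ofValues .a .c .f .e .d .b, ofValues .a .c .e .d .b .f, ofValues .a .b .d .f .e .c,
   ofValues .a .b .e .d .f .c, ofValues .f .d .c .b .e .a, ofValues .c .b .d .a .f .e,
   ofValues .b .e .c .d .a .f, ofValues .b .d .c .a .e .f, ofValues .e .c .b .d .a .f,
   ofValues .a .e .d .c .f .b]

lemma isReducer_of_mem : ∀ τ ∈ reducers, IsReducer (conjFin τ) := by
  decide +kernel

/-- Rotation of an array. -/
def rotate (T : Fin 6 → Fin 6 → Blk) (n : Fin 6) : Fin 6 → Fin 6 → Blk :=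
  fun i j => T (i + n) (j + n)

lemma rotate_rotate (T : Fin 6 → Fin 6 → Blk) (m n : Fin 6) :
    rotate (rotate T m) n = rotate T (m + n) := by
  funext i j
  simp only [rotate, add_assoc, add_comm n m]

lemma rotate_zero (T : Fin 6 → Fin 6 → Blk) : rotate T 0 = T := by
  funext i j
  simp only [rotate, add_zero]

lemma IsTypeArray.rotate {T : Fin 6 → Fin 6 → Blk} (hT : IsTypeArray T) (n : Fin 6) :
    IsTypeArray (rotate T n) :=
  ⟨fun _ _ => hT.1 _ _, fun _ => hT.2 _⟩

lemma Fits.of_rotate {T : Fin 6 → Fin 6 → Blk} {n : Fin 6} {τ : Fin 6 → Fin 6}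
    (h : Fits (rotate T n) τ) : Fits T fun i => τ (i - n) + n := by
  refine ⟨fun k => ?_, fun k l hkl => ?_⟩
  · simpa [TwelveSwitch.rotate] using h.1 (k - n)
  · have := h.2 (k - n) (l - n) (by simpa using hkl)
    rw [← balanced_iff] at this ⊢
    simpa [TwelveSwitch.rotate] using this

lemma Fits.rotate {T : Fin 6 → Fin 6 → Blk} (n : Fin 6) {τ : Fin 6 → Fin 6}
    (h : Fits T τ) : Fits (rotate T n) fun i => τ (i + n) - n := by
  refine ⟨fun k => ?_, fun k l hkl => ?_⟩
  · simpa [TwelveSwitch.rotate] using h.1 (k + n)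
  · have := h.2 (k + n) (l + n) (by simpa using hkl)
    rw [← balanced_iff] at this ⊢
    simpa [TwelveSwitch.rotate] using this

/-- `p` holds for one of the first `m` rotations of `T`. -/
def anyRotation (p : (Six → Six → Blk) → Bool) : ℕ → (Six → Six → Blk) → Bool
  | 0, _ => false
  | m + 1, T => p T || anyRotation p m fun i j => T i.next j.next

lemma exists_of_anyRotation {p : (Six → Six → Blk) → Bool} {m : ℕ} {T : Fin 6 → Fin 6 → Blk}
    (h : anyRotation p m (onSix T) = true) : ∃ n, p (onSix (rotate T n)) = true := by
  induction m generalizing T with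
  | zero => simp [anyRotation] at h
  | succ m ih =>
    rw [anyRotation, Bool.or_eq_true] at h
    rcases h with h | h
    · exact ⟨0, by rwa [rotate_zero]⟩
    · have e : (fun i j => onSix T (next i) (next j)) = onSix (rotate T 1) := by
        funext i j
        simp only [onSix, rotate, toFin_next]
      rw [e] at h
      obtain ⟨n, hn⟩ := ih h
      exact ⟨1 + n, by rwa [rotate_rotate] at hn⟩

/-- `T` admits one of the reducers. -/
def hasReducer (T : Six → Six → Blk) : Bool := reducers.any (fitsBool T)

/-- `T` belongs to the table. -/
def inTable (T : Six → Six → Blk) : Bool :=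
  (List.finRange 18).any fun k => allPairs fun i j => decide (T i j = onSix (blockTable k) i j)

lemma isTypeArray_blockTable : ∀ k, IsTypeArray (blockTable k) := by
  unfold IsTypeArray
  decide +kernel

/-- The test at the leaves of the search. -/
def leaf (T : Six → Six → Blk) : Bool := hasReducer T || anyRotation inTable 6 T

lemma IsTypeArray.ext {T T' : Fin 6 → Fin 6 → Blk} (hT : IsTypeArray T) (hT' : IsTypeArray T')
    (h : ∀ i j, i < j → T i j = T' i j) : T = T' := by
  funext i j
  rcases lt_trichotomy i j with h1 | rfl | h1
  · exact h i j h1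
  · rw [hT.2, hT'.2]
  · rw [hT.1 j i, hT'.1 j i, h j i h1]

lemma of_leaf {T : Fin 6 → Fin 6 → Blk} (hT : IsTypeArray T) (h : leaf (onSix T) = true) :
    (∃ k n, ∀ i j, rotate T n i j = blockTable k i j) ∨ ∃ τ, IsReducer τ ∧ Fits T τ := by
  rw [leaf, Bool.or_eq_true] at h
  rcases h with h | h
  · simp only [hasReducer, List.any_eq_true] at h
    obtain ⟨τ, hτ, hf⟩ := h
    exact Or.inr ⟨_, isReducer_of_mem τ hτ, fits_of_fitsBool hT hf⟩
  · obtain ⟨n, hn⟩ := exists_of_anyRotation h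
    simp only [inTable, List.any_eq_true, allPairs_iff, decide_eq_true_eq, onSix,
      toFin_ofFin] at hn
    obtain ⟨k, -, hk⟩ := hn
    exact Or.inl ⟨k, n, fun i j => by
      rw [(hT.rotate n).ext (isTypeArray_blockTable k) hk]⟩

/-- The search through the arrays of types that fit the cyclic shift. -/
def search : Bool :=
  Blk.all fun x01 => imp x01.notNt <|
  Blk.all fun x02 =>
  Blk.all fun x03 =>
  Blk.all fun x04 =>
  Blk.all fun x05 => imp x05.notN <|
  Blk.all fun x12 => imp x12.notNt <| imp (balanced x01 x02 .O x12) <|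
  Blk.all fun x13 => imp (balanced x02 x03 x12 x13) <|
  Blk.all fun x14 => imp (balanced x03 x04 x13 x14) <|
  Blk.all fun x15 => imp (balanced x04 x05 x14 x15) <| imp (balanced x05 .O x15 x01.transpose) <|
  Blk.all fun x23 => imp x23.notNt <| imp (balanced x12 x13 .O x23) <|
  Blk.all fun x24 => imp (balanced x13 x14 x23 x24) <|
  Blk.all fun x25 => imp (balanced x14 x15 x24 x25) <|
    imp (balanced x15 x01.transpose x25 x02.transpose) <|
  Blk.all fun x34 => imp x34.notNt <| imp (balanced x23 x24 .O x34) <|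
  Blk.all fun x35 => imp (balanced x24 x25 x34 x35) <|
    imp (balanced x25 x02.transpose x35 x03.transpose) <|
  Blk.all fun x45 => imp x45.notNt <| imp (balanced x34 x35 .O x45) <|
    imp (balanced x35 x03.transpose x45 x04.transpose) <|
    imp (balanced x45 x04.transpose .O x05.transpose) <|
  leaf (ofValues
    (ofValues .O x01 x02 x03 x04 x05)
    (ofValues x01.transpose .O x12 x13 x14 x15)
    (ofValues x02.transpose x12.transpose .O x23 x24 x25)
    (ofValues x03.transpose x13.transpose x23.transpose .O x34 x35)
    (ofValues x04.transpose x14.transpose x24.transpose x34.transpose .O x45)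
    (ofValues x05.transpose x15.transpose x25.transpose x35.transpose x45.transpose .O))

/-- The 15 entries above the diagonal are chosen one after the other, and each condition is tested
as soon as all of its entries are known, so that most branches are cut early. Conditions that wrap
from index 5 to index 0 use transposed entries. -/
lemma search_eq_true : search = true := by decide +kernel

end TwelveSwitch

/-! ### Consequences of the finite checks: completeness, rigidity and distinctness of the table. -/

namespace TwelveSwitch
open Six

/-- Every array of types that fits the cyclic shift is in the table, up to rotation, or admits a
factorization of the shift. -/
theorem exists_table_or_reducer {T : Fin 6 → Fin 6 → Blk} (hT : IsTypeArray T)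
    (hF : Fits T (· + 1)) :
    (∃ k n, ∀ i j, rotate T n i j = blockTable k i j) ∨ ∃ τ, IsReducer τ ∧ Fits T τ := by
  have h1 : ∀ i j, j = i + 1 → (T i j).notNt = true := by
    rintro i j rfl
    exact notNt_iff.2 (hF.1 i)
  -- The diagonal condition at `k = 5` concerns the entry `(5, 0)`; above the diagonal it is read
  -- off as its transpose.
  have h1' : (T 0 5).notN = true := by
    have := hF.1 5
    rw [hT.1 (5 + 1) 5] at this
    refine notN_iff.2 fun e => this ?_
    change (T 0 5).transpose = _
    rw [e]
    rfl
  have b : ∀ i j {y z w}, T i (j + 1) = y → T (i + 1) j = z → T (i + 1) (j + 1) = w →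
      (hij : i ≠ j := by decide) → balanced (T i j) y z w = true := by
    rintro i j _ _ _ rfl rfl rfl hij
    exact balanced_iff.2 (hF.2 i j hij)
  have h := search_eq_true
  simp only [search, Blk.all_iff, imp_iff] at h
  refine of_leaf hT ?_
  have e : onSix T = ofValues
      (ofValues .O (T 0 1) (T 0 2) (T 0 3) (T 0 4) (T 0 5))
      (ofValues (T 0 1).transpose .O (T 1 2) (T 1 3) (T 1 4) (T 1 5))
      (ofValues (T 0 2).transpose (T 1 2).transpose .O (T 2 3) (T 2 4) (T 2 5))
      (ofValues (T 0 3).transpose (T 1 3).transpose (T 2 3).transpose .O (T 3 4) (T 3 5))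
      (ofValues (T 0 4).transpose (T 1 4).transpose (T 2 4).transpose (T 3 4).transpose .O (T 4 5))
      (ofValues (T 0 5).transpose (T 1 5).transpose (T 2 5).transpose (T 3 5).transpose (T 4 5).transpose
        .O) := by
    funext i j
    cases i <;> cases j <;> first | rfl | exact hT.2 _ | exact hT.1 _ _
  rw [e]
  exact h (T 0 1) (h1 0 1 rfl) (T 0 2) (T 0 3) (T 0 4) (T 0 5) h1' (T 1 2) (h1 1 2 rfl)
    (b 0 1 rfl (hT.2 _) rfl) (T 1 3) (b 0 2 rfl rfl rfl) (T 1 4) (b 0 3 rfl rfl rfl) (T 1 5)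
    (b 0 4 rfl rfl rfl) (b 0 5 (hT.2 _) rfl (hT.1 _ _)) (T 2 3) (h1 2 3 rfl)
    (b 1 2 rfl (hT.2 _) rfl) (T 2 4) (b 1 3 rfl rfl rfl) (T 2 5) (b 1 4 rfl rfl rfl)
    (b 1 5 (hT.1 _ _) rfl (hT.1 _ _)) (T 3 4) (h1 3 4 rfl) (b 2 3 rfl (hT.2 _) rfl) (T 3 5)
    (b 2 4 rfl rfl rfl) (b 2 5 (hT.1 _ _) rfl (hT.1 _ _)) (T 4 5) (h1 4 5 rfl)
    (b 3 4 rfl (hT.2 _) rfl) (b 3 5 (hT.1 _ _) rfl (hT.1 _ _))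
    (b 4 5 (hT.1 _ _) (hT.2 _) (hT.1 _ _))

/-- `p` holds for all indices. -/
def all6 (p : Six → Bool) : Bool :=
  both (p .a) <| both (p .b) <| both (p .c) <| both (p .d) <| both (p .e) (p .f)

lemma all6_iff {p : Six → Bool} : all6 p = true ↔ ∀ x, p x = true := by
  simp only [all6, both_iff]
  exact ⟨fun h x => by cases x <;> simp [h], fun h => by simp [h]⟩

/-- The indices are different. -/
def ne (x y : Six) : Bool := !decide (x = y)

/-- The list is in natural order or cyclically shifted by one. -/
def isIdOrShift (ta tb tc td te tf : Six) : Bool :=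
  decide ([ta, tb, tc, td, te, tf] = [.a, .b, .c, .d, .e, .f]) ||
    decide ([ta, tb, tc, td, te, tf] = [.b, .c, .d, .e, .f, .a])

/-- The only permutations that fit `T` are the identity and the cyclic shift. -/
def onlyTrivial (T : Six → Six → Blk) : Bool :=
  all6 fun ta => imp (T .a ta).notNt <|
  all6 fun tb => imp (ne ta tb) <| imp (T .b tb).notNt <|
    imp (balanced (T .a .b) (T .a tb) (T ta .b) (T ta tb)) <|
  all6 fun tc => imp (ne ta tc) <| imp (ne tb tc) <| imp (T .c tc).notNt <|
    imp (balanced (T .a .c) (T .a tc) (T ta .c) (T ta tc)) <|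
    imp (balanced (T .b .c) (T .b tc) (T tb .c) (T tb tc)) <|
  all6 fun td => imp (ne ta td) <| imp (ne tb td) <| imp (ne tc td) <| imp (T .d td).notNt <|
    imp (balanced (T .a .d) (T .a td) (T ta .d) (T ta td)) <|
    imp (balanced (T .b .d) (T .b td) (T tb .d) (T tb td)) <|
    imp (balanced (T .c .d) (T .c td) (T tc .d) (T tc td)) <|
  all6 fun te => imp (ne ta te) <| imp (ne tb te) <| imp (ne tc te) <| imp (ne td te) <| imp (T .e te).notNt <|
    imp (balanced (T .a .e) (T .a te) (T ta .e) (T ta te)) <|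
    imp (balanced (T .b .e) (T .b te) (T tb .e) (T tb te)) <|
    imp (balanced (T .c .e) (T .c te) (T tc .e) (T tc te)) <|
    imp (balanced (T .d .e) (T .d te) (T td .e) (T td te)) <|
  all6 fun tf => imp (ne ta tf) <| imp (ne tb tf) <| imp (ne tc tf) <| imp (ne td tf) <| imp (ne te tf) <| imp (T .f tf).notNt <|
    imp (balanced (T .a .f) (T .a tf) (T ta .f) (T ta tf)) <|
    imp (balanced (T .b .f) (T .b tf) (T tb .f) (T tb tf)) <|
    imp (balanced (T .c .f) (T .c tf) (T tc .f) (T tc tf)) <|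
    imp (balanced (T .d .f) (T .d tf) (T td .f) (T td tf)) <|
    imp (balanced (T .e .f) (T .e tf) (T te .f) (T te tf)) <|
  isIdOrShift ta tb tc td te tf


/-- This rigidity is what makes the table entries irreducible: no permutation other than the
identity and the shift can be an intermediate stage of a factorization. -/
lemma onlyTrivial_blockTable : ∀ k, onlyTrivial (onSix (blockTable k)) = true := by
  decide +kernel

lemma of_onlyTrivial {T : Fin 6 → Fin 6 → Blk} (h : onlyTrivial (onSix T) = true)
    {τ : Fin 6 → Fin 6} (hτ : Function.Injective τ) (hF : Fits T τ) :
    (∀ i, τ i = i) ∨ ∀ i, τ i = i + 1 := by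
  let t : Fin 6 → Six := fun i => ofFin (τ i)
  have n : ∀ i j, i ≠ j → ne (t i) (t j) = true := by
    intro i j hij
    have : t i ≠ t j := fun e => hij (hτ (by simpa [t, toFin_ofFin] using congrArg toFin e))
    simp [ne, this]
  have d : ∀ i, (onSix T (ofFin i) (t i)).notNt = true := by
    intro i
    simpa only [onSix, toFin_ofFin, notNt_iff, t] using hF.1 i
  have b : ∀ i j, i ≠ j → balanced (onSix T (ofFin i) (ofFin j)) (onSix T (ofFin i) (t j))
      (onSix T (t i) (ofFin j)) (onSix T (t i) (t j)) = true := by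
    intro i j hij
    rw [balanced_iff]
    simpa only [onSix, toFin_ofFin, t] using hF.2 i j hij
  simp only [onlyTrivial, all6_iff, imp_iff] at h
  have h := h (t 0) (d 0) (t 1) (n 0 1 (by decide)) (d 1) (b 0 1 (by decide)) (t 2) (n 0 2 (by decide))
    (n 1 2 (by decide)) (d 2) (b 0 2 (by decide)) (b 1 2 (by decide)) (t 3) (n 0 3
    (by decide)) (n 1 3 (by decide)) (n 2 3 (by decide)) (d 3) (b 0 3 (by decide)) (b 1 3
    (by decide)) (b 2 3 (by decide)) (t 4) (n 0 4 (by decide)) (n 1 4 (by decide)) (n 2 4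
    (by decide)) (n 3 4 (by decide)) (d 4) (b 0 4 (by decide)) (b 1 4 (by decide)) (b 2 4
    (by decide)) (b 3 4 (by decide)) (t 5) (n 0 5 (by decide)) (n 1 5 (by decide)) (n 2 5
    (by decide)) (n 3 5 (by decide)) (n 4 5 (by decide)) (d 5) (b 0 5 (by decide)) (b 1 5
    (by decide)) (b 2 5 (by decide)) (b 3 5 (by decide)) (b 4 5 (by decide))
  simp only [isIdOrShift, Bool.or_eq_true, decide_eq_true_eq, List.cons.injEq, and_true, t] at h
  have key : ∀ i x, ofFin (τ i) = x → τ i = x.toFin := by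
    rintro i _ rfl
    rw [toFin_ofFin]
  rcases h with ⟨h0, h1, h2, h3, h4, h5⟩ | ⟨h0, h1, h2, h3, h4, h5⟩
  · refine Or.inl fun i => ?_
    fin_cases i
    exacts [key _ _ h0, key _ _ h1, key _ _ h2, key _ _ h3, key _ _ h4, key _ _ h5]
  · refine Or.inr fun i => ?_
    fin_cases i
    exacts [key _ _ h0, key _ _ h1, key _ _ h2, key _ _ h3, key _ _ h4, key _ _ h5]

lemma fits_blockTable : ∀ k, Fits (blockTable k) (· + 1) := by
  unfold Fits
  decide +kernel

/-- A Boolean equality test for arrays. -/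
def sameArray (T T' : Fin 6 → Fin 6 → Blk) : Bool := decide (∀ i j, T i j = T' i j)

lemma sameArray_blockTable :
    ∀ k l n, sameArray (rotate (blockTable k) n) (blockTable l) = true → k = l := by
  decide +kernel

lemma eq_of_rotate_blockTable {k l : Fin 18} {n : Fin 6}
    (h : ∀ i j, rotate (blockTable k) n i j = blockTable l i j) : k = l :=
  sameArray_blockTable k l n ((@decide_eq_true_iff _ (_)).2 h)

end TwelveSwitch

/-! ### From matrices to arrays of types. -/

namespace TwelveSwitch
open Matrix

lemma HasType.isTypeArray {B : Matrix (Fin 6 × Fin 2) (Fin 6 × Fin 2) ℝ}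
    {T : Fin 6 → Fin 6 → Blk} (h : HasType B T) : IsTypeArray T :=
  ⟨h.transpose, h.diag_type⟩

lemma HasType.mem_switchable_iff {B : Matrix (Fin 6 × Fin 2) (Fin 6 × Fin 2) ℝ}
    {T : Fin 6 → Fin 6 → Blk} (h : HasType B T) : B ∈ switchable R12 ↔ Fits T (· + 1) := by
  rw [R12_eq]
  exact ⟨fun hB => (h.isAdjMatrix_conj_iff shift).1 hB.2,
    fun hF => ⟨h.isAdjMatrix, (h.isAdjMatrix_conj_iff shift).2 hF⟩⟩

lemma hasType_table (k : Fin 18) : HasType (table k) (blockTable k) where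
  symm x y := by
    simp only [table, Matrix.of_apply]
    rw [(isTypeArray_blockTable k).1 x.1 y.1, Blk.toMatrix_transpose]
  diag := by
    refine ⟨0, Or.inl rfl, fun i a b => ?_⟩
    simp only [table, Matrix.of_apply]
    rw [(isTypeArray_blockTable k).2 i]
    fin_cases a <;> fin_cases b <;> simp [Blk.toMatrix]
  block i j _ := Or.inl fun a c => rfl
  diag_type := (isTypeArray_blockTable k).2

/-! Equivalent switching sets have the same types of blocks, up to rotation. -/

section Steps

variable {B : Matrix (Fin 6 × Fin 2) (Fin 6 × Fin 2) ℝ} {T : Fin 6 → Fin 6 → Blk}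

lemma blockCompl_blockCompl (i j : Fin 6) : blockCompl i j (blockCompl i j B) = B := by
  ext x y
  simp only [blockCompl, Matrix.of_apply]
  split_ifs <;> ring

lemma HasType.blockCompl (h : HasType B T) {i j : Fin 6} (hij : i ≠ j) :
    HasType (blockCompl i j B) T where
  symm x y := by
    simp only [TwelveSwitch.blockCompl, Matrix.of_apply, h.symm x y]
    congr 1
    rw [or_comm, and_comm, @and_comm (x.1 = i)]
  diag := by
    obtain ⟨δ, hδ, hd⟩ := h.diag
    refine ⟨δ, hδ, fun k a b => ?_⟩
    rw [← hd k]
    simp only [TwelveSwitch.blockCompl, Matrix.of_apply]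
    rw [if_neg]
    rintro (⟨h1, h2⟩ | ⟨h1, h2⟩)
    · exact hij (h1.symm.trans h2)
    · exact hij (h2.symm.trans h1)
  block k l hkl := by
    simp only [TwelveSwitch.blockCompl, Matrix.of_apply]
    split_ifs
    · exact (h.block k l hkl).compl
    · exact h.block k l hkl
  diag_type := h.diag_type

lemma HasType.compl (h : HasType B T) : HasType (Matrix.of (fun _ _ => (1 : ℝ)) - 1 - B) T where
  symm x y := by
    simp only [Matrix.sub_apply, Matrix.of_apply, Matrix.one_apply, h.symm x y, @eq_comm _ x y]
  diag := by
    obtain ⟨δ, hδ, hd⟩ := h.diag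
    refine ⟨1 - δ, ?_, fun k a b => ?_⟩
    · rcases hδ with rfl | rfl <;> simp
    · simp only [Matrix.sub_apply, Matrix.of_apply, Matrix.one_apply, hd, Prod.mk.injEq, true_and]
      split_ifs <;> ring
  block k l hkl := by
    simpa [Matrix.one_apply, hkl] using (h.block k l hkl).compl
  diag_type := h.diag_type

/-- Exchanging the rows or the columns changes a character only by a sign, so each named block is
either fixed or complemented. -/
lemma HasBlock.comp {t : Blk} {b : Fin 2 → Fin 2 → ℝ} (h : HasBlock t b) {f g : Fin 2 → Fin 2}
    (hf : Function.Injective f) (hg : Function.Injective g) :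
    HasBlock t fun a c => b (f a) (g c) := by
  have key : ∀ f : Fin 2 → Fin 2, f 0 ≠ f 1 → f 0 = 0 ∧ f 1 = 1 ∨ f 0 = 1 ∧ f 1 = 0 := by decide
  rw [hasBlock_iff] at h ⊢
  have hf' := key f (hf.ne (by decide))
  have hg' := key g (hg.ne (by decide))
  rcases h with ⟨h1, h2, h3, h4⟩ | ⟨h1, h2, h3, h4⟩ <;>
    rcases hf' with ⟨f0, f1⟩ | ⟨f0, f1⟩ <;> rcases hg' with ⟨g0, g1⟩ | ⟨g0, g1⟩ <;>
    cases t <;> simp [f0, f1, g0, g1, h1, h2, h3, h4, Blk.toMatrix]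

lemma HasType.submatrix (h : HasType B T) (p : Equiv.Perm (Fin 6 × Fin 2)) {n : Fin 6}
    (hp : ∀ x, (p x).1 = x.1 + n) : HasType (B.submatrix p p) (rotate T n) where
  symm x y := h.symm _ _
  diag := by
    obtain ⟨δ, hδ, hd⟩ := h.diag
    refine ⟨δ, hδ, fun i a b => ?_⟩
    have e : ∀ c, p (i, c) = (i + n, (p (i, c)).2) := fun c => Prod.ext (hp _) rfl
    rw [Matrix.submatrix_apply, e a, e b, hd]
    congr 1
    rw [eq_iff_iff]
    refine ⟨fun h2 => ?_, fun h2 => by rw [h2]⟩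
    have : p (i, a) = p (i, b) := by rw [e a, e b, h2]
    simpa using this
  block i j hij := by
    have e : ∀ i c, p (i, c) = (i + n, (p (i, c)).2) := fun i c => Prod.ext (hp _) rfl
    have inj : ∀ i, Function.Injective fun c => (p (i, c)).2 := by
      intro i a b hab
      have : p (i, a) = p (i, b) := by rw [e i a, e i b]; exact congrArg _ hab
      simpa using this
    have := (h.block (i + n) (j + n) (by simpa using hij)).comp (inj i) (inj j)
    simp only [← e] at this
    exact this
  diag_type i := h.diag_type _

end Steps

/-! ### Automorphisms of the matrix and the invariant of the equivalence. -/

/-- The two columns of a pair have opposite signs in their difference parts, which cancel. The sum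
distinguishes the diagonal block `J` from the block `Y`, although both have full support. -/
lemma R12_add {x y y' : Fin 6 × Fin 2} (h : y.1 = y'.1) (h' : y ≠ y') :
    R12 x y + R12 x y' = if y.1 = x.1 then 1 else 0 := by
  obtain ⟨i, a⟩ := x
  obtain ⟨j, b⟩ := y
  obtain ⟨j', b'⟩ := y'
  obtain rfl : j = j' := h
  have hb : sg b + sg b' = 0 := by
    have : b ≠ b' := fun e => h' (by rw [e])
    revert this
    fin_cases b <;> fin_cases b' <;> simp
  simp only [R12_eq, pairMatrix, Matrix.of_apply]
  split_ifs <;> first | ring1 | linear_combination (sg a / 2) * hb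

lemma R12_ne_zero_iff {x y : Fin 6 × Fin 2} : R12 x y ≠ 0 ↔ y.1 = x.1 ∨ y.1 + 1 = x.1 := by
  simp only [R12, Matrix.of_apply, eq_sub_iff_add_eq]
  split_ifs <;> simp_all

/-- An automorphism of `R₁₂` rotates the pairs. -/
lemma exists_rotation {p p' : Equiv.Perm (Fin 6 × Fin 2)} (h : R12.submatrix p p' = R12) :
    ∃ n, ∀ x, (p x).1 = x.1 + n := by
  have hR : ∀ x y, R12 (p x) (p' y) = R12 x y := fun x y => congrFun (congrFun h x) y
  have col : ∀ y y' : Fin 6 × Fin 2, y.1 = y'.1 → (p' y).1 = (p' y').1 := by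
    intro y y' hy
    have hn : ∀ x : Fin 6 × Fin 2, ((p' y).1 = x.1 ∨ (p' y).1 + 1 = x.1) ↔
        ((p' y').1 = x.1 ∨ (p' y').1 + 1 = x.1) := by
      intro x
      obtain ⟨x, rfl⟩ := p.surjective x
      rw [← R12_ne_zero_iff, ← R12_ne_zero_iff, hR, hR, R12_ne_zero_iff, R12_ne_zero_iff, hy]
    -- The support of a column of pair `j` consists of the row pairs `j` and `j + 1`, and this set
    -- determines `j`.
    have key : ∀ i j : Fin 6, (i = j ∨ i + 1 = j) → (i = j + 1 ∨ i + 1 = j + 1) → i = j := by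
      decide
    exact key _ _ ((hn ((p' y').1, 0)).2 (Or.inl rfl)) ((hn ((p' y').1 + 1, 0)).2 (Or.inr rfl))
  have sum : ∀ x i, (if (p' (i, 0)).1 = (p x).1 then (1 : ℝ) else 0) = if i = x.1 then 1 else 0 := by
    intro x i
    rw [← R12_add (x := p x) (col (i, 0) (i, 1) rfl) (p'.injective.ne (a₁ := (i, 0)) (a₂ := (i, 1)) (by simp)), hR, hR,
      R12_add (y := (i, 0)) (y' := (i, 1)) rfl (by simp)]
  have same : ∀ x, (p' (x.1, 0)).1 = (p x).1 := by
    intro x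
    by_contra hne
    have := sum x x.1
    simp [hne] at this
  -- The nonzero block at `(i + 1, i)` must go to a nonzero block, and `sum` rules out that its
  -- image is a diagonal block.
  have next : ∀ i, (p' (i + 1, 0)).1 = (p' (i, 0)).1 + 1 := by
    intro i
    have h1 : R12 (p (i + 1, 0)) (p' (i, 0)) ≠ 0 := by
      rw [hR, R12_ne_zero_iff]
      exact Or.inr rfl
    rw [R12_ne_zero_iff, ← same (i + 1, 0)] at h1
    rcases h1 with h1 | h1
    · have := sum (i + 1, 0) i
      rw [← same (i + 1, 0), if_pos h1] at this
      simp at this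
    · exact h1.symm
  have all := cyclic_induction (p := fun i => (p' (i, 0)).1 = i + (p' (0, 0)).1) (i := 0)
    (by simp) (fun i hi => by rw [next, hi]; abel)
  exact ⟨(p' (0, 0)).1, fun x => by rw [← same, all]⟩

/-- Equivalent matrices have the same type up to rotation. -/
lemma Equivalent.exists_hasType_iff {B B' : Matrix (Fin 6 × Fin 2) (Fin 6 × Fin 2) ℝ}
    (h : Equivalent B B') : ∃ n, ∀ T, HasType B T ↔ HasType B' (rotate T n) := by
  induction h with
  | rel B B' h =>
    cases h with
    | block i j h =>
      refine ⟨0, fun T => ?_⟩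
      rw [rotate_zero]
      exact ⟨fun hT => hT.blockCompl h, fun hT => by
        simpa only [blockCompl_blockCompl] using hT.blockCompl h⟩
    | compl =>
      refine ⟨0, fun T => ?_⟩
      rw [rotate_zero]
      exact ⟨fun hT => hT.compl, fun hT => by simpa using hT.compl⟩
    | conj p p' h =>
      obtain ⟨n, hn⟩ := exists_rotation h
      refine ⟨n, fun T => ⟨fun hT => hT.submatrix p hn, fun hT => ?_⟩⟩
      have := hT.submatrix p.symm (n := -n) fun x => by
        rw [← sub_eq_add_neg, eq_sub_iff_add_eq, ← hn, Equiv.apply_symm_apply]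
      simpa [Matrix.submatrix_submatrix, rotate_rotate, rotate_zero] using this
  | refl B => exact ⟨0, fun T => by rw [rotate_zero]⟩
  | symm B B' _ ih =>
    obtain ⟨n, hn⟩ := ih
    exact ⟨-n, fun T => by rw [hn, rotate_rotate, neg_add_cancel, rotate_zero]⟩
  | trans B B' B'' _ _ ih ih' =>
    obtain ⟨n, hn⟩ := ih
    obtain ⟨m, hm⟩ := ih'
    exact ⟨n + m, fun T => by rw [hn, hm, rotate_rotate]⟩

section SameType

variable {B B' : Matrix (Fin 6 × Fin 2) (Fin 6 × Fin 2) ℝ} {T : Fin 6 → Fin 6 → Blk}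

/-- Complementing the whole matrix exchanges the two possible values of the diagonal parameter `δ`
and keeps the types. -/
lemma HasType.exists_zero_diag (h : HasType B T) :
    ∃ B', Equivalent B B' ∧ HasType B' T ∧ ∀ i a b, B' (i, a) (i, b) = 0 := by
  obtain ⟨δ, rfl | rfl, hd⟩ := h.diag
  · exact ⟨B, .refl _, h, fun i a b => by simp [hd]⟩
  · refine ⟨_, .rel _ _ (.compl B), h.compl, fun i a b => ?_⟩
    simp only [Matrix.sub_apply, Matrix.of_apply, Matrix.one_apply, hd, Prod.mk.injEq, true_and]
    split_ifs <;> ring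

/-- The set `s` contains all block positions at which `B` and `B'` may still differ. Two blocks of
the same type are equal or complementary, so one block complementation removes a position from `s`.
-/
lemma equivalent_of_agree (s : Finset (Fin 6 × Fin 6)) (h : HasType B T) (h' : HasType B' T)
    (hd : ∀ i a b, B (i, a) (i, b) = 0) (hd' : ∀ i a b, B' (i, a) (i, b) = 0)
    (hs : ∀ i j, i < j → (i, j) ∉ s → ∀ a b, B (i, a) (j, b) = B' (i, a) (j, b)) :
    Equivalent B B' := by
  induction s using Finset.induction_on generalizing B with
  | empty =>
    have : B = B' := by
      ext ⟨i, a⟩ ⟨j, b⟩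
      rcases lt_trichotomy i j with h1 | rfl | h1
      · exact hs i j h1 (by simp) a b
      · rw [hd, hd']
      · rw [h.symm, h'.symm]
        exact hs j i h1 (by simp) b a
    rw [this]
    exact .refl _
  | insert q s hq ih =>
    obtain ⟨k, l⟩ := q
    by_cases hkl : k < l
    swap
    · refine ih h hd fun i j hij hm => hs i j hij ?_
      rw [Finset.mem_insert, not_or]
      exact ⟨fun e => hkl (by rw [Prod.mk.injEq] at e; rw [← e.1, ← e.2]; exact hij), hm⟩
    by_cases hB : ∀ a b, B (k, a) (l, b) = B' (k, a) (l, b)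
    · refine ih h hd fun i j hij hm => ?_
      by_cases e : (i, j) = (k, l)
      · rw [Prod.mk.injEq] at e
        rw [e.1, e.2]
        exact hB
      · exact hs i j hij (by simp [hm, e])
    · have hc : ∀ a b, 1 - B (k, a) (l, b) = B' (k, a) (l, b) := by
        rcases h.block k l hkl.ne with h1 | h1 <;> rcases h'.block k l hkl.ne with h2 | h2
        · exact absurd (fun a b => (h1 a b).trans (h2 a b).symm) hB
        · exact fun a b => (congrArg (1 - ·) (h1 a b)).trans (h2 a b).symm
        · exact fun a b => (congrArg (1 - ·) (h1 a b)).trans ((sub_sub_cancel _ _).trans (h2 a b).symm)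
        · exact absurd (fun a b => (h1 a b).trans (h2 a b).symm) hB
      refine .trans _ _ _ (.rel _ _ (.block B k l hkl.ne)) (ih (h.blockCompl hkl.ne) ?_ ?_)
      · intro i a b
        simp only [blockCompl, Matrix.of_apply]
        rw [if_neg, hd]
        rintro (⟨h1, h2⟩ | ⟨h1, h2⟩)
        · exact hkl.ne (h1.symm.trans h2)
        · exact hkl.ne (h2.symm.trans h1)
      · intro i j hij hm a b
        simp only [blockCompl, Matrix.of_apply]
        by_cases e : i = k ∧ j = l
        · rw [if_pos (Or.inl e), e.1, e.2, hc]
        · rw [if_neg, hs i j hij (by simp [hm, e])]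
          rintro (h1 | ⟨h1, h2⟩)
          · exact e h1
          · rw [h1, h2] at hij
            exact lt_asymm hij hkl

lemma HasType.equivalent (h : HasType B T) (h' : HasType B' T) : Equivalent B B' := by
  obtain ⟨C, e, hC, hd⟩ := h.exists_zero_diag
  obtain ⟨C', e', hC', hd'⟩ := h'.exists_zero_diag
  exact .trans _ _ _ e (.trans _ _ _
    (equivalent_of_agree Finset.univ hC hC' hd hd' fun _ _ _ hm => absurd (Finset.mem_univ _) hm)
    (.symm _ _ e'))

end SameType

/-- Equivalences only rotate the array of types. Conversely, every rotation of the pairs is an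
automorphism of the block circulant `R12`, and equal types suffice for equivalence. -/
lemma equivalent_table_iff {k : Fin 18} {B : Matrix (Fin 6 × Fin 2) (Fin 6 × Fin 2) ℝ} :
    Equivalent (table k) B ↔ ∃ n, HasType B (rotate (blockTable k) n) := by
  constructor
  · intro h
    obtain ⟨n, hn⟩ := h.exists_hasType_iff
    exact ⟨n, (hn _).1 (hasType_table k)⟩
  · rintro ⟨n, hn⟩
    let p : Equiv.Perm (Fin 6 × Fin 2) := (Equiv.addRight n).prodCongr (Equiv.refl _)
    have hp : R12.submatrix p p = R12 := by
      ext x y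
      simp [R12, p, add_sub_right_comm]
    exact .trans _ _ _ (.rel _ _ (.conj _ p p hp))
      (((hasType_table k).submatrix p fun x => rfl).equivalent hn)

lemma eq_of_equivalent_table {k l : Fin 18} (h : Equivalent (table k) (table l)) : k = l := by
  obtain ⟨n, hn⟩ := equivalent_table_iff.1 h
  have := hn.unique (hasType_table l)
  exact eq_of_rotate_blockTable fun i j => congrFun (congrFun this i) j

/-! ### Reducibility: factorizations from fitting permutations, and their absence for the table. -/

section Extend

variable {ι : Type*}

lemma extend_mul [Fintype ι] (d : ℕ) (R S : Matrix ι ι ℝ) : extend d (R * S) = extend d R * extend d S := by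
  simp [extend, Matrix.fromBlocks_multiply]

lemma extend_one [DecidableEq ι] (d : ℕ) : extend d (1 : Matrix ι ι ℝ) = 1 := Matrix.fromBlocks_one

lemma prod_map_extend [Fintype ι] [DecidableEq ι] (d : ℕ) (L : List (Matrix ι ι ℝ)) :
    (L.map (extend d)).prod = extend d L.prod := by
  induction L with
  | nil => simp [extend_one]
  | cons M L ih => simp [ih, extend_mul]

/-- The inner block and each outer column can be tested separately, which reduces the quantifier
over all `A` in the definition of reducibility to single zero-one vectors. -/
lemma extend_conj_isAdjMatrix_iff [Fintype ι] {d : ℕ} {A : Matrix (ι ⊕ Fin d) (ι ⊕ Fin d) ℝ}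
    (hA : A.IsAdjMatrix) (P : Matrix ι ι ℝ) :
    ((extend d P)ᵀ * A * extend d P).IsAdjMatrix ↔ (Pᵀ * A.toBlocks₁₁ * P).IsAdjMatrix ∧
      ∀ x j, (Pᵀ * A.toBlocks₁₂) x j = 0 ∨ (Pᵀ * A.toBlocks₁₂) x j = 1 := by
  have e : (extend d P)ᵀ * A * extend d P = Matrix.fromBlocks (Pᵀ * A.toBlocks₁₁ * P)
      (Pᵀ * A.toBlocks₁₂) (A.toBlocks₂₁ * P) A.toBlocks₂₂ := by
    conv_lhs => rw [← Matrix.fromBlocks_toBlocks A]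
    simp [extend, Matrix.fromBlocks_transpose, Matrix.fromBlocks_multiply]
  have h21 : A.toBlocks₂₁ = A.toBlocks₁₂ᵀ := by
    ext i j
    exact (hA.symm.apply _ _).symm
  have h' : A.toBlocks₂₁ * P = (Pᵀ * A.toBlocks₁₂)ᵀ := by
    rw [h21, Matrix.transpose_mul, Matrix.transpose_transpose]
  rw [e, h']
  constructor
  · intro h
    refine ⟨?_, fun x j => h.zero_or_one (Sum.inl x) (Sum.inr j)⟩
    exact h.submatrix Sum.inl
  · rintro ⟨h1, h2⟩
    refine ⟨?_, ?_, ?_⟩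
    · rintro (x | x) (y | y)
      · exact h1.zero_or_one x y
      · exact h2 x y
      · exact h2 y x
      · exact hA.zero_or_one (Sum.inr x) (Sum.inr y)
    · refine Matrix.IsSymm.fromBlocks h1.symm rfl ?_
      exact hA.symm.submatrix Sum.inr
    · rintro (x | x)
      · exact h1.apply_diag x
      · exact hA.apply_diag (Sum.inr x)

end Extend

/-- A zero-one vector is mapped to a zero-one vector by the transpose of `R₁₂` only if the
parities of its restrictions to the pairs agree. -/
lemma zero_or_one_of_R12 {v : Fin 6 × Fin 2 → ℝ} (hv : ∀ x, v x = 0 ∨ v x = 1)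
    (hR : ∀ y, ∑ x, R12 x y * v x = 0 ∨ ∑ x, R12 x y * v x = 1) (τ : Equiv.Perm (Fin 6))
    (y : Fin 6 × Fin 2) :
    ∑ x, pairMatrix τ x y * v x = 0 ∨ ∑ x, pairMatrix τ x y * v x = 1 := by
  have hR' := fun k a => hR (k, a)
  simp only [R12_eq, sum_pairMatrix_mul, Equiv.coe_addRight] at hR'
  -- The image has the coordinate `(sum on pair k + difference on pair k + 1) / 2`; integrality
  -- equates the parities of neighbouring pairs.
  have next : ∀ k, (v (k, 0) = v (k, 1) ↔ v (k + 1, 0) = v (k + 1, 1)) := by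
    intro k
    have h0 := hR' k 0
    simp only [sg_zero] at h0
    rcases hv (k, 0) with h1 | h1 <;> rcases hv (k, 1) with h2 | h2 <;>
      rcases hv (k + 1, 0) with h3 | h3 <;> rcases hv (k + 1, 1) with h4 | h4 <;>
      rw [h1, h2, h3, h4] at h0 ⊢ <;> revert h0 <;> norm_num
  have all : ∀ i j, (v (i, 0) = v (i, 1) ↔ v (j, 0) = v (j, 1)) := fun i =>
    cyclic_induction (i := i) Iff.rfl fun j hj => hj.trans (next j)
  obtain ⟨k, a⟩ := y
  rw [sum_pairMatrix_mul]
  have h := all k (τ k)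
  rcases hv (k, 0) with h1 | h1 <;> rcases hv (k, 1) with h2 | h2 <;>
    rcases hv (τ k, 0) with h3 | h3 <;> rcases hv (τ k, 1) with h4 | h4 <;>
    rw [h1, h2, h3, h4] at h ⊢ <;> revert h <;> fin_cases a <;> norm_num

lemma mul_toBlocks₁₂ {d : ℕ} (P : Matrix (Fin 6 × Fin 2) (Fin 6 × Fin 2) ℝ)
    (A : Matrix (Fin 6 × Fin 2 ⊕ Fin d) (Fin 6 × Fin 2 ⊕ Fin d) ℝ) (x : Fin 6 × Fin 2)
    (j : Fin d) : (Pᵀ * A.toBlocks₁₂) x j = ∑ y, P y x * A.toBlocks₁₂ y j := rfl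

/-- A proper factorization of the cyclic shift gives a reduction. -/
lemma HasType.isReducible {B : Matrix (Fin 6 × Fin 2) (Fin 6 × Fin 2) ℝ}
    {T : Fin 6 → Fin 6 → Blk} (h : HasType B T) {τ : Fin 6 → Fin 6} (hτ : IsReducer τ)
    (hF : Fits T τ) : IsReducible R12 B := by
  obtain ⟨hinj, ⟨s, hs, hs', h1⟩, t, ht, ht', h2⟩ := hτ
  let σ : Equiv.Perm (Fin 6) := Equiv.ofBijective τ (Finite.injective_iff_bijective.1 hinj)
  -- With two factors the only nontrivial intermediate stage is conjugation by `pairMatrix σ`. A set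
  -- invariant under `i ↦ τ i - 1` is also invariant under the inverse map `σ⁻¹ * shift`.
  refine ⟨[pairMatrix σ, pairMatrix (σ⁻¹ * shift)], ?_, ?_, ?_⟩
  · simp only [List.mem_cons, List.not_mem_nil, or_false, forall_eq_or_imp, forall_eq]
    refine ⟨⟨pairMatrix_regular _, pairMatrix_decomposable hs hs' h1⟩, pairMatrix_regular _,
      pairMatrix_decomposable ht ht' fun i => ?_⟩
    rw [← h2 ((σ⁻¹ * shift) i)]
    have : τ ((σ⁻¹ * shift) i) = i + 1 := σ.apply_symm_apply _
    rw [this, add_sub_cancel_right]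
  · simp [pairMatrix_mul, R12_eq]
  · intro d A hA hB hA' i hi
    rw [prod_map_extend]
    simp only [List.length_cons, List.length_nil] at hi
    interval_cases i
    · simpa [extend_one] using hA
    · rw [extend_conj_isAdjMatrix_iff hA] at hA' ⊢
      rw [hB] at hA' ⊢
      simp only [mul_toBlocks₁₂] at hA' ⊢
      simp only [List.take_succ_cons, List.take_zero, List.prod_cons, List.prod_nil, mul_one]
      exact ⟨(h.isAdjMatrix_conj_iff σ).2 hF, fun x j => zero_or_one_of_R12
        (fun y => hA.zero_or_one _ _) (fun y => hA'.2 y j) σ x⟩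

lemma exists_eq_single {g : Fin 6 → ℝ} (hg : ∀ i, g i = 0 ∨ g i = 1) (hs : ∑ i, g i = 1) :
    ∃ k, ∀ i, g i = if k = i then 1 else 0 := by
  have h0 : ∀ i, 0 ≤ g i := fun i => by rcases hg i with h | h <;> rw [h]; norm_num
  obtain ⟨k, hk⟩ : ∃ k, g k = 1 := by
    by_contra hne
    push Not at hne
    rw [Finset.sum_eq_zero fun i _ => (hg i).resolve_right (hne i)] at hs
    norm_num at hs
  refine ⟨k, fun i => ?_⟩
  split_ifs with e
  · rw [← e, hk]
  · refine (hg i).resolve_right fun hi => ?_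
    have := Finset.add_le_sum (fun j _ => h0 j) (Finset.mem_univ k) (Finset.mem_univ i) e
    rw [hs, hk, hi] at this
    norm_num at this

/-- By the parallelogram identity, the squares of all pair sums and differences add up to twice the
squared norm; for values in `{0, 1, -1}` squares are absolute values. -/
lemma sum_abs_add_sum_abs {p : Fin 6 × Fin 2 → ℝ}
    (hU : ∀ i, p (i, 0) + p (i, 1) = 0 ∨ p (i, 0) + p (i, 1) = 1 ∨ p (i, 0) + p (i, 1) = -1)
    (hW : ∀ i, p (i, 0) - p (i, 1) = 0 ∨ p (i, 0) - p (i, 1) = 1 ∨ p (i, 0) - p (i, 1) = -1)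
    (hn : ∑ x, p x * p x = 1) :
    ∑ i, |p (i, 0) + p (i, 1)| + ∑ i, |p (i, 0) - p (i, 1)| = 2 := by
  rw [Fintype.sum_prod_type] at hn
  simp only [Fin.sum_univ_two] at hn
  rw [← Finset.sum_add_distrib]
  refine Eq.trans ?_ (congrArg (2 * ·) hn |>.trans (mul_one _))
  simp only [Finset.mul_sum]
  refine Finset.sum_congr rfl fun i _ => ?_
  have key : ∀ x : ℝ, x = 0 ∨ x = 1 ∨ x = -1 → |x| = x ^ 2 := by
    rintro x (rfl | rfl | rfl) <;> norm_num
  rw [key _ (hU i), key _ (hW i)]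
  ring

/-- A vector is determined by the sums and differences of its coordinates in each pair. -/
lemma exists_pair_form {p : Fin 6 × Fin 2 → ℝ}
    (hU : ∀ i, p (i, 0) + p (i, 1) = 0 ∨ p (i, 0) + p (i, 1) = 1)
    (hW : ∀ i, p (i, 0) - p (i, 1) = 0 ∨ p (i, 0) - p (i, 1) = 1 ∨ p (i, 0) - p (i, 1) = -1)
    (hUs : ∑ i, (p (i, 0) + p (i, 1)) = 1) (hWs : ∑ i, |p (i, 0) - p (i, 1)| = 1) :
    ∃ k m b, ∀ x, p x =
      ((if k = x.1 then 1 else 0) + (if m = x.1 then sg x.2 * sg b else 0)) / 2 := by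
  have hWabs : ∀ i, |p (i, 0) - p (i, 1)| = 0 ∨ |p (i, 0) - p (i, 1)| = 1 := by
    intro i
    rcases hW i with h | h | h <;> rw [h] <;> norm_num
  obtain ⟨k, hk⟩ := exists_eq_single hU hUs
  obtain ⟨m, hm⟩ := exists_eq_single hWabs hWs
  have hm' : ∀ i, m ≠ i → p (i, 0) - p (i, 1) = 0 := fun i hi => by
    rw [← abs_eq_zero, hm, if_neg hi]
  obtain ⟨b, hb⟩ : ∃ b : Fin 2, p (m, 0) - p (m, 1) = sg b := by
    rcases hW m with h | h | h
    · have := hm m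
      rw [if_pos rfl, h, abs_zero] at this
      norm_num at this
    · exact ⟨0, h⟩
    · exact ⟨1, by rw [h, sg_one]⟩
  refine ⟨k, m, b, ?_⟩
  rintro ⟨i, a⟩
  have h1 := hk i
  have h2 : p (i, 0) - p (i, 1) = if m = i then sg b else 0 := by
    split_ifs with e
    · rw [← e, hb]
    · exact hm' i e
  have h3 : (if m = i then sg a * sg b else 0) = sg a * if m = i then sg b else 0 := by
    split_ifs <;> simp
  simp only [h3]
  rw [← h1, ← h2]
  fin_cases a
  · simp
  · simp
    ring

/-- The columns of the matrices that preserve the relevant zero-one vectors. -/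
lemma column_structure {p : Fin 6 × Fin 2 → ℝ}
    (hU : ∀ i, p (i, 0) + p (i, 1) = 0 ∨ p (i, 0) + p (i, 1) = 1)
    (hsum : ∑ i, (p (i, 0) + p (i, 1)) ≤ 1)
    (hs : ∀ s : Fin 6 → Fin 2, ∑ i, p (i, s i) = 0 ∨ ∑ i, p (i, s i) = 1)
    (hn : ∑ x, p x * p x = 1) :
    ∃ k m b, ∀ x, p x =
      ((if k = x.1 then 1 else 0) + (if m = x.1 then sg x.2 * sg b else 0)) / 2 := by
  have hW : ∀ i, p (i, 0) - p (i, 1) = 0 ∨ p (i, 0) - p (i, 1) = 1 ∨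
      p (i, 0) - p (i, 1) = -1 := by
    intro i
    -- Changing a transversal in pair `i` alone changes its sum by the difference in that pair.
    have h1 := hs fun _ => 0
    have h2 := hs fun j => if j = i then 1 else 0
    have e : ∑ j, p (j, if j = i then 1 else 0) = ∑ j, p (j, 0) - (p (i, 0) - p (i, 1)) := by
      have : ∀ j, p (j, if j = i then 1 else 0) =
          p (j, 0) - if j = i then p (i, 0) - p (i, 1) else 0 := by
        intro j
        split_ifs with hj
        · rw [hj]; ring
        · ring
      simp only [this, Finset.sum_sub_distrib, Finset.sum_ite_eq', Finset.mem_univ, if_true]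
    rw [e] at h2
    rcases h1 with h1 | h1 <;> rw [h1] at h2 <;> rcases h2 with h2 | h2
    · left; linarith
    · right; right; linarith
    · right; left; linarith
    · left; linarith
  have hWsum : ∑ i, |p (i, 0) - p (i, 1)| ≤ 1 := by
    -- The total of the absolute differences is the largest transversal sum minus the smallest, and
    -- both are zero or one.
    have h1 := hs fun i => if p (i, 1) ≤ p (i, 0) then 0 else 1
    have h2 := hs fun i => if p (i, 1) ≤ p (i, 0) then 1 else 0
    have e : ∑ i, |p (i, 0) - p (i, 1)| = ∑ i, p (i, if p (i, 1) ≤ p (i, 0) then 0 else 1) -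
        ∑ i, p (i, if p (i, 1) ≤ p (i, 0) then 1 else 0) := by
      rw [← Finset.sum_sub_distrib]
      refine Finset.sum_congr rfl fun i _ => ?_
      split_ifs with h
      · rw [abs_of_nonneg (by linarith)]
      · rw [abs_of_neg (by linarith)]; ring
    rw [e]
    rcases h1 with h1 | h1 <;> rcases h2 with h2 | h2 <;> rw [h1, h2] <;> norm_num
  have hn2 := sum_abs_add_sum_abs (fun i => (hU i).imp_right Or.inl) hW hn
  have hUabs : ∑ i, |p (i, 0) + p (i, 1)| = ∑ i, (p (i, 0) + p (i, 1)) :=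
    Finset.sum_congr rfl fun i _ => abs_of_nonneg (by rcases hU i with h | h <;> rw [h]; norm_num)
  -- Two quantities that are at most one and add up to two are both equal to one.
  exact exists_pair_form hU hW (by linarith) (by linarith)

/-- An orthogonal matrix with columns of the given form is one of the matrices `pairMatrix τ`, up
to a permutation of the columns. -/
lemma eq_pairMatrix_of_columns {M : Matrix (Fin 6 × Fin 2) (Fin 6 × Fin 2) ℝ}
    (horth : ∀ y y', ∑ x, M x y * M x y' = if y = y' then 1 else 0)
    (hcol : ∀ y, ∃ k m b, ∀ x, M x y =
      ((if k = x.1 then 1 else 0) + (if m = x.1 then sg x.2 * sg b else 0)) / 2) :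
    ∃ (τ : Equiv.Perm (Fin 6)) (f : Equiv.Perm (Fin 6 × Fin 2)),
      M = (pairMatrix τ).submatrix id f := by
  choose k m b h using hcol
  -- This is twice the inner product of two columns. It vanishes only if the sum parts and the
  -- difference parts coincide simultaneously, with opposite signs, or both differ.
  have hrel : ∀ y y', y ≠ y' → (if k y = k y' then (1 : ℝ) else 0) +
      (if m y = m y' then sg (b y) * sg (b y') else 0) = 0 := by
    intro y y' hne
    have h0 := horth y y'
    rw [if_neg hne] at h0
    simp only [h, Fintype.sum_prod_type, Fin.sum_univ_two, sg_zero, sg_one] at h0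
    have e : ∀ i, ((if k y = i then (1 : ℝ) else 0) + if m y = i then 1 * sg (b y) else 0) / 2 *
          (((if k y' = i then 1 else 0) + if m y' = i then 1 * sg (b y') else 0) / 2) +
        ((if k y = i then (1 : ℝ) else 0) + if m y = i then -1 * sg (b y) else 0) / 2 *
          (((if k y' = i then 1 else 0) + if m y' = i then -1 * sg (b y') else 0) / 2) =
        (if k y' = i then (if k y = i then 1 / 2 else 0) else 0) +
        (if m y' = i then (if m y = i then sg (b y) * sg (b y') / 2 else 0) else 0) := by
      intro i
      split_ifs <;> ring
    simp only [e, Finset.sum_add_distrib, Finset.sum_ite_eq, Finset.mem_univ, if_true] at h0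
    by_cases h1 : k y = k y' <;> by_cases h2 : m y = m y' <;> simp only [h1, h2, if_true,
      if_false] at h0 ⊢ <;> linarith
  have hsg : ∀ a c : Fin 2, sg a * sg c ≠ 0 := by
    intro a c
    fin_cases a <;> fin_cases c <;> simp
  have hkm : ∀ y y', k y = k y' ↔ m y = m y' := by
    intro y y'
    by_cases hne : y = y'
    · simp [hne]
    have := hrel y y' hne
    by_cases h1 : k y = k y' <;> by_cases h2 : m y = m y' <;> simp [h1, h2] at this ⊢
    exact absurd this (by simpa using hsg (b y) (b y'))
  let f : Fin 6 × Fin 2 → Fin 6 × Fin 2 := fun y => (k y, b y)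
  have hf : Function.Injective f := by
    intro y y' hy
    by_contra hne
    have := hrel y y' hne
    simp only [f, Prod.mk.injEq] at hy
    rw [if_pos hy.1, if_pos ((hkm y y').1 hy.1), hy.2, sg_mul_self] at this
    norm_num at this
  let F : Equiv.Perm (Fin 6 × Fin 2) :=
    Equiv.ofBijective f (Finite.injective_iff_bijective.1 hf)
  have hkF : ∀ i, k (F.symm (i, 0)) = i := fun i =>
    congrArg Prod.fst (F.apply_symm_apply (i, 0))
  have ht : Function.Injective fun i => m (F.symm (i, 0)) := by
    intro i j hij
    have := (hkm _ _).2 hij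
    rwa [hkF, hkF] at this
  refine ⟨Equiv.ofBijective _ (Finite.injective_iff_bijective.1 ht), F, ?_⟩
  ext x y
  have e : m (F.symm (k y, 0)) = m y := (hkm _ _).1 (hkF _)
  rw [Matrix.submatrix_apply, h y x]
  simp only [pairMatrix, Matrix.of_apply, id_eq, Equiv.ofBijective_apply, F, f] at e ⊢
  rw [e]


/-- An orthogonal matrix whose transpose maps the zero-one vectors that are relevant for `R₁₂` to
zero-one vectors is one of the matrices `pairMatrix τ`, up to a permutation of the columns. -/
lemma exists_eq_pairMatrix {M : Matrix (Fin 6 × Fin 2) (Fin 6 × Fin 2) ℝ}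
    (hM : M ∈ orthogonalGroup (Fin 6 × Fin 2) ℝ)
    (hv : ∀ v : Fin 6 × Fin 2 → ℝ, (∀ x, v x = 0 ∨ v x = 1) →
      (∀ y, ∑ x, R12 x y * v x = 0 ∨ ∑ x, R12 x y * v x = 1) →
      ∀ y, ∑ x, M x y * v x = 0 ∨ ∑ x, M x y * v x = 1) :
    ∃ (τ : Equiv.Perm (Fin 6)) (f : Equiv.Perm (Fin 6 × Fin 2)),
      M = (pairMatrix τ).submatrix id f := by
  have horth : ∀ y y', ∑ x, M x y * M x y' = if y = y' then 1 else 0 := by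
    intro y y'
    have := congrFun (congrFun ((mem_orthogonalGroup_iff' _ _).1 hM) y) y'
    rwa [Matrix.mul_apply, Matrix.one_apply] at this
  have hU : ∀ i y, M (i, 0) y + M (i, 1) y = 0 ∨ M (i, 0) y + M (i, 1) y = 1 := by
    intro i y
    have := hv (fun x => if x.1 = i then 1 else 0) (fun x => by split_ifs <;> simp) (fun y => by
      obtain ⟨k, a⟩ := y
      rw [R12_eq, sum_pairMatrix_mul]
      by_cases h1 : k = i <;> by_cases h2 : k + 1 = i <;> simp [h1, h2]) y
    simpa [Fintype.sum_prod_type, Finset.sum_add_distrib] using this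
  have hone : ∀ y, ∑ i, (M (i, 0) y + M (i, 1) y) ≤ 1 := by
    intro y
    have := hv (fun x => 1) (fun x => Or.inr rfl) (fun y => by
      obtain ⟨k, a⟩ := y
      rw [R12_eq, sum_pairMatrix_mul]
      norm_num) y
    simp only [Fintype.sum_prod_type, Fin.sum_univ_two, mul_one] at this
    rcases this with h | h <;> rw [h]; norm_num
  -- The test vectors are the admissible ones of three kinds: a full pair, all the vertices, and
  -- here a transversal of the pairs.
  have hodd : ∀ y (s : Fin 6 → Fin 2), ∑ i, M (i, s i) y = 0 ∨ ∑ i, M (i, s i) y = 1 := by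
    intro y s
    have key : ∀ c : Fin 2, (c = 0 ∧ ¬ 1 = c) ∨ (c = 1 ∧ ¬ 0 = c) := by decide
    have := hv (fun x => if x.2 = s x.1 then 1 else 0) (fun x => by split_ifs <;> simp)
      (fun y => by
        obtain ⟨k, a⟩ := y
        rw [R12_eq, sum_pairMatrix_mul]
        simp only [Equiv.coe_addRight]
        rcases key (s k) with ⟨h1, h1'⟩ | ⟨h1, h1'⟩ <;>
          rcases key (s (k + 1)) with ⟨h2, h2'⟩ | ⟨h2, h2'⟩ <;>
          rcases key a with ⟨h3, -⟩ | ⟨h3, -⟩ <;> simp [h1, h2, h3]) y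
    simpa [Fintype.sum_prod_type] using this
  exact eq_pairMatrix_of_columns horth fun y => column_structure (p := fun x => M x y)
    (fun i => hU i y) (hone y) (hodd y) ((horth y y).trans (if_pos rfl))

lemma isDecomposable_submatrix {ι κ : Type*} [Fintype ι] [DecidableEq ι] [Fintype κ]
    [DecidableEq κ] {M : Matrix ι ι ℝ} (h : IsDecomposable M) (e f : κ ≃ ι) :
    IsDecomposable (M.submatrix e f) := by
  obtain ⟨S, T, h1, h2, h3, h4⟩ := h
  refine ⟨S.map e.symm.toEmbedding, T.map f.symm.toEmbedding, h1.map, fun hS => h2 ?_, by simpa,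
    fun i j hij => ?_⟩
  · rw [← Finset.univ_map_equiv_to_embedding e.symm] at hS
    exact Finset.map_injective _ hS
  · simpa using h4 _ _ hij

lemma R12_mem_orthogonalGroup : R12 ∈ orthogonalGroup (Fin 6 × Fin 2) ℝ := by
  rw [R12_eq]
  exact pairMatrix_mem _

/-- If no permutation but the identity and the cyclic shift fits the types of the blocks,
the switching set is not reducible. -/
lemma HasType.not_isReducible {B : Matrix (Fin 6 × Fin 2) (Fin 6 × Fin 2) ℝ}
    {T : Fin 6 → Fin 6 → Blk} (h : HasType B T) (hF : Fits T (· + 1))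
    (hT : ∀ τ : Fin 6 → Fin 6, Function.Injective τ → Fits T τ →
      (∀ i, τ i = i) ∨ ∀ i, τ i = i + 1) : ¬ IsReducible R12 B := by
  rintro ⟨L, hL, hprod, hA⟩
  have hsw := h.mem_switchable_iff.2 hF
  have orth : ∀ i, (L.take i).prod ∈ orthogonalGroup (Fin 6 × Fin 2) ℝ := fun i =>
    list_prod_mem fun S hS => (hL S (List.mem_of_mem_take hS)).1.1
  have form : ∀ i < L.length, ∃ f : Equiv.Perm (Fin 6 × Fin 2),
      (L.take i).prod = (1 : Matrix _ _ ℝ).submatrix id f ∨ (L.take i).prod = R12.submatrix id f := by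
    intro i hi
    have test : ∀ v : Fin 6 × Fin 2 → ℝ, (∀ x, v x = 0 ∨ v x = 1) →
        (∀ y, ∑ x, R12 x y * v x = 0 ∨ ∑ x, R12 x y * v x = 1) →
        ((L.take i).prodᵀ * B * (L.take i).prod).IsAdjMatrix ∧
          ∀ y, ∑ x, (L.take i).prod x y * v x = 0 ∨ ∑ x, (L.take i).prod x y * v x = 1 := by
      intro v hv hR
      let V : Matrix (Fin 6 × Fin 2) (Fin 1) ℝ := Matrix.of fun x _ => v x
      have hadj : (Matrix.fromBlocks B V Vᵀ 0).IsAdjMatrix := by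
        refine ⟨?_, Matrix.IsSymm.fromBlocks hsw.1.symm rfl rfl, ?_⟩
        · rintro (x | x) (y | y)
          · exact hsw.1.zero_or_one x y
          · exact hv x
          · exact hv y
          · exact Or.inl rfl
        · rintro (x | x)
          · exact hsw.1.apply_diag x
          · rfl
      -- One outer vertex with adjacency vector `v` suffices to test the partial product on `v`.
      have := hA 1 (Matrix.fromBlocks B V Vᵀ 0) hadj (Matrix.toBlocks_fromBlocks₁₁ _ _ _ _)
        ((extend_conj_isAdjMatrix_iff hadj R12).2
          ⟨by rw [Matrix.toBlocks_fromBlocks₁₁]; exact hsw.2, fun y _ => hR y⟩) i hi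
      rw [prod_map_extend, extend_conj_isAdjMatrix_iff hadj, Matrix.toBlocks_fromBlocks₁₁] at this
      exact ⟨this.1, fun y => this.2 y 0⟩
    obtain ⟨τ, f, hτ⟩ := exists_eq_pairMatrix (orth i) fun v hv hR => (test v hv hR).2
    -- The condition on `B` does not involve `v`, so the zero vector serves to extract it.
    have hB := (test 0 (fun _ => Or.inl rfl) (fun _ => Or.inl (by simp))).1
    have e : (L.take i).prodᵀ * B * (L.take i).prod =
        ((pairMatrix τ)ᵀ * B * pairMatrix τ).submatrix f f := by
      rw [hτ]
      ext x y
      simp [Matrix.mul_apply]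
    rw [e, Matrix.isAdjMatrix_submatrix_iff f.surjective, h.isAdjMatrix_conj_iff] at hB
    refine ⟨f, (hT τ τ.injective hB).imp (fun h1 => ?_) fun h1 => ?_⟩
    · rw [hτ, show τ = 1 from Equiv.ext h1, pairMatrix_one]
    · rw [hτ, show τ = shift from Equiv.ext h1, R12_eq]
  have form' : ∀ i ≤ L.length, ∃ f : Equiv.Perm (Fin 6 × Fin 2),
      (L.take i).prod = (1 : Matrix _ _ ℝ).submatrix id f ∨
        (L.take i).prod = R12.submatrix id f := by
    intro i hi
    rcases hi.lt_or_eq with hi | rfl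
    · exact form i hi
    · exact ⟨1, Or.inr (by rw [List.take_length, hprod]; rfl)⟩
  have perm : ∀ i ≤ L.length, ∃ f : Equiv.Perm (Fin 6 × Fin 2),
      (L.take i).prod = (1 : Matrix _ _ ℝ).submatrix id f := by
    intro i
    induction i with
    | zero => exact fun _ => ⟨1, by simp⟩
    | succ i ih =>
      intro hi
      obtain ⟨g, hg⟩ := ih (by omega)
      obtain ⟨f, hf | hf⟩ := form' (i + 1) hi
      · exact ⟨f, hf⟩
      exfalso
      -- At the first passage from a permutation matrix to a column permutation of `R12`, the factor
      -- used is itself `R12` up to row and column order, so it cannot be decomposable.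
      have hlast : L[i].submatrix g.symm id = R12.submatrix id f := by
        rw [← hf, List.prod_take_succ _ _ hi, hg, ← Equiv.coe_refl, Matrix.one_submatrix_mul]
        rfl
      have := isDecomposable_submatrix (hL _ (List.getElem_mem hi)).2 g.symm (Equiv.refl _)
      rw [Equiv.coe_refl, hlast] at this
      exact R12_not_decomposable
        (by simpa [Matrix.submatrix_submatrix] using
          isDecomposable_submatrix this (Equiv.refl _) f.symm)
  -- The full product would then be a permutation matrix, but `R12` has an entry `1 / 2`.
  obtain ⟨f, hf⟩ := perm L.length le_rfl
  rw [List.take_length, hprod] at hf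
  have := congrFun (congrFun hf (0, 0)) (0, 0)
  rw [Matrix.submatrix_apply, Matrix.one_apply] at this
  simp only [R12, Matrix.of_apply, if_true] at this
  split_ifs at this <;> norm_num at this

/-- The table lists the irreducible switching sets of `R₁₂`. -/
theorem isIrreducible_R12_iff (B : Matrix (Fin 6 × Fin 2) (Fin 6 × Fin 2) ℝ) :
    IsIrreducible R12 B ↔ ∃ k, Equivalent (table k) B := by
  constructor
  · rintro ⟨hB, hred⟩
    obtain ⟨T, hT⟩ := exists_hasType hB
    rcases exists_table_or_reducer hT.isTypeArray (hT.mem_switchable_iff.1 hB) with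
      ⟨k, n, h⟩ | ⟨τ, hτ, hF⟩
    · refine ⟨k, equivalent_table_iff.2 ⟨-n, ?_⟩⟩
      rw [show (blockTable k : Fin 6 → Fin 6 → Blk) = rotate T n from
        funext fun i => funext fun j => (h i j).symm, rotate_rotate, add_neg_cancel, rotate_zero]
      exact hT
    · exact absurd (hT.isReducible hτ hF) hred
  · rintro ⟨k, h⟩
    obtain ⟨n, hn⟩ := equivalent_table_iff.1 h
    have hF : Fits (rotate (blockTable k) n) (· + 1) := by
      have := (fits_blockTable k).rotate n
      simpa only [add_right_comm _ n 1, add_sub_cancel_right] using this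
    refine ⟨hn.mem_switchable_iff.2 hF, hn.not_isReducible hF fun τ hτ hF' => ?_⟩
    refine (of_onlyTrivial (onlyTrivial_blockTable k) (fun i j hij => ?_) hF'.of_rotate).imp
      (fun h i => ?_) fun h i => ?_
    · simpa using @hτ (i - n) (j - n) (by simpa using hij)
    · simpa using h (i + n)
    · have := h (i + n)
      rw [add_sub_cancel_right, add_right_comm] at this
      exact add_right_cancel this

/-! Reducibility does not depend on the order of the rows and columns of `R`. -/

section Transport

lemma conj_submatrix {ι κ : Type*} [Fintype ι] [Fintype κ] (R B : Matrix ι ι ℝ) (e f : κ ≃ ι) :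
    (R.submatrix e f)ᵀ * B.submatrix e e * R.submatrix e f = (Rᵀ * B * R).submatrix f f := by
  rw [Matrix.transpose_submatrix, Matrix.submatrix_mul_equiv, Matrix.submatrix_mul_equiv]

lemma mem_switchable_submatrix_iff {ι κ : Type*} [Fintype ι] [Fintype κ] {R B : Matrix ι ι ℝ} (e f : κ ≃ ι) :
    B.submatrix e e ∈ switchable (R.submatrix e f) ↔ B ∈ switchable R := by
  simp only [switchable, Set.mem_ofPred_eq]
  rw [conj_submatrix, Matrix.isAdjMatrix_submatrix_iff e.surjective,
    Matrix.isAdjMatrix_submatrix_iff f.surjective]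

lemma extend_submatrix {ι κ : Type*} (d : ℕ) (R : Matrix ι ι ℝ) (e f : κ ≃ ι) :
    extend d (R.submatrix e f) = (extend d R).submatrix (e.sumCongr (Equiv.refl (Fin d)))
      (f.sumCongr (Equiv.refl (Fin d))) := by
  ext (x | x) (y | y) <;> simp [extend, Matrix.one_apply]

variable {ι κ : Type*} [Fintype ι] [DecidableEq ι] [Fintype κ] [DecidableEq κ]

lemma isRegularOrthogonal_submatrix {M : Matrix ι ι ℝ} (h : IsRegularOrthogonal M) (e f : κ ≃ ι) :
    IsRegularOrthogonal (M.submatrix e f) := by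
  obtain ⟨h1, c, hc⟩ := h
  refine ⟨?_, c, fun i => ?_⟩
  · rw [mem_orthogonalGroup_iff] at h1 ⊢
    rw [Matrix.transpose_submatrix, Matrix.submatrix_mul_equiv, h1, Matrix.submatrix_one_equiv]
  · simp only [Matrix.submatrix_apply]
    rw [Equiv.sum_comp f fun j => M (e i) j, hc]

lemma isRegularOrthogonal_one : IsRegularOrthogonal (1 : Matrix ι ι ℝ) :=
  ⟨one_mem _, 1, fun i => by simp [Matrix.one_apply]⟩

lemma isDecomposable_one [Nontrivial ι] : IsDecomposable (1 : Matrix ι ι ℝ) := by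
  obtain ⟨a, b, hab⟩ := exists_pair_ne ι
  refine ⟨{a}, {a}, Finset.singleton_nonempty a, fun h => hab ?_, rfl, fun i j hij => ?_⟩
  · have : b ∈ ({a} : Finset ι) := by rw [h]; exact Finset.mem_univ b
    exact (Finset.mem_singleton.1 this).symm
  · rw [Matrix.one_apply, ne_eq, ite_eq_right_iff, Classical.not_imp] at hij
    rw [hij.1]

lemma prod_map_submatrix (L : List (Matrix ι ι ℝ)) (e : κ ≃ ι) :
    (L.map fun M => M.submatrix e e).prod = L.prod.submatrix e e := by
  induction L with
  | nil => simp
  | cons M L ih => simp [ih, Matrix.submatrix_mul_equiv]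

/-- Reindexing rows and columns by the same `e` transports a factorization. The discrepancy between
`e` and `f` is a permutation matrix, which is decomposable in order at least two and is appended as
a last factor. -/
lemma isReducible_submatrix [Nontrivial κ] {R B : Matrix ι ι ℝ} (h : IsReducible R B)
    (e f : κ ≃ ι) : IsReducible (R.submatrix e f) (B.submatrix e e) := by
  obtain ⟨L, hL, rfl, hA⟩ := h
  have : Nontrivial ι := e.symm.nontrivial
  refine ⟨L.map (fun M => M.submatrix e e) ++ [(1 : Matrix ι ι ℝ).submatrix e f], ?_, ?_, ?_⟩
  · intro S hS
    rw [List.mem_append, List.mem_map, List.mem_singleton] at hS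
    rcases hS with ⟨M, hM, rfl⟩ | rfl
    · exact ⟨isRegularOrthogonal_submatrix (hL M hM).1 e e,
        isDecomposable_submatrix (hL M hM).2 e e⟩
    · exact ⟨isRegularOrthogonal_submatrix isRegularOrthogonal_one e f,
        isDecomposable_submatrix isDecomposable_one e f⟩
  · rw [List.prod_append, prod_map_submatrix, List.prod_singleton, Matrix.submatrix_mul_equiv,
      mul_one]
  · intro d A hadj hB hA' i hi
    rw [List.length_append, List.length_map, List.length_singleton, Nat.lt_succ_iff] at hi
    rw [List.take_append_of_le_length (by rwa [List.length_map]), prod_map_extend, ← List.map_take,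
      prod_map_submatrix]
    let E := e.sumCongr (Equiv.refl (Fin d))
    obtain ⟨A, rfl⟩ : ∃ A' : Matrix (ι ⊕ Fin d) (ι ⊕ Fin d) ℝ, A = A'.submatrix E E :=
      ⟨A.submatrix E.symm E.symm, by simp⟩
    rw [Matrix.isAdjMatrix_submatrix_iff E.surjective] at hadj
    have hB' : A.toBlocks₁₁ = B := by
      ext x y
      have := congrFun (congrFun hB (e.symm x)) (e.symm y)
      simpa [Matrix.toBlocks₁₁, E] using this
    rw [extend_submatrix, conj_submatrix, Matrix.isAdjMatrix_submatrix_iff (Equiv.surjective _)]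
      at hA' ⊢
    rcases hi.lt_or_eq with hi | rfl
    · have := hA d A hadj hB' hA' i hi
      rwa [prod_map_extend] at this
    -- The stage before the extra factor differs from the final stage only by the order of the
    -- vertices.
    · rwa [List.take_length]

lemma isIrreducible_submatrix_iff [Nontrivial κ] {R B : Matrix ι ι ℝ} (e f : κ ≃ ι) :
    IsIrreducible (R.submatrix e f) (B.submatrix e e) ↔ IsIrreducible R B := by
  have : Nontrivial ι := e.symm.nontrivial
  refine and_congr (mem_switchable_submatrix_iff e f) (not_congr ⟨fun h => ?_, fun h =>
    isReducible_submatrix h e f⟩)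
  simpa using isReducible_submatrix h e.symm f.symm

end Transport

/-! The switching operation. -/

section Switching

variable {V : Type*} [DecidableEq V] (c : Fin 6 × Fin 2 ↪ V)

/-- The zero-one matrix of the embedding `c`. -/
def embMatrix : Matrix V (Fin 6 × Fin 2) ℝ := Matrix.of fun v x => if c x = v then 1 else 0

lemma extendAlong_eq : extendAlong c = 1 + embMatrix c * (R12 - 1) * (embMatrix c)ᵀ := by
  unfold extendAlong embMatrix
  congr!

lemma extendAlong_transpose :
    (extendAlong c)ᵀ = 1 + embMatrix c * ((R12ᵀ - 1) * (embMatrix c)ᵀ) := by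
  rw [extendAlong_eq]
  simp [Matrix.transpose_mul, Matrix.mul_assoc]

lemma embMatrix_apply_of_notMem {v : V} (hv : v ∉ Set.range c) (x : Fin 6 × Fin 2) :
    embMatrix c v x = 0 :=
  if_neg fun h => hv ⟨x, h⟩

variable [Fintype V]

lemma embMatrix_transpose_mul_self : (embMatrix c)ᵀ * embMatrix c = 1 := by
  ext x y
  simp [embMatrix, Matrix.mul_apply, Matrix.one_apply, eq_comm]

lemma mul_embMatrix {α : Type*} (M : Matrix α V ℝ) (u : α) (x : Fin 6 × Fin 2) :
    (M * embMatrix c) u x = M u (c x) := by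
  simp [embMatrix, Matrix.mul_apply]

lemma embMatrix_transpose_mul {α : Type*} (M : Matrix V α ℝ) (u : α) (x : Fin 6 × Fin 2) :
    ((embMatrix c)ᵀ * M) x u = M (c x) u := by
  simp [embMatrix, Matrix.mul_apply]

/-- The columns of `embMatrix c` are orthonormal, so `extendAlong c` acts on their span as `R12`.
This intertwining and its mirror image below carry the block computations over to the vertex set
`V`. -/
lemma extendAlong_mul_embMatrix : extendAlong c * embMatrix c = embMatrix c * R12 := by
  rw [extendAlong_eq, Matrix.add_mul, Matrix.mul_assoc (embMatrix c * _),
    embMatrix_transpose_mul_self, Matrix.one_mul, Matrix.mul_one, Matrix.mul_sub, Matrix.mul_one,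
    add_sub_cancel]

lemma embMatrix_transpose_mul_extendAlong :
    (embMatrix c)ᵀ * extendAlong c = R12 * (embMatrix c)ᵀ := by
  rw [extendAlong_eq, Matrix.mul_add, Matrix.mul_assoc (embMatrix c),
    ← Matrix.mul_assoc _ (embMatrix c), embMatrix_transpose_mul_self, Matrix.one_mul,
    Matrix.mul_one, Matrix.sub_mul, Matrix.one_mul, add_sub_cancel]

lemma extendAlong_transpose_mul_self : (extendAlong c)ᵀ * extendAlong c = 1 := by
  have h := (mem_orthogonalGroup_iff' _ _).1 R12_mem_orthogonalGroup
  have e : (R12ᵀ - 1) * (R12 * (embMatrix c)ᵀ) = -((R12 - 1) * (embMatrix c)ᵀ) := by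
    rw [← Matrix.mul_assoc, Matrix.sub_mul, h, Matrix.one_mul, ← Matrix.neg_mul, neg_sub]
  rw [extendAlong_transpose, Matrix.add_mul, Matrix.one_mul, Matrix.mul_assoc, Matrix.mul_assoc,
    embMatrix_transpose_mul_extendAlong, e, extendAlong_eq, Matrix.mul_neg, Matrix.mul_assoc,
    add_neg_cancel_right]

lemma allOnes_mul_R12 {α : Type*} :
    (Matrix.of fun (_ : α) (_ : Fin 6 × Fin 2) => (1 : ℝ)) * R12 = Matrix.of fun _ _ => 1 := by
  ext i j
  have := pairMatrix_row_sum shift⁻¹ j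
  rw [← pairMatrix_transpose, ← R12_eq] at this
  simpa [Matrix.mul_apply] using this

lemma allOnes_mul_extendAlong {α : Type*} :
    (Matrix.of fun (_ : α) (_ : V) => (1 : ℝ)) * extendAlong c = Matrix.of fun _ _ => 1 := by
  have h : (Matrix.of fun (_ : α) (_ : V) => (1 : ℝ)) * embMatrix c = Matrix.of fun _ _ => 1 := by
    ext i x
    rw [mul_embMatrix, Matrix.of_apply, Matrix.of_apply]
  rw [extendAlong_eq, Matrix.mul_add, Matrix.mul_one, ← Matrix.mul_assoc, ← Matrix.mul_assoc, h,
    Matrix.mul_sub, allOnes_mul_R12, Matrix.mul_one, sub_self, Matrix.zero_mul, add_zero]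

lemma extendAlong_transpose_mul_apply {α : Type*} (M : Matrix V α ℝ) {v : V}
    (hv : v ∉ Set.range c) (w : α) : ((extendAlong c)ᵀ * M) v w = M v w := by
  have : (embMatrix c * ((R12ᵀ - 1) * (embMatrix c)ᵀ * M) : Matrix V α ℝ) v w = 0 := by
    rw [Matrix.mul_apply]
    exact Finset.sum_eq_zero fun x _ => by rw [embMatrix_apply_of_notMem c hv, zero_mul]
  rw [extendAlong_transpose, Matrix.add_mul, Matrix.one_mul, Matrix.mul_assoc, Matrix.add_apply,
    this, add_zero]

lemma mul_extendAlong_apply {α : Type*} (M : Matrix α V ℝ) {v : V}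
    (hv : v ∉ Set.range c) (w : α) : (M * extendAlong c) w v = M w v := by
  have := extendAlong_transpose_mul_apply c Mᵀ hv w
  rwa [← Matrix.transpose_mul] at this

variable (A : Matrix V V ℝ)

lemma conj_outside {u v : V} (hu : u ∉ Set.range c) (hv : v ∉ Set.range c) :
    ((extendAlong c)ᵀ * A * extendAlong c) u v = A u v := by
  rw [mul_extendAlong_apply c _ hv, extendAlong_transpose_mul_apply c _ hu]

lemma conj_mixed {v : V} (hv : v ∉ Set.range c) (x : Fin 6 × Fin 2) :
    ((extendAlong c)ᵀ * A * extendAlong c) v (c x) = ∑ y, R12 y x * A v (c y) := by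
  rw [← mul_embMatrix c ((extendAlong c)ᵀ * A * extendAlong c), Matrix.mul_assoc, extendAlong_mul_embMatrix, Matrix.mul_assoc,
    extendAlong_transpose_mul_apply c _ hv, ← Matrix.mul_assoc, Matrix.mul_apply]
  simp only [mul_embMatrix, mul_comm]

lemma conj_inside :
    ((extendAlong c)ᵀ * A * extendAlong c).submatrix c c = R12ᵀ * A.submatrix c c * R12 := by
  have h : ∀ M : Matrix V V ℝ, M.submatrix c c = (embMatrix c)ᵀ * M * embMatrix c := by
    intro M
    ext x y
    rw [mul_embMatrix, embMatrix_transpose_mul, Matrix.submatrix_apply]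
  have h' : (embMatrix c)ᵀ * (extendAlong c)ᵀ = R12ᵀ * (embMatrix c)ᵀ := by
    rw [← Matrix.transpose_mul, extendAlong_mul_embMatrix, Matrix.transpose_mul]
  rw [h, h, Matrix.mul_assoc, Matrix.mul_assoc, extendAlong_mul_embMatrix, Matrix.mul_assoc,
    ← Matrix.mul_assoc, h']
  simp only [Matrix.mul_assoc]

end Switching

/-! ### Switching of graphs as conjugation, and cospectrality. -/

section Graphs

variable {V : Type*}

lemma adj_apply_eq_one_iff (G : SimpleGraph V) (u v : V) : adj G u v = 1 ↔ G.Adj u v := by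
  simp [adj, SimpleGraph.adjMatrix_apply]

lemma adj_zero_or_one (G : SimpleGraph V) (u v : V) : adj G u v = 0 ∨ adj G u v = 1 := by
  by_cases h : G.Adj u v
  · exact Or.inr ((adj_apply_eq_one_iff G u v).2 h)
  · left; simp [adj, SimpleGraph.adjMatrix_apply, h]

lemma adj_isAdjMatrix (G : SimpleGraph V) : (adj G).IsAdjMatrix where
  zero_or_one := adj_zero_or_one G
  symm := by
    ext u v
    by_cases h : G.Adj u v
    · simp [adj, SimpleGraph.adjMatrix_apply, h, h.symm]
    · simpa [adj, SimpleGraph.adjMatrix_apply, h] using fun h' : G.Adj v u => h h'.symm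
  apply_diag u := by simp [adj, SimpleGraph.adjMatrix_apply]

lemma exists_adj_eq {A : Matrix V V ℝ} (hA : A.IsAdjMatrix) : ∃ G : SimpleGraph V, adj G = A := by
  refine ⟨⟨fun u v => A u v = 1, ⟨fun u v h => ?_⟩, ⟨fun u h => ?_⟩⟩, ?_⟩
  · rw [← h]
    exact hA.symm.apply u v
  · rw [hA.apply_diag] at h
    exact zero_ne_one h
  · ext u v
    rcases hA.zero_or_one u v with h | h <;> simp [adj, SimpleGraph.adjMatrix_apply, h]

variable (G : SimpleGraph V) (c : Fin 6 × Fin 2 ↪ V)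

/-- The number of neighbours in a pair. -/
lemma ncard_neighbors (v : V) (i : Fin 6) : ((G.neighborSet v ∩ pair c i).ncard : ℝ) =
    adj G v (c (i, 0)) + adj G v (c (i, 1)) := by
  classical
  have hne : c (i, 0) ≠ c (i, 1) := c.injective.ne (by simp)
  have h : G.neighborSet v ∩ pair c i =
      ((({c (i, 0), c (i, 1)} : Finset V).filter (G.Adj v) : Finset V) : Set V) := by
    ext w
    simp only [pair, Fin.exists_fin_two, Set.mem_inter_iff, SimpleGraph.mem_neighborSet,
      Finset.coe_filter, Finset.mem_insert, Finset.mem_singleton]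
    constructor
    · rintro ⟨h1, h2⟩
      exact ⟨h2.imp Eq.symm Eq.symm, h1⟩
    · rintro ⟨h1, h2⟩
      exact ⟨h2, h1.imp Eq.symm Eq.symm⟩
  rw [h, Set.ncard_coe_finset, Finset.card_filter, Finset.sum_pair hne]
  simp [adj, SimpleGraph.adjMatrix_apply]

variable {G c} {v : V}

/-- In the case of an even number of neighbours in each pair, the two adjacencies agree. -/
lemma adj_eq_of_not_oneInEach (hP : ParityCondition G c) (hv : v ∉ Set.range c)
    (h : ¬ OneInEach G c v) (i : Fin 6) : adj G v (c (i, 0)) = adj G v (c (i, 1)) := by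
  by_contra hne
  refine h fun j => ?_
  have hi : (G.neighborSet v ∩ pair c i).ncard = 1 := by
    have := ncard_neighbors G c v i
    rcases adj_zero_or_one G v (c (i, 0)) with h1 | h1 <;>
      rcases adj_zero_or_one G v (c (i, 1)) with h2 | h2 <;> rw [h1, h2] at this hne
    · exact absurd rfl hne
    · exact_mod_cast this.trans (zero_add _)
    · exact_mod_cast this.trans (add_zero _)
    · exact absurd rfl hne
  have hj := hP v hv j i
  rw [hi] at hj
  have := ncard_neighbors G c v j
  have hle : (G.neighborSet v ∩ pair c j).ncard ≤ 2 := by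
    have h2 : ((G.neighborSet v ∩ pair c j).ncard : ℝ) ≤ 2 := by
      rw [this]
      rcases adj_zero_or_one G v (c (j, 0)) with h1 | h1 <;>
        rcases adj_zero_or_one G v (c (j, 1)) with h2 | h2 <;> rw [h1, h2] <;> norm_num
    exact_mod_cast h2
  generalize (G.neighborSet v ∩ pair c j).ncard = n at hj hle
  interval_cases n
  · exact absurd hj (by decide)
  · rfl
  · exact absurd hj (by decide)

/-- Switching determines the graph. -/
lemma IsSwitched.unique {H H' : SimpleGraph V} (h : IsSwitched G H c) (h' : IsSwitched G H' c) :
    H = H' := by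
  have hmix : ∀ v ∉ Set.range c, ∀ x, (H.Adj v (c x) ↔ H'.Adj v (c x)) := by
    rintro v hv ⟨k, a⟩
    by_cases ho : OneInEach G c v
    · have h1 := h.shift v hv ho (k + 1) a
      have h2 := h'.shift v hv ho (k + 1) a
      rw [add_sub_cancel_right] at h1 h2
      rw [h1, h2]
    · rw [h.keep v hv ho, h'.keep v hv ho]
  ext u v
  by_cases hu : u ∈ Set.range c <;> by_cases hv : v ∈ Set.range c
  · obtain ⟨x, rfl⟩ := hu
    obtain ⟨y, rfl⟩ := hv
    have := congrFun (congrFun (h.inside.trans h'.inside.symm) x) y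
    simp only [inducedAdj, Matrix.submatrix_apply] at this
    rw [← adj_apply_eq_one_iff, this, adj_apply_eq_one_iff]
  · obtain ⟨x, rfl⟩ := hu
    rw [H.adj_comm, H'.adj_comm]
    exact hmix v hv x
  · obtain ⟨y, rfl⟩ := hv
    exact hmix u hu y
  · rw [h.outside u hu v hv, h'.outside u hu v hv]

variable [Fintype V] [DecidableEq V]

/-- The new adjacencies of a vertex with one neighbour in each pair. -/
lemma conj_of_oneInEach (hv : v ∉ Set.range c) (h : OneInEach G c v) (k : Fin 6) (a : Fin 2) :
    ((extendAlong c)ᵀ * adj G * extendAlong c) v (c (k, a)) = adj G v (c (k + 1, a)) := by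
  rw [conj_mixed c _ hv, R12_eq, sum_pairMatrix_mul shift k a fun y => adj G v (c y)]
  have h1 := ncard_neighbors G c v k
  have h2 := ncard_neighbors G c v (k + 1)
  rw [h, Nat.cast_one] at h1 h2
  rw [← h1, Equiv.coe_addRight]
  fin_cases a
  · simp only [Fin.zero_eta, sg_zero]; linarith
  · simp only [Fin.mk_one, sg_one]; linarith

/-- The adjacencies of the other vertices do not change. -/
lemma conj_of_not_oneInEach (hP : ParityCondition G c) (hv : v ∉ Set.range c)
    (h : ¬ OneInEach G c v) (x : Fin 6 × Fin 2) :
    ((extendAlong c)ᵀ * adj G * extendAlong c) v (c x) = adj G v (c x) := by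
  obtain ⟨k, a⟩ := x
  have h0 := adj_eq_of_not_oneInEach hP hv h
  rw [conj_mixed c _ hv, R12_eq, sum_pairMatrix_mul shift k a fun y => adj G v (c y), h0, h0]
  fin_cases a
  · simp [h0]
  · simp

lemma conj_isAdjMatrix (hP : ParityCondition G c) (hB : inducedAdj G c ∈ switchable R12) :
    ((extendAlong c)ᵀ * adj G * extendAlong c).IsAdjMatrix := by
  have hsymm : ((extendAlong c)ᵀ * adj G * extendAlong c).IsSymm := by
    simp only [Matrix.IsSymm, Matrix.transpose_mul, Matrix.transpose_transpose,
      (adj_isAdjMatrix G).symm.eq, Matrix.mul_assoc]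
  have hin : (((extendAlong c)ᵀ * adj G * extendAlong c).submatrix c c).IsAdjMatrix := by
    rw [conj_inside]
    exact hB.2
  have hmix : ∀ v ∉ Set.range c, ∀ x,
      ((extendAlong c)ᵀ * adj G * extendAlong c) v (c x) = 0 ∨
        ((extendAlong c)ᵀ * adj G * extendAlong c) v (c x) = 1 := by
    rintro v hv ⟨k, a⟩
    by_cases h : OneInEach G c v
    · rw [conj_of_oneInEach hv h]
      exact adj_zero_or_one _ _ _
    · rw [conj_of_not_oneInEach hP hv h]
      exact adj_zero_or_one _ _ _
  refine ⟨fun u v => ?_, hsymm, fun u => ?_⟩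
  · by_cases hu : u ∈ Set.range c <;> by_cases hv : v ∈ Set.range c
    · obtain ⟨x, rfl⟩ := hu
      obtain ⟨y, rfl⟩ := hv
      exact hin.zero_or_one x y
    · obtain ⟨x, rfl⟩ := hu
      rw [← hsymm.apply]
      exact hmix v hv x
    · obtain ⟨y, rfl⟩ := hv
      exact hmix u hu y
    · rw [conj_outside c _ hu hv]
      exact adj_zero_or_one _ _ _
  · by_cases hu : u ∈ Set.range c
    · obtain ⟨x, rfl⟩ := hu
      exact hin.apply_diag x
    · rw [conj_outside c _ hu hu]
      exact (adj_isAdjMatrix G).apply_diag u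

/-- The switching operation is the conjugation with `diag(R₁₂, I)`. -/
theorem exists_isSwitched (hP : ParityCondition G c) (hB : inducedAdj G c ∈ switchable R12) :
    ∃ G' : SimpleGraph V, IsSwitched G G' c ∧
      adj G' = (extendAlong c)ᵀ * adj G * extendAlong c := by
  obtain ⟨G', hG'⟩ := exists_adj_eq (conj_isAdjMatrix hP hB)
  refine ⟨G', ⟨fun u hu v hv => ?_, fun v hv ho i a => ?_, fun v hv ho x => ?_, ?_⟩, hG'⟩
  · rw [← adj_apply_eq_one_iff, hG', conj_outside c _ hu hv, adj_apply_eq_one_iff]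
  · rw [← adj_apply_eq_one_iff, hG', conj_of_oneInEach hv ho, sub_add_cancel,
      adj_apply_eq_one_iff]
  · rw [← adj_apply_eq_one_iff, hG', conj_of_not_oneInEach hP hv ho, adj_apply_eq_one_iff]
  · rw [inducedAdj, hG', conj_inside, inducedAdj]

/-- The orthogonal matrix `extendAlong c` has all row and column sums one, so conjugation by it
fixes the all-ones matrix and makes `A + rJ` similar to `A' + rJ`. -/
lemma rCospectral_of_adj_eq {G' : SimpleGraph V}
    (h : adj G' = (extendAlong c)ᵀ * adj G * extendAlong c) : RCospectral G G' := by
  intro r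
  have hJ : (extendAlong c)ᵀ * Matrix.of (fun _ _ => (1 : ℝ)) * extendAlong c =
      Matrix.of fun _ _ => 1 := by
    rw [Matrix.mul_assoc, allOnes_mul_extendAlong, ← Matrix.transpose_transpose (_ * _),
      Matrix.transpose_mul, Matrix.transpose_transpose]
    exact congrArg Matrix.transpose (allOnes_mul_extendAlong c)
  have e : adj G' + r • Matrix.of (fun _ _ => (1 : ℝ)) =
      (extendAlong c)ᵀ * ((adj G + r • Matrix.of fun _ _ => 1) * extendAlong c) := by
    rw [Matrix.add_mul, Matrix.mul_add, ← Matrix.mul_assoc, ← h, Matrix.smul_mul, Matrix.mul_smul,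
      ← Matrix.mul_assoc, hJ]
  rw [e, Matrix.charpoly_mul_comm, Matrix.mul_assoc,
    mul_eq_one_comm.1 (extendAlong_transpose_mul_self c), Matrix.mul_one]

end Graphs

/-! Families of four-element subsets of a set of twelve elements with even intersections. -/

section Quadruples

/-- The indicator function of a set modulo two. -/
def bit (s : Finset (Fin 12)) (j : Fin 12) : ZMod 2 := if j ∈ s then 1 else 0

lemma bit_eq_one_iff {s : Finset (Fin 12)} {j : Fin 12} : bit s j = 1 ↔ j ∈ s := by
  simp [bit]

lemma sum_bit_mul (s t : Finset (Fin 12)) :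
    ∑ j, bit s j * bit t j = ((s ∩ t).card : ZMod 2) := by
  have h : ∀ j, bit s j * bit t j = if j ∈ s ∩ t then 1 else 0 := by
    intro j
    by_cases h1 : j ∈ s <;> by_cases h2 : j ∈ t <;> simp [bit, h1, h2]
  simp only [h, Finset.sum_ite_mem, Finset.univ_inter, Finset.sum_const, nsmul_eq_mul, mul_one]

lemma exists_fourth {s : Finset (Fin 12)} (hs : s.card = 4) {u v w : Fin 12} (hu : u ∈ s)
    (hv : v ∈ s) (hw : w ∈ s) (huv : u ≠ v) (huw : u ≠ w) (hvw : v ≠ w) :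
    ∃ z, z ≠ u ∧ z ≠ v ∧ z ≠ w ∧ s = {u, v, w, z} := by
  have h3 : ({u, v, w} : Finset (Fin 12)).card = 3 := Finset.card_eq_three.2 ⟨u, v, w, huv, huw, hvw, rfl⟩
  have hsub : ({u, v, w} : Finset (Fin 12)) ⊆ s := by
    simp [Finset.insert_subset_iff, hu, hv, hw]
  have h1 : (s \ {u, v, w}).card = 1 := by
    rw [Finset.card_sdiff_of_subset hsub, hs, h3]
  obtain ⟨z, hz⟩ := Finset.card_eq_one.1 h1
  have hz' : z ∈ s \ {u, v, w} := by rw [hz]; simp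
  simp only [Finset.mem_sdiff, Finset.mem_insert, Finset.mem_singleton, not_or] at hz'
  refine ⟨z, hz'.2.1, hz'.2.2.1, hz'.2.2.2, ?_⟩
  rw [← Finset.union_sdiff_of_subset hsub, hz]
  ext j
  simp

/-- The number of ones among some bits. -/
def weight {n : ℕ} (x : Fin n → ZMod 2) : ℕ := ∑ k, (x k).val

lemma weight_bit {n : ℕ} (s : Finset (Fin 12)) {h : Fin n → Fin 12} (hh : Function.Injective h) :
    weight (fun k => bit s (h k)) = (s ∩ Finset.univ.image h).card := by
  have e : s ∩ Finset.univ.image h = (Finset.univ.filter fun k => h k ∈ s).image h := by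
    ext j
    simp only [Finset.mem_inter, Finset.mem_image, Finset.mem_univ, true_and, Finset.mem_filter]
    constructor
    · rintro ⟨h1, k, rfl⟩
      exact ⟨k, h1, rfl⟩
    · rintro ⟨k, h1, rfl⟩
      exact ⟨h1, k, rfl⟩
  rw [e, Finset.card_image_of_injective _ hh, Finset.card_filter]
  refine Finset.sum_congr rfl fun k _ => ?_
  simp only [bit]
  split_ifs <;> rfl

/-- The word of length seven with the given parameters. -/
def fanoWord (p q r e : ZMod 2) : Fin 7 → ZMod 2 := ![p, q, r, p + e, q + e, r + e, p + q + r]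

/-- These words form the Hamming code of length seven, whose nonzero weights are 3, 4 and 7. -/
lemma weight_fanoWord : ∀ p q r e : ZMod 2, 0 < weight (fanoWord p q r e) →
    weight (fanoWord p q r e) < 4 → weight (fanoWord p q r e) = 3 := by
  decide +kernel

/-- Adding as a new bit the inner product with a fixed word of weight 3 gives a code of length eight
with minimum weight 4, like the extended Hamming code. -/
lemma weight_fanoWord_cons : ∀ p q r e p' q' r' e' : ZMod 2, weight (fanoWord p q r e) = 3 →
    0 < weight (Fin.cons (∑ k, fanoWord p q r e k * fanoWord p' q' r' e' k)
      (fanoWord p' q' r' e') : Fin 8 → ZMod 2) →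
    4 ≤ weight (Fin.cons (∑ k, fanoWord p q r e k * fanoWord p' q' r' e' k)
      (fanoWord p' q' r' e') : Fin 8 → ZMod 2) := by
  decide +kernel

variable {ι : Type*} {s : ι → Finset (Fin 12)}

/-- The family `s` consists of sets of size four with even intersections, and it is connected. -/
structure IsTetradSystem (s : ι → Finset (Fin 12)) : Prop where
  card : ∀ i, (s i).card = 4
  even : ∀ i t, ∑ j, bit (s i) j * bit (s t) j = 0
  connected : ∀ U : Finset (Fin 12), U.Nonempty → U ≠ Finset.univ →
    ∃ i, (∃ j ∈ U, j ∈ s i) ∧ ∃ j ∉ U, j ∈ s i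

namespace IsTetradSystem

lemma exists_crossing (hs : IsTetradSystem s) {α : Type*} [Fintype α] [Nonempty α]
    (hα : Fintype.card α < 12) (h : α → Fin 12) :
    ∃ i, (∃ k, h k ∈ s i) ∧ ∃ x, (∀ k, h k ≠ x) ∧ x ∈ s i := by
  obtain ⟨i, ⟨j, h1, h2⟩, x, h3, h4⟩ := hs.connected (Finset.univ.image h)
    (Finset.univ_nonempty.image h) (fun e => by
      have := Finset.card_image_le (s := Finset.univ) (f := h)
      rw [e, Finset.card_univ, Finset.card_univ, Fintype.card_fin] at this
      omega)
  obtain ⟨k, -, rfl⟩ := Finset.mem_image.1 h1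
  exact ⟨i, ⟨k, h2⟩, x, fun k hk => h3 (Finset.mem_image.2 ⟨k, Finset.mem_univ k, hk⟩), h4⟩

lemma weight_crossing (hs : IsTetradSystem s) {n : ℕ} {h : Fin n → Fin 12}
    (hh : Function.Injective h) {i : ι} {k : Fin n} (hk : h k ∈ s i) {x : Fin 12}
    (hx : ∀ k, h k ≠ x) (hxi : x ∈ s i) :
    0 < weight (fun k => bit (s i) (h k)) ∧ weight (fun k => bit (s i) (h k)) < 4 := by
  rw [weight_bit _ hh]
  constructor
  · exact Finset.card_pos.2 ⟨h k, by simp [hk]⟩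
  · rw [← hs.card i]
    refine Finset.card_lt_card ⟨Finset.inter_subset_left, fun hsub => ?_⟩
    have := hsub hxi
    simp only [Finset.mem_inter, Finset.mem_image, Finset.mem_univ, true_and] at this
    obtain ⟨-, k, hk⟩ := this
    exact hx k hk

lemma sum_bit_eq_zero (hs : IsTetradSystem s) {n : ℕ} {h : Fin n → Fin 12}
    (hh : Function.Injective h) {t : ι} (ht : ∀ j ∈ s t, ∃ k, h k = j) (i : ι) :
    ∑ k, bit (s t) (h k) * bit (s i) (h k) = 0 := by
  rw [← hs.even t i, ← Finset.sum_image (s := Finset.univ) (g := h)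
    (f := fun j => bit (s t) j * bit (s i) j) fun _ _ _ _ e => hh e]
  refine Finset.sum_subset (Finset.subset_univ _) fun j _ hj => ?_
  have : j ∉ s t := fun hjt => by
    obtain ⟨k, rfl⟩ := ht j hjt
    exact hj (by simp)
  rw [bit, if_neg this, zero_mul]

lemma sum_four (hs : IsTetradSystem s) {t : ι} {u v w z : Fin 12} (huv : u ≠ v) (huw : u ≠ w)
    (hvw : v ≠ w) (hzu : z ≠ u) (hzv : z ≠ v) (hzw : z ≠ w) (ht : s t = {u, v, w, z}) (i : ι) :
    bit (s i) u + bit (s i) v + bit (s i) w + bit (s i) z = 0 := by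
  have hh : Function.Injective ![u, v, w, z] := by
    intro a b hab
    fin_cases a <;> fin_cases b <;> simp_all [eq_comm]
  have := hs.sum_bit_eq_zero hh (t := t) (fun j hj => by
    rw [ht] at hj
    simp only [Finset.mem_insert, Finset.mem_singleton] at hj
    rcases hj with rfl | rfl | rfl | rfl
    exacts [⟨0, rfl⟩, ⟨1, rfl⟩, ⟨2, rfl⟩, ⟨3, rfl⟩]) i
  simpa [Fin.sum_univ_four, bit, ht] using this

/-- The code of length seven is excluded. -/
lemma false_of_fano (hs : IsTetradSystem s) {h : Fin 7 → Fin 12} (hh : Function.Injective h)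
    (hw : ∀ i, ∃ p q r e, (fun k => bit (s i) (h k)) = fanoWord p q r e) : False := by
  obtain ⟨t, ⟨k, hk⟩, y, hy, hyt⟩ := hs.exists_crossing (by simp) h
  have hwt := hs.weight_crossing hh hk hy hyt
  obtain ⟨p, q, r, e, ht⟩ := hw t
  rw [ht] at hwt
  have hwt := weight_fanoWord p q r e hwt.1 hwt.2
  have hh' : Function.Injective (Fin.cons y h : Fin 8 → Fin 12) :=
    Fin.cons_injective_iff.2 ⟨fun ⟨k, hk⟩ => hy k hk, hh⟩
  have hcons : ∀ i, (fun k => bit (s i) ((Fin.cons y h : Fin 8 → Fin 12) k)) =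
      (Fin.cons (bit (s i) y) fun k => bit (s i) (h k) : Fin 8 → ZMod 2) := by
    intro i
    funext k
    refine Fin.cases ?_ (fun k => ?_) k <;> simp
  -- The crossing set `s t` has three of the seven points and `y`, hence lies in the eight points.
  -- Even intersection with it then determines the bit at `y` of every other member.
  have hsub : ∀ j ∈ s t, ∃ k, (Fin.cons y h : Fin 8 → Fin 12) k = j := by
    have h4 : weight (fun k => bit (s t) ((Fin.cons y h : Fin 8 → Fin 12) k)) = 4 := by
      rw [hcons, ht, weight, Fin.sum_univ_succ]
      simp only [Fin.cons_zero, Fin.cons_succ]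
      rw [bit_eq_one_iff.2 hyt]
      rw [weight] at hwt
      rw [hwt]
      rfl
    rw [weight_bit _ hh'] at h4
    intro j hj
    have := Finset.eq_of_subset_of_card_le (Finset.inter_subset_left (s₁ := s t)
      (s₂ := Finset.univ.image (Fin.cons y h : Fin 8 → Fin 12))) (by rw [h4, hs.card])
    rw [← this] at hj
    simpa using (Finset.mem_inter.1 hj).2
  obtain ⟨i, ⟨k', hk'⟩, x, hx, hxi⟩ := hs.exists_crossing (by simp) (Fin.cons y h : Fin 8 → Fin 12)
  have hwi := hs.weight_crossing hh' hk' hx hxi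
  obtain ⟨p', q', r', e', hi⟩ := hw i
  have hsum := hs.sum_bit_eq_zero hh' hsub i
  rw [Fin.sum_univ_succ] at hsum
  simp only [Fin.cons_zero, Fin.cons_succ, bit_eq_one_iff.2 hyt, one_mul] at hsum
  have hyi : bit (s i) y = ∑ k, fanoWord p q r e k * fanoWord p' q' r' e' k := by
    have h2 : ∀ a b : ZMod 2, a + b = 0 → a = b := by decide
    rw [h2 _ _ hsum]
    refine Finset.sum_congr rfl fun k _ => ?_
    rw [← congrFun ht k, ← congrFun hi k]
  rw [hcons, hi, hyi] at hwi
  -- No member meets the eight points in one, two or three elements, so these would be disconnected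
  -- from the other four.
  exact absurd (weight_fanoWord_cons p q r e p' q' r' e' hwt hwi.1) (not_le.2 hwi.2)

lemma sum_bit_self (hs : IsTetradSystem s) (t i : ι) : ∑ j ∈ s t, bit (s i) j = 0 := by
  rw [← hs.even t i, sum_bit_mul]
  simp [bit]

end IsTetradSystem

/-- Disjoint pairs with the property that each member of the family meets all of them in the same
number of elements modulo two. -/
def IsPaired (s : ι → Finset (Fin 12)) {n : ℕ} (g : Fin n → Fin 2 → Fin 12) : Prop :=
  (Function.Injective fun x : Fin n × Fin 2 => g x.1 x.2) ∧
    ∀ i k l, bit (s i) (g k 0) + bit (s i) (g k 1) = bit (s i) (g l 0) + bit (s i) (g l 1)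

namespace IsPaired

variable {n : ℕ} {g : Fin n → Fin 2 → Fin 12}

lemma ne (hg : IsPaired s g) {k l : Fin n} {c d : Fin 2} (h : k ≠ l ∨ c ≠ d) : g k c ≠ g l d := by
  intro e
  have := @hg.1 (k, c) (l, d) e
  simp only [Prod.mk.injEq] at this
  tauto

lemma cons (hg : IsPaired s g) {x y : Fin 12} (hxy : x ≠ y) (hx : ∀ k c, g k c ≠ x)
    (hy : ∀ k c, g k c ≠ y) (k : Fin n)
    (h : ∀ i, bit (s i) x + bit (s i) y = bit (s i) (g k 0) + bit (s i) (g k 1)) :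
    IsPaired s (Fin.cons ![x, y] g : Fin (n + 1) → Fin 2 → Fin 12) := by
  have hp : ∀ i l, bit (s i) ((Fin.cons ![x, y] g : Fin (n + 1) → Fin 2 → Fin 12) l 0) +
      bit (s i) ((Fin.cons ![x, y] g : Fin (n + 1) → Fin 2 → Fin 12) l 1) =
      bit (s i) (g k 0) + bit (s i) (g k 1) := by
    intro i l
    refine Fin.cases ?_ (fun l => ?_) l
    · simpa using h i
    · simpa using hg.2 i l k
  refine ⟨?_, fun i l l' => (hp i l).trans (hp i l').symm⟩
  have hc : ∀ c, ![x, y] c = x ∨ ![x, y] c = y := by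
    intro c
    fin_cases c <;> simp
  rintro ⟨l, c⟩ ⟨l', c'⟩ e
  refine Fin.cases (fun e => ?_) (fun l e => ?_) l e <;>
    refine Fin.cases (fun e => ?_) (fun l' e => ?_) l' e <;>
    simp only [Fin.cons_zero, Fin.cons_succ] at e
  · have : c = c' := by
      fin_cases c <;> fin_cases c'
      exacts [rfl, absurd e hxy, absurd e.symm hxy, rfl]
    rw [this]
  · rcases hc c with h1 | h1 <;> rw [h1] at e
    exacts [absurd e.symm (hx _ _), absurd e.symm (hy _ _)]
  · rcases hc c' with h1 | h1 <;> rw [h1] at e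
    exacts [absurd e (hx _ _), absurd e (hy _ _)]
  · have := @hg.1 (l, c) (l', c') e
    simp_all

lemma mem_iff_of_even (hg : IsPaired s g) {t : ι} {k : Fin n}
    (h : bit (s t) (g k 0) + bit (s t) (g k 1) = 0) (l : Fin n) : g l 0 ∈ s t ↔ g l 1 ∈ s t := by
  rw [hg.2 t k l] at h
  by_cases h0 : g l 0 ∈ s t <;> by_cases h1 : g l 1 ∈ s t <;> simp_all [bit]

lemma exists_mem_of_odd (hg : IsPaired s g) {t : ι} {k : Fin n}
    (h : bit (s t) (g k 0) + bit (s t) (g k 1) ≠ 0) (l : Fin n) : ∃ c, g l c ∈ s t := by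
  rw [hg.2 t k l] at h
  by_contra hne
  push Not at hne
  simp [bit, hne] at h

/-- Take a member that crosses the boundary of the union of the pairs. If it meets the pairs evenly,
it consists of one pair and two outside points, which form the new pair. If it meets them oddly, it
has a point in each pair and one outside, so `n = 3`, and the six points with the outside one carry
the Hamming code that `false_of_fano` excludes. -/
lemma exists_cons (hs : IsTetradSystem s) (hg : IsPaired s g) (h3 : 3 ≤ n) (h6 : n < 6) :
    ∃ g' : Fin (n + 1) → Fin 2 → Fin 12, IsPaired s g' := by
  have : Nonempty (Fin n) := ⟨⟨0, by omega⟩⟩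
  obtain ⟨t, ⟨⟨k, c⟩, hk⟩, x, hx, hxt⟩ := hs.exists_crossing
    (by simp only [Fintype.card_prod, Fintype.card_fin]; omega)
    (fun x : Fin n × Fin 2 => g x.1 x.2)
  have hx : ∀ k c, g k c ≠ x := fun k c => hx (k, c)
  simp only at hk
  by_cases hpar : bit (s t) (g k 0) + bit (s t) (g k 1) = 0
  · have hmem := hg.mem_iff_of_even hpar
    have hk0 : g k 0 ∈ s t := by
      fin_cases c
      exacts [hk, (hmem k).2 hk]
    have hk1 := (hmem k).1 hk0
    have h01 : g k 0 ≠ g k 1 := hg.ne (Or.inr (by decide))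
    obtain ⟨y, hy0, hy1, hyx, hst⟩ := exists_fourth (hs.card t) hk0 hk1 hxt h01 (hx k 0) (hx k 1)
    refine ⟨_, hg.cons hyx.symm hx (fun l d e => ?_) k fun i => ?_⟩
    · have hlk : l ≠ k := by
        rintro rfl
        fin_cases d
        exacts [hy0 e.symm, hy1 e.symm]
      have hy : y ∈ s t := by rw [hst]; simp
      rw [← e] at hy
      have hall : ∀ d, g l d ∈ s t := by
        intro d'
        fin_cases d <;> fin_cases d'
        exacts [hy, (hmem l).1 hy, (hmem l).2 hy, hy]
      -- If the fourth point lay in an old pair, its partner would be a fifth element of the member.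
      have := hall (d + 1)
      rw [hst, ← e] at this
      have hd : d + 1 ≠ d := by fin_cases d <;> decide
      simp only [Finset.mem_insert, Finset.mem_singleton] at this
      rcases this with h | h | h | h
      exacts [hg.ne (Or.inl hlk) h, hg.ne (Or.inl hlk) h, hx _ _ h, hg.ne (Or.inr hd) h]
    · have := hs.sum_four h01 (hx k 0) (hx k 1) hy0 hy1 hyx hst i
      have key : ∀ a b c d : ZMod 2, a + b + c + d = 0 → c + d = a + b := by decide
      exact key _ _ _ _ this
  · choose c hc using hg.exists_mem_of_odd hpar
    have hinj : Function.Injective (Fin.cons x fun l => g l (c l) : Fin (n + 1) → Fin 12) := by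
      refine Fin.cons_injective_iff.2 ⟨fun ⟨l, hl⟩ => hx _ _ hl, fun l l' e => ?_⟩
      by_contra hne
      exact hg.ne (Or.inl hne) e
    have hcard := Finset.card_le_card (s := Finset.univ.image
      (Fin.cons x fun l => g l (c l) : Fin (n + 1) → Fin 12)) (t := s t) (by
        intro j hj
        obtain ⟨l, -, rfl⟩ := Finset.mem_image.1 hj
        exact Fin.cases hxt (fun l => hc l) l)
    rw [Finset.card_image_of_injective _ hinj, Finset.card_univ, Fintype.card_fin, hs.card] at hcard
    obtain rfl : n = 3 := by omega
    exfalso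
    have hne : ∀ {k l : Fin 3} (d d'), k ≠ l → g k d ≠ g l d' := fun d d' h => hg.ne (Or.inl h)
    obtain ⟨z, hz0, hz1, hz2, hst⟩ := exists_fourth (hs.card t) (hc 0) (hc 1) (hc 2)
      (hne _ _ (by decide)) (hne _ _ (by decide)) (hne _ _ (by decide))
    have hzx : x = z := by
      rw [hst] at hxt
      simp only [Finset.mem_insert, Finset.mem_singleton] at hxt
      rcases hxt with h | h | h | h
      exacts [absurd h.symm (hx _ _), absurd h.symm (hx _ _), absurd h.symm (hx _ _), h]
    subst hzx
    refine hs.false_of_fano (h := Fin.snoc (fun k : Fin 6 => (g (finProdFinEquiv.symm k : Fin 2 × Fin 3).2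
      (c (finProdFinEquiv.symm k : Fin 2 × Fin 3).2 +
        (finProdFinEquiv.symm k : Fin 2 × Fin 3).1))) x) ?_ fun i => ?_
    · refine Fin.snoc_injective_iff.2 ⟨fun k l e => ?_, fun ⟨k, hk⟩ => hx _ _ hk⟩
      have := @hg.1 (_, _) (_, _) e
      simp only [Prod.mk.injEq] at this
      obtain ⟨h1, h2⟩ := this
      rw [show (finProdFinEquiv.symm k : Fin 2 × Fin 3).2 = _ from h1] at h2
      exact finProdFinEquiv.symm.injective (Prod.ext (add_left_cancel h2) h1)
    · refine ⟨bit (s i) (g 0 (c 0)), bit (s i) (g 1 (c 1)), bit (s i) (g 2 (c 2)),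
        bit (s i) (g 0 0) + bit (s i) (g 0 1), ?_⟩
      have hq : ∀ l, bit (s i) (g l (c l + 1)) =
          bit (s i) (g l (c l)) + (bit (s i) (g 0 0) + bit (s i) (g 0 1)) := by
        intro l
        rw [hg.2 i 0 l]
        have key : ∀ a b : ZMod 2, b = a + (a + b) ∧ a = b + (a + b) := by decide
        generalize c l = d
        fin_cases d
        exacts [(key _ _).1, (key _ _).2]
      have h4 := hs.sum_four (hne _ _ (by decide)) (hne _ _ (by decide)) (hne _ _ (by decide))
        hz0 hz1 hz2 hst i
      have hx' : bit (s i) x = bit (s i) (g 0 (c 0)) + bit (s i) (g 1 (c 1)) +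
          bit (s i) (g 2 (c 2)) := by
        have key : ∀ a b : ZMod 2, a + b = 0 → b = a := by decide
        exact key _ _ h4
      funext k
      fin_cases k
      · exact congrArg (fun d => bit (s i) (g 0 d)) (add_zero _)
      · exact congrArg (fun d => bit (s i) (g 1 d)) (add_zero _)
      · exact congrArg (fun d => bit (s i) (g 2 d)) (add_zero _)
      · exact hq 0
      · exact hq 1
      · exact hq 2
      · exact hx'

end IsPaired

namespace IsTetradSystem

/-- Two members that meet without being equal have exactly two elements in common. The intersection
and the two differences are the pairs, and evenness against the two members compares their parities.
-/
lemma exists_isPaired_three (hs : IsTetradSystem s) [Nonempty ι] :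
    ∃ g : Fin 3 → Fin 2 → Fin 12, IsPaired s g := by
  obtain ⟨r⟩ := ‹Nonempty ι›
  obtain ⟨t, ⟨j, hjr, hjt⟩, j', hjr', hjt'⟩ := hs.connected (s r)
    (Finset.card_pos.1 (by rw [hs.card]; norm_num)) fun e => by
      have := hs.card r
      rw [e, Finset.card_univ, Fintype.card_fin] at this
      norm_num at this
  have hpos : 0 < (s r ∩ s t).card := Finset.card_pos.2 ⟨j, by simp [hjr, hjt]⟩
  have h1 := Finset.card_inter_add_card_sdiff (s r) (s t)
  have h2 := Finset.card_inter_add_card_sdiff (s t) (s r)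
  have hpos' : 0 < (s t \ s r).card := Finset.card_pos.2 ⟨j', by simp [hjr', hjt']⟩
  rw [Finset.inter_comm, hs.card] at h2
  rw [hs.card] at h1
  have heven := hs.even r t
  rw [sum_bit_mul, ZMod.natCast_eq_zero_iff] at heven
  obtain ⟨a, b, hab, hA⟩ := Finset.card_eq_two.1 (show (s r \ s t).card = 2 by omega)
  obtain ⟨c, d, hcd, hC⟩ := Finset.card_eq_two.1 (show (s r ∩ s t).card = 2 by omega)
  obtain ⟨e, f, hef, hE⟩ := Finset.card_eq_two.1 (show (s t \ s r).card = 2 by omega)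
  have hac : ∀ i, bit (s i) a + bit (s i) b = bit (s i) c + bit (s i) d := by
    intro i
    have := Finset.sum_inter_add_sum_sdiff (s r) (s t) (bit (s i))
    rw [hs.sum_bit_self, hA, hC, Finset.sum_pair hab, Finset.sum_pair hcd] at this
    have key : ∀ x y : ZMod 2, x + y = 0 → y = x := by decide
    exact key _ _ this
  have hec : ∀ i, bit (s i) e + bit (s i) f = bit (s i) c + bit (s i) d := by
    intro i
    have := Finset.sum_inter_add_sum_sdiff (s t) (s r) (bit (s i))
    rw [hs.sum_bit_self, hE, Finset.inter_comm, hC, Finset.sum_pair hef,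
      Finset.sum_pair hcd] at this
    have key : ∀ x y : ZMod 2, x + y = 0 → y = x := by decide
    exact key _ _ this
  have mA : ∀ x, (x = a ∨ x = b) ↔ x ∈ s r ∧ x ∉ s t := fun x => by
    rw [← Finset.mem_sdiff, hA]; simp
  have mC : ∀ x, (x = c ∨ x = d) ↔ x ∈ s r ∧ x ∈ s t := fun x => by
    rw [← Finset.mem_inter, hC]; simp
  have mE : ∀ x, (x = e ∨ x = f) ↔ x ∈ s t ∧ x ∉ s r := fun x => by
    rw [← Finset.mem_sdiff, hE]; simp
  have ha := (mA a).1 (Or.inl rfl)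
  have hb := (mA b).1 (Or.inr rfl)
  have hc := (mC c).1 (Or.inl rfl)
  have hd := (mC d).1 (Or.inr rfl)
  have he := (mE e).1 (Or.inl rfl)
  have hf := (mE f).1 (Or.inr rfl)
  clear mA mC mE
  refine ⟨![![a, b], ![c, d], ![e, f]], ?_, fun i => ?_⟩
  · rintro ⟨k, x⟩ ⟨l, y⟩ h
    have : ∀ (k : Fin 3) (x : Fin 2),
        (((![![a, b], ![c, d], ![e, f]] : Fin 3 → Fin 2 → Fin 12) k x ∈ s r) ↔ k ≠ 2) ∧
        (((![![a, b], ![c, d], ![e, f]] : Fin 3 → Fin 2 → Fin 12) k x ∈ s t) ↔ k ≠ 0) := by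
      intro k x
      fin_cases k <;> fin_cases x <;> simp [ha, hb, hc, hd, he, hf]
    have hk := this k x
    have hl := this l y
    simp only at h
    rw [h] at hk
    have hkl : k = l := by
      have h1 := hk.1.symm.trans hl.1
      have h2 := hk.2.symm.trans hl.2
      clear hk hl this h
      revert k l
      decide
    subst hkl
    clear hk hl this
    fin_cases k <;> fin_cases x <;> fin_cases y <;> simp_all [eq_comm]
  · have : ∀ k, bit (s i) ((![![a, b], ![c, d], ![e, f]] : Fin 3 → Fin 2 → Fin 12) k 0) +
        bit (s i) ((![![a, b], ![c, d], ![e, f]] : Fin 3 → Fin 2 → Fin 12) k 1) =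
        bit (s i) c + bit (s i) d := by
      intro k
      fin_cases k
      exacts [hac i, rfl, hec i]
    intro k l
    rw [this, this]

/-- The twelve elements are the disjoint union of six pairs such that every member of the family
is a union of pairs. -/
theorem exists_pairing (hs : IsTetradSystem s) [Nonempty ι] :
    ∃ g : Fin 6 × Fin 2 ≃ Fin 12, ∀ i k, g (k, 0) ∈ s i ↔ g (k, 1) ∈ s i := by
  obtain ⟨g₃, h₃⟩ := hs.exists_isPaired_three
  obtain ⟨g₄, h₄⟩ := h₃.exists_cons hs (by norm_num) (by norm_num)
  obtain ⟨g₅, h₅⟩ := h₄.exists_cons hs (by norm_num) (by norm_num)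
  obtain ⟨g, hg⟩ := h₅.exists_cons hs (by norm_num) (by norm_num)
  refine ⟨Equiv.ofBijective _ ((Fintype.bijective_iff_injective_and_card _).2 ⟨hg.1, by simp⟩),
    fun i k => hg.mem_iff_of_even (k := 0) ?_ k⟩
  by_contra hodd
  -- A member meeting all six pairs oddly would have at least six elements instead of four.
  choose c hc using hg.exists_mem_of_odd hodd
  have hcard := Finset.card_le_card (s := Finset.univ.image fun l => g l (c l)) (t := s i) (by
    intro j hj
    obtain ⟨l, -, rfl⟩ := Finset.mem_image.1 hj
    exact hc l)
  rw [Finset.card_image_of_injective _ fun l l' e => by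
    by_contra hne
    exact hg.ne (Or.inl hne) e, Finset.card_univ, Fintype.card_fin, hs.card] at hcard
  norm_num at hcard

end IsTetradSystem

end Quadruples

/-! ### Indecomposable matrices of order twelve and level two. -/

/-- Without a proper invariant set the permutation is a single six-cycle, and all six-cycles are
conjugate. -/
lemma exists_conj_shift {σ : Equiv.Perm (Fin 6)}
    (h : ∀ s : Finset (Fin 6), s.Nonempty → (∀ i, σ i ∈ s ↔ i ∈ s) → s = Finset.univ) :
    ∃ c : Equiv.Perm (Fin 6), ∀ i, c (σ i) = c i + 1 := by
  have hfix : ∀ i, σ i ≠ i := by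
    intro i hi
    have := h {i} (Finset.singleton_nonempty i) fun j => by
      rw [Finset.mem_singleton, Finset.mem_singleton]
      nth_rewrite 1 [← hi]
      exact σ.injective.eq_iff
    have h2 : i + 1 ∈ ({i} : Finset (Fin 6)) := by rw [this]; exact Finset.mem_univ _
    simp at h2
  have hsame : ∀ y, σ.SameCycle 0 y := by
    classical
    intro y
    have := h (Finset.univ.filter fun y => σ.SameCycle 0 y) ⟨0, by simp [Equiv.Perm.SameCycle.refl]⟩ fun i => by simp
    have hy : y ∈ Finset.univ.filter fun y => σ.SameCycle 0 y := by rw [this]; exact Finset.mem_univ _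
    simpa using hy
  have hc : σ.IsCycle := ⟨0, hfix 0, fun y _ => hsame y⟩
  have hcard : σ.support.card = (finRotate 6).support.card := by
    rw [support_finRotate]
    congr 1
    ext i
    simp [hfix]
  obtain ⟨c, hc⟩ := isConj_iff.1 (hc.isConj isCycle_finRotate hcard)
  refine ⟨c, fun i => ?_⟩
  have := Equiv.congr_fun hc (c i)
  simpa using this

/-- A matrix of a permutation that does not preserve a proper set of pairs is `R₁₂`, up to
simultaneous permutations of the rows and columns. -/
lemma exists_pairMatrix_eq {σ : Equiv.Perm (Fin 6)} (h : ¬ IsDecomposable (pairMatrix σ)) :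
    ∃ e : Equiv.Perm (Fin 6 × Fin 2), pairMatrix σ = R12.submatrix e e := by
  obtain ⟨c, hc⟩ := exists_conj_shift (σ := σ) fun s hs hinv => by
    by_contra hne
    exact h (pairMatrix_decomposable hs hne hinv)
  refine ⟨c.prodCongr (Equiv.refl _), ?_⟩
  ext x y
  simp [R12_eq, pairMatrix, ← hc]

section LevelTwo

variable {R : Matrix (Fin 12) (Fin 12) ℝ} {z : Fin 12 → Fin 12 → ℤ}

lemma sum_int_row (hR : R ∈ orthogonalGroup (Fin 12) ℝ) (hz : ∀ i j, 2 * R i j = z i j)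
    (i i' : Fin 12) : ∑ j, z i j * z i' j = if i = i' then 4 else 0 := by
  have h := congrFun (congrFun ((mem_orthogonalGroup_iff _ _).1 hR) i) i'
  have h' : (∑ j, z i j * z i' j : ℝ) = 4 * (if i = i' then 1 else 0) := by
    rw [← Matrix.one_apply, ← h]
    change _ = 4 * ∑ j, R i j * R i' j
    rw [Finset.mul_sum]
    refine Finset.sum_congr rfl fun j _ => ?_
    rw [← hz, ← hz]
    ring
  have h2 : ((∑ j, z i j * z i' j : ℤ) : ℝ) = ((if i = i' then 4 else 0 : ℤ) : ℝ) := by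
    push_cast
    rw [h']
    split_ifs <;> norm_num
  exact_mod_cast h2

lemma sum_int_column (hR : R ∈ orthogonalGroup (Fin 12) ℝ) (hz : ∀ i j, 2 * R i j = z i j)
    (j : Fin 12) : ∑ i, z i j * z i j = 4 := by
  have hR' : Rᵀ ∈ orthogonalGroup (Fin 12) ℝ := by
    rw [mem_orthogonalGroup_iff, Matrix.transpose_transpose]
    exact (mem_orthogonalGroup_iff' _ _).1 hR
  simpa using sum_int_row (R := Rᵀ) (z := fun i j => z j i) hR' (fun i j => hz j i) j j

lemma eq_zero_of_four_le {f : Fin 12 → ℤ} (hf : ∑ j, f j * f j = 4) {j : Fin 12}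
    (hj : 4 ≤ f j * f j) {k : Fin 12} (hk : k ≠ j) : f k = 0 := by
  have := Finset.add_le_sum (fun i _ => mul_self_nonneg (f i)) (Finset.mem_univ j)
    (Finset.mem_univ k) hk.symm
  have h0 := mul_self_nonneg (f k)
  exact mul_self_eq_zero.1 (by omega)

lemma eq_zero_iff_of_int (hz : ∀ i j, 2 * R i j = z i j) (i j : Fin 12) :
    R i j ≠ 0 ↔ z i j ≠ 0 := by
  have := hz i j
  rw [← @Int.cast_ne_zero ℝ, ← this]
  simp

/-- The squares in each row and column of `2R` add up to 4, so an entry of absolute value at least 2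
is alone in its row and column and splits off as a block of order one. -/
lemma int_cases (hR : R ∈ orthogonalGroup (Fin 12) ℝ) (hz : ∀ i j, 2 * R i j = z i j)
    (hd : ¬ IsDecomposable R) (i j : Fin 12) : z i j = 0 ∨ z i j = 1 ∨ z i j = -1 := by
  by_contra hne
  have h4 : 4 ≤ z i j * z i j := by
    have : 2 ≤ z i j ∨ z i j ≤ -2 := by omega
    rcases this with h | h <;> nlinarith
  have hrow := fun k => eq_zero_of_four_le ((sum_int_row hR hz i i).trans (if_pos rfl)) h4 (k := k)
  have hcol := fun k => eq_zero_of_four_le (f := fun i => z i j) (sum_int_column hR hz j) h4 (k := k)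
  refine hd ⟨{i}, {j}, Finset.singleton_nonempty i, fun h => ?_, rfl, fun a b hab => ?_⟩
  · have h2 : i + 1 ∈ ({i} : Finset (Fin 12)) := by rw [h]; exact Finset.mem_univ _
    simp at h2
  · rw [eq_zero_iff_of_int hz] at hab
    simp only [Finset.mem_singleton]
    constructor
    · rintro rfl
      by_contra hb
      exact hab (hrow b hb)
    · rintro rfl
      by_contra ha
      exact hab (hcol a ha)

/-- The support of a row. -/
def rowSupport (z : Fin 12 → Fin 12 → ℤ) (i : Fin 12) : Finset (Fin 12) :=
  Finset.univ.filter fun j => z i j ≠ 0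

lemma mem_rowSupport {i j : Fin 12} : j ∈ rowSupport z i ↔ z i j ≠ 0 := by simp [rowSupport]

lemma isTetradSystem_rowSupport (hR : R ∈ orthogonalGroup (Fin 12) ℝ)
    (hz : ∀ i j, 2 * R i j = z i j) (hd : ¬ IsDecomposable R) :
    IsTetradSystem (rowSupport z) where
  card i := by
    have h := (sum_int_row hR hz i i).trans (if_pos rfl)
    have h2 : ((rowSupport z i).card : ℤ) = ∑ j, z i j * z i j := by
      rw [rowSupport, Finset.card_filter, Nat.cast_sum]
      refine Finset.sum_congr rfl fun j _ => ?_
      rcases int_cases hR hz hd i j with h | h | h <;> rw [h] <;> simp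
    omega
  even i t := by
    have hb : ∀ i j, bit (rowSupport z i) j = (z i j : ZMod 2) := by
      intro i j
      simp only [bit, mem_rowSupport]
      rcases int_cases hR hz hd i j with h | h | h <;> rw [h] <;> simp
    have h := congrArg (Int.cast : ℤ → ZMod 2) (sum_int_row hR hz i t)
    push_cast at h
    simp only [hb, h]
    split_ifs
    exacts [rfl, rfl]
  connected U hU hU' := by
    by_contra hne
    push Not at hne
    simp only [mem_rowSupport] at hne
    -- If no row crosses `U`, the rows meeting `U` and the columns in `U` form a block. It is square
    -- because its squared entries, added by rows and by columns, give 4 per row and 4 per column.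
    let S : Finset (Fin 12) := Finset.univ.filter fun i => ∃ j ∈ U, z i j ≠ 0
    have hS : ∀ i, i ∈ S ↔ ∃ j ∈ U, z i j ≠ 0 := fun i => by simp [S]
    have key : ∀ i j, z i j ≠ 0 → (i ∈ S ↔ j ∈ U) := by
      intro i j hij
      rw [hS]
      refine ⟨fun ⟨k, hk, hik⟩ => ?_, fun hj => ⟨j, hj, hij⟩⟩
      by_contra hj
      exact hij (by simpa using hne i ⟨k, hk, hik⟩ j hj)
    have hcol : ∀ j, ∃ i, z i j ≠ 0 := by
      intro j
      by_contra h0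
      push Not at h0
      have := sum_int_column hR hz j
      simp [h0] at this
    have hcard : (4 * S.card : ℤ) = 4 * U.card := by
      have h1 : ∑ i ∈ S, ∑ j, z i j * z i j = 4 * S.card := by
        rw [Finset.sum_congr rfl fun i _ => (sum_int_row hR hz i i).trans (if_pos rfl)]
        simp [mul_comm]
      have h2 : ∑ j ∈ U, ∑ i, z i j * z i j = 4 * U.card := by
        rw [Finset.sum_congr rfl fun j _ => sum_int_column hR hz j]
        simp [mul_comm]
      have h0 : ∀ i j, ¬ (i ∈ S ↔ j ∈ U) → z i j * z i j = 0 := fun i j h => by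
        rw [mul_self_eq_zero]
        by_contra hij
        exact h (key i j hij)
      rw [← h1, ← h2]
      calc ∑ i ∈ S, ∑ j, z i j * z i j = ∑ i ∈ S, ∑ j ∈ U, z i j * z i j :=
            Finset.sum_congr rfl fun i hi => (Finset.sum_subset (Finset.subset_univ U)
              fun j _ hj => h0 i j (by tauto)).symm
        _ = ∑ j ∈ U, ∑ i ∈ S, z i j * z i j := Finset.sum_comm
        _ = ∑ j ∈ U, ∑ i, z i j * z i j :=
            Finset.sum_congr rfl fun j hj => Finset.sum_subset (Finset.subset_univ S)
              fun i _ hi => h0 i j (by tauto)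
    obtain ⟨j, hj⟩ := hU
    obtain ⟨i, hi⟩ := hcol j
    refine hd ⟨S, U, ⟨i, (key i j hi).2 hj⟩, fun hSu => hU' ?_, by omega, fun i j hij =>
      key i j ((eq_zero_iff_of_int hz i j).1 hij)⟩
    rw [Finset.eq_univ_iff_forall] at hSu ⊢
    intro j
    obtain ⟨i, hi⟩ := hcol j
    exact (key i j hi).1 (hSu i)

/-- On a pair in the support either the sum or the difference is `±1` and the other is zero. The
absolute values add up to two and the sums to one, which leaves one sum equal to `1` and one
difference equal to `±1`. -/
lemma exists_row_form {p : Fin 6 × Fin 2 → ℝ} {q : Fin 6 × Fin 2 → ℤ} (hpq : ∀ x, 2 * p x = q x)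
    (hq : ∀ x, q x = 0 ∨ q x = 1 ∨ q x = -1) (hpair : ∀ k, q (k, 0) ≠ 0 ↔ q (k, 1) ≠ 0)
    (hsum : ∑ x, p x = 1) (hn : ∑ x, p x * p x = 1) :
    ∃ k m b, ∀ x, p x =
      ((if k = x.1 then 1 else 0) + (if m = x.1 then sg x.2 * sg b else 0)) / 2 := by
  have hp : ∀ x, p x = q x / 2 := fun x => by rw [← hpq]; ring
  have hUW : ∀ i, (p (i, 0) + p (i, 1) = 0 ∨ p (i, 0) + p (i, 1) = 1 ∨ p (i, 0) + p (i, 1) = -1) ∧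
      (p (i, 0) - p (i, 1) = 0 ∨ p (i, 0) - p (i, 1) = 1 ∨ p (i, 0) - p (i, 1) = -1) := by
    intro i
    have := hpair i
    rw [hp, hp]
    rcases hq (i, 0) with h0 | h0 | h0 <;> rcases hq (i, 1) with h1 | h1 | h1 <;>
      rw [h0, h1] at this ⊢ <;> revert this <;> norm_num
  have habs := sum_abs_add_sum_abs (fun i => (hUW i).1) (fun i => (hUW i).2) hn
  have hs : ∑ i, (p (i, 0) + p (i, 1)) = 1 := by
    rw [← hsum, Fintype.sum_prod_type]
    simp only [Fin.sum_univ_two]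
  have hWpos : 0 ≤ ∑ i, |p (i, 0) - p (i, 1)| := Finset.sum_nonneg fun i _ => abs_nonneg _
  have hU : ∀ i, p (i, 0) + p (i, 1) = 0 ∨ p (i, 0) + p (i, 1) = 1 := by
    intro i
    rcases (hUW i).1 with h | h | h
    · exact Or.inl h
    · exact Or.inr h
    · exfalso
      -- A pair sum `-1` contributes two to this nonnegative total, so the absolute pair sums would
      -- add up to at least three.
      have := Finset.single_le_sum (f := fun i => |p (i, 0) + p (i, 1)| - (p (i, 0) + p (i, 1)))
        (fun j _ => sub_nonneg.2 (le_abs_self _)) (Finset.mem_univ i)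
      simp only [Finset.sum_sub_distrib, h] at this
      norm_num at this
      linarith
  have hUabs : ∑ i, |p (i, 0) + p (i, 1)| = ∑ i, (p (i, 0) + p (i, 1)) :=
    Finset.sum_congr rfl fun i _ => abs_of_nonneg (by rcases hU i with h | h <;> rw [h]; norm_num)
  exact exists_pair_form hU (fun i => (hUW i).2) hs (by linarith)

/-- An indecomposable regular orthogonal matrix of order twelve, level two and row sum one is equal
to `R₁₂`, up to permutations of the rows and columns. -/
theorem exists_eq_R12_submatrix (hR : R ∈ orthogonalGroup (Fin 12) ℝ) (hrow : ∀ i, ∑ j, R i j = 1)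
    (hlevel : HasLevel R 2) (hd : ¬ IsDecomposable R) :
    ∃ e f : Fin 12 ≃ Fin 6 × Fin 2, R = R12.submatrix e f := by
  choose z hz using hlevel.1.2
  simp only [Nat.cast_ofNat] at hz
  obtain ⟨g, hg⟩ := (isTetradSystem_rowSupport hR hz hd).exists_pairing
  simp only [mem_rowSupport] at hg
  have horth : ∀ y y', ∑ x, R (g y) (g x) * R (g y') (g x) = if y = y' then 1 else 0 := by
    intro y y'
    have h := congrFun (congrFun ((mem_orthogonalGroup_iff _ _).1 hR) (g y)) (g y')
    rw [Matrix.one_apply] at h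
    simp only [g.injective.eq_iff] at h
    rw [← h]
    exact g.sum_comp fun j => R (g y) j * R (g y') j
  -- The structure is known for the rows of `R`, so the column criterion is applied to the
  -- transpose; this is where `τ⁻¹` comes from.
  obtain ⟨τ, f, hM⟩ := eq_pairMatrix_of_columns (M := Matrix.of fun x y => R (g y) (g x)) horth
    fun y => exists_row_form (q := fun x => z (g y) (g x)) (fun x => hz _ _)
      (fun x => int_cases hR hz hd _ _) (fun k => hg _ k)
      ((g.sum_comp fun j => R (g y) j).trans (hrow _)) ((horth y y).trans (if_pos rfl))
  have hRτ : R = (pairMatrix τ⁻¹).submatrix (g.symm.trans f) g.symm := by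
    rw [← pairMatrix_transpose]
    ext i j
    have := congrFun (congrFun hM (g.symm j)) (g.symm i)
    simpa using this
  obtain ⟨e, he⟩ := exists_pairMatrix_eq (σ := τ⁻¹) fun h => hd (by
    rw [hRτ]
    exact isDecomposable_submatrix h _ _)
  refine ⟨(g.symm.trans f).trans e, g.symm.trans e, ?_⟩
  rw [hRτ, he]
  rfl

end LevelTwo

end TwelveSwitch

theorem theorem5p12 :
    -- the switching operation: it yields a graph, by conjugation, and this graph is cospectral
    (∀ {V : Type*} [Fintype V] [DecidableEq V] (G : SimpleGraph V) (c : Fin 6 × Fin 2 ↪ V),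
      ParityCondition G c →
      (∃ k, Equivalent (table k) (inducedAdj G c)) →
      ∃ G' : SimpleGraph V, IsSwitched G G' c ∧ (∀ H, IsSwitched G H c → H = G') ∧
        adj G' = (extendAlong c).transpose * adj G * extendAlong c ∧
        RCospectral G G') ∧
    -- the table lists the irreducible switching sets of `R12`, each of them once
    (∀ B : Matrix (Fin 6 × Fin 2) (Fin 6 × Fin 2) ℝ,
      IsIrreducible R12 B ↔ ∃ k, Equivalent (table k) B) ∧
    (∀ k l, Equivalent (table k) (table l) → k = l) ∧
    -- there are no others for any indecomposable matrix of order 12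
    (∀ R : Matrix (Fin 12) (Fin 12) ℝ,
      R ∈ Matrix.orthogonalGroup (Fin 12) ℝ → (∀ i, ∑ j, R i j = 1) →
      HasLevel R 2 → ¬ IsDecomposable R →
      ∃ e f : Fin 12 ≃ Fin 6 × Fin 2, R = R12.submatrix e f ∧
        ∀ B : Matrix (Fin 12) (Fin 12) ℝ,
          IsIrreducible R B ↔ ∃ k, Equivalent (table k) (B.submatrix e.symm e.symm)) := by
  refine ⟨fun G c hP ⟨k, hk⟩ => ?_, isIrreducible_R12_iff, fun k l => eq_of_equivalent_table,
    fun R hR hrow hlevel hd => ?_⟩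
  · obtain ⟨G', hG', hadj⟩ := exists_isSwitched hP ((isIrreducible_R12_iff _).2 ⟨k, hk⟩).1
    exact ⟨G', hG', fun H hH => hH.unique hG', hadj, rCospectral_of_adj_eq hadj⟩
  · obtain ⟨e, f, hef⟩ := exists_eq_R12_submatrix hR hrow hlevel hd
    refine ⟨e, f, hef, fun B => ?_⟩
    rw [← isIrreducible_R12_iff, ← isIrreducible_submatrix_iff e f, ← hef]
    simp
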